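/- **Conventions.** A surface spread over the sphere is a pair $(S,f)$, where $S$ is a connected topological surface without boundary (compact or not) and $f\colon S\to\hat{\mathbb C}$ is continuous, open and discrete. Its singular values are its critical values (images of points at which the local degree of $f$ exceeds $1$) and its asymptotic values (limits of $f$ along paths $[0,1)\to S$ that leave every compact set). It is in the Speiser class $\mathcal S$ if it has finitely many singular values. A pointed surface $(S,f,w)$ has in addition a base point $w\in S$ that is not critical. Write $(S_1,f_1,w_1)\subset(S_2,f_2,w_2)$ if there is a continuous injection $\phi\colon S_1\to S_2$ with $\phi(w_1)=w_2$ and $f_2\circ\phi=f_1$; the two are equivalent if $\phi$ can be taken to be a homeomorphism. For a sequence $(S_n,f_n,w_n)$ consider the pointed surfaces $(S,f,w)$ with the following property: there is a closed discrete set $E\subset S$, $w\notin E$, such that for every compact $K\subset S\setminus E$ with $w\in K$ and for all sufficiently large $n$ there is a continuous embedding $\phi\colon K\to S_n$ with $\phi(w)=w_n$ and $f_n\circ\phi=f$ on $K$. A kernel of the sequence is a pointed surface that is maximal with respect to $\subset$, up to equivalence, among those with this property. The sequence converges to $(S,f,w)$ in the sense of Carathéodory if there are a point $q\in\hat{\mathbb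 C}$ and a disk $B$ centred at $q$ such that, for every $n$, $f_n(w_n)=q$ and $f_n$ maps some domain containing $w_n$ homeomorphically onto $B$, and if $(S,f,w)$ is a kernel of every subsequence. Let $\beta\subset\hat{\mathbb C}$ be a Jordan curve with distinct points $b_1,\dots,b_k$, $k\ge1$, in cyclic order on it. Fix a point $\times$ in one of the two components (the hemispheres) of $\hat{\mathbb C}\setminus\beta$ and a point $\circ$ in the other, and for each $j$ join $\times$ to $\circ$ by an edge that crosses $\beta$ exactly once, on the arc from $b_j$ to $b_{j+1}$ (cyclically), the edges being otherwise disjoint. For a surface $(S,f)$ all of whose singular values lie in $\{b_1,\dots,b_k\}$, the labeled Speiser graph with labels $b_1,\dots,b_k$ is the preimage of this graph under $f$: its vertices are the points over $\times$ and $\circ$, and each edge over the $j$-th one lies between a face labeled $b_j$ and a face labeled $b_{j+1}$. The hemisphere of $S$ corresponding to a vertex is the component of the preimage of the respective hemisphere of $\hat{\mathbb C}$ that contains the vertex. Isometries of labeled Speiser graphs are graph isomorphisms that preserve the two kinds of vertices and the index $j$ of every edge (that is, the labels of the faces). **Theorem 4.1.** Let $k\ge2$. Let the points $a_1,a_2,\dots,a_{k-1},a_k(n)$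 be distinct and in cyclic order on a fixed Jordan curve $\beta\subset\hat{\mathbb C}$ for every $n\in\mathbb N$, and let $a_k(n)\to a_1$ as $n\to\infty$. Let $(S_n,f_n,w_n)$ be pointed surfaces spread over the sphere such that all singular values of $f_n$ lie in $\{a_1,\dots,a_{k-1},a_k(n)\}$, and suppose that for all $n$ the labeled Speiser graph of $(S_n,f_n)$ with these labels is isometric, by an isometry $\iota_n$, to one and the same labeled graph $\Gamma$. Suppose that $(S_n,f_n,w_n)$ converges in the sense of Carathéodory to a pointed surface $(S,f,w)$, that $f_n(w_n)=f(w)\ne a_1$ for all $n$, and that for some vertex $p$ of $\Gamma$ the point $w_n$ lies, for all $n$, in the closure of the hemisphere of $S_n$ corresponding to $\iota_n(p)$. Let $\Gamma'$ be the connected component containing $p$ of the graph obtained from $\Gamma$ by removing all edges between $a_k(n)$ and $a_1$, that is, the edges with index $k$, which cross the arc of $\beta$ from $a_k(n)$ to $a_1$; faces that merge are labeled $a_1$. Then: 1. $(S,f)$ belongs to $\mathcal S$, and all its singular values are among $a_1,\dots,a_{k-1}$. More precisely, for $1\le j\le k-1$, the point $a_j$ is a singular value of $f$ if and only if some face of $\Gamma'$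 labeled $a_j$ is not a digon (a face bounded by exactly two edges). 2. $\Gamma'$ is the labeled Speiser graph of $(S,f)$ with labels $a_1,\dots,a_{k-1}$: there is an isometry $\kappa$ from $\Gamma'$ onto it, and $w$ lies in the closure of the hemisphere of $S$ corresponding to $\kappa(p)$. -/

import Mathlib

open Set Filter Topology

universe u v w

/-- A surface spread over the sphere: a connected topological surface (Hausdorff, second countable,
locally homeomorphic to the plane, without boundary, compact or not) together with a continuous,
open and discrete map to the Riemann sphere `OnePoint ℂ`, the projection. -/
structure SpreadSurface where
  carrier : Type u
  [top : TopologicalSpace carrier]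
  [hausdorff : T2Space carrier]
  [secondCountable : SecondCountableTopology carrier]
  [connected : ConnectedSpace carrier]
  locally_planar : ∀ x : carrier, ∃ e : OpenPartialHomeomorph carrier ℂ, x ∈ e.source
  proj : carrier → OnePoint ℂ
  continuous_proj : Continuous proj
  isOpenMap_proj : IsOpenMap proj
  discrete_proj : ∀ y : OnePoint ℂ, IsDiscrete (proj ⁻¹' {y})

attribute [instance] SpreadSurface.top SpreadSurface.hausdorff SpreadSurface.secondCountable
  SpreadSurface.connected

namespace SpreadSurface

/-- Critical points of the projection: the points where the local degree exceeds one. Near any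
point the projection looks like `z ↦ z ^ d`, so `d > 1` means that it is injective on no
neighbourhood of the point. -/
def IsCriticalPoint (S : SpreadSurface.{u}) (x : S.carrier) : Prop :=
  ¬ ∃ U ∈ 𝓝 x, InjOn S.proj U

/-- Asymptotic values: limits of the projection along paths `γ : [0, 1) → S` that leave every
compact set. -/
def IsAsymptoticValue (S : SpreadSurface.{u}) (a : OnePoint ℂ) : Prop :=
  ∃ γ : ℝ → S.carrier, ContinuousOn γ (Ico 0 1) ∧
    Tendsto γ (𝓝[<] (1 : ℝ)) (cocompact S.carrier) ∧
    Tendsto (fun r => S.proj (γ r)) (𝓝[<] (1 : ℝ)) (𝓝 a)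

/-- The singular values are the critical values and the asymptotic values. -/
def singularValues (S : SpreadSurface.{u}) : Set (OnePoint ℂ) :=
  {a | (∃ x, S.IsCriticalPoint x ∧ S.proj x = a) ∨ S.IsAsymptoticValue a}

/-- The Speiser class. -/
def IsSpeiser (S : SpreadSurface.{u}) : Prop :=
  S.singularValues.Finite

end SpreadSurface

/-- A pointed surface spread over the sphere; the base point is not critical. -/
structure PointedSpreadSurface extends SpreadSurface.{u} where
  base : carrier
  base_not_critical : ¬ toSpreadSurface.IsCriticalPoint base

namespace PointedSpreadSurface

/-- The order relation `T₁ ⊂ T₂`. -/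
def Embeds (T₁ T₂ : PointedSpreadSurface.{u}) : Prop :=
  ∃ φ : T₁.carrier → T₂.carrier, Continuous φ ∧ Function.Injective φ ∧
    φ T₁.base = T₂.base ∧ ∀ x, T₂.proj (φ x) = T₁.proj x

/-- The equivalence relation `T₁ ∼ T₂`. -/
def Equivalent (T₁ T₂ : PointedSpreadSurface.{u}) : Prop :=
  ∃ φ : T₁.carrier ≃ₜ T₂.carrier, φ T₁.base = T₂.base ∧ ∀ x, T₂.proj (φ x) = T₁.proj x

/-- There is a closed discrete exceptional set `E` avoiding the base point of `T` such that every
compact subset of `T` minus `E` that contains the base point embeds, over the sphere and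
respecting base points, into all but finitely many members of the sequence. -/
def Approximates (T : PointedSpreadSurface.{u}) (X : ℕ → PointedSpreadSurface.{u}) : Prop :=
  ∃ E : Set T.carrier, IsClosed E ∧ IsDiscrete E ∧ T.base ∉ E ∧
    ∀ K : Set T.carrier, IsCompact K → Disjoint K E → T.base ∈ K →
      ∃ N : ℕ, ∀ n, N < n → ∃ φ : T.carrier → (X n).carrier,
        ContinuousOn φ K ∧ InjOn φ K ∧ φ T.base = (X n).base ∧
          ∀ x ∈ K, (X n).proj (φ x) = T.proj x

/-- `T` is a kernel of the sequence `X`: it is maximal, with respect to the order relation and up to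
equivalence, among the pointed surfaces that approximate `X`. -/
def IsKernel (T : PointedSpreadSurface.{u}) (X : ℕ → PointedSpreadSurface.{u}) : Prop :=
  T.Approximates X ∧
    ∀ T' : PointedSpreadSurface.{u}, T'.Approximates X → T.Embeds T' → T.Equivalent T'

/-- The standing assumption on sequences of pointed surfaces: the base points lie over a common
point `p`, and one connected neighbourhood `B` of `p` (a disk centred at `p`, say) is the
homeomorphic image of a domain around every base point. As the projections are continuous and
open, bijectivity suffices for a homeomorphism. -/
def UniformAtBase (X : ℕ → PointedSpreadSurface.{u}) : Prop :=
  ∃ (p : OnePoint ℂ) (B : Set (OnePoint ℂ)), IsOpen B ∧ IsConnected B ∧ p ∈ B ∧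
    ∀ n, (X n).proj (X n).base = p ∧
      ∃ W : Set (X n).carrier, IsOpen W ∧ IsConnected W ∧ (X n).base ∈ W ∧ BijOn (X n).proj W B

/-- Convergence in the sense of Carathéodory: `T` is a kernel of every subsequence. -/
def CaratheodoryConverges (X : ℕ → PointedSpreadSurface.{u}) (T : PointedSpreadSurface.{u}) :
    Prop :=
  UniformAtBase X ∧ ∀ σ : ℕ → ℕ, StrictMono σ → T.IsKernel (fun n => X (σ n))

end PointedSpreadSurface

/-- A labeled graph of the kind to which Speiser graphs belong, with `k` labels `a 0, …, a (k - 1)`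
in cyclic order: a bipartite graph with vertices of the two kinds `×` and `∘`, in which
`edge j x y` says that `x` and `y` are joined by an edge that has a face labeled `a j` on one side
and a face labeled `a (j + 1)` (cyclically) on the other. The cyclic order of the edges at a vertex
is the one of the indices `j` at `×` and its reverse at `∘`, and the faces labeled `a j` are the
circuits whose edges have the indices `j - 1` and `j` alternately. -/
structure LabeledGraph (k : ℕ) where
  Cross : Type v
  Circ : Type v
  edge : Fin k → Cross → Circ → Prop

namespace LabeledGraph

/-- The vertices, of both kinds. -/
abbrev Vertex {k : ℕ} (G : LabeledGraph.{v} k) : Type v := G.Cross ⊕ G.Circ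

/-- The underlying simple graph (multiple edges identified). -/
def simple {k : ℕ} (G : LabeledGraph.{v} k) : SimpleGraph G.Vertex :=
  SimpleGraph.fromRel fun p q => ∃ j x y, p = Sum.inl x ∧ q = Sum.inr y ∧ G.edge j x y

/-- Isomorphisms (isometries) of labeled graphs: they preserve the two kinds of vertices, and the
edges with the labels on their two sides. -/
structure Iso {k : ℕ} (G : LabeledGraph.{v} k) (H : LabeledGraph.{w} k) where
  cross : G.Cross ≃ H.Cross
  circ : G.Circ ≃ H.Circ
  edge_iff : ∀ j x y, H.edge j (cross x) (circ y) ↔ G.edge j x y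

/-- The action of an isomorphism on vertices. -/
def Iso.vertex {k : ℕ} {G : LabeledGraph.{v} k} {H : LabeledGraph.{w} k} (ι : G.Iso H) :
    G.Vertex → H.Vertex :=
  Sum.map ι.cross ι.circ

/-- Remove the edges between the faces with the last label and the faces with the first label
`a 0`. The faces that get merged keep the label `a 0`. (If there are only two labels, the edges
removed are those that cross the arc leading from the last label to the first one in the cyclic
order.) -/
def deleteLast {k : ℕ} (G : LabeledGraph.{v} (k + 1)) : LabeledGraph.{v} k where
  Cross := G.Cross
  Circ := G.Circ
  edge j x y := G.edge j.castSucc x y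

/-- The connected component of the vertex `p`. -/
def component {k : ℕ} (G : LabeledGraph.{v} k) (p : G.Vertex) : LabeledGraph.{v} k where
  Cross := {x : G.Cross // G.simple.Reachable p (Sum.inl x)}
  Circ := {y : G.Circ // G.simple.Reachable p (Sum.inr y)}
  edge j x y := G.edge j x.1 y.1

/-- The vertex `p` as a vertex of its connected component. -/
def root {k : ℕ} (G : LabeledGraph.{v} k) : (p : G.Vertex) → (G.component p).Vertex
  | Sum.inl x => Sum.inl ⟨x, SimpleGraph.Reachable.refl _⟩
  | Sum.inr y => Sum.inr ⟨y, SimpleGraph.Reachable.refl _⟩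

/-- Some face labeled `a j` is not a digon: at some vertex `×`, the two consecutive edges that bound
a face labeled `a j` lead to different vertices. -/
def HasNonDigon {k : ℕ} [NeZero k] (G : LabeledGraph.{v} k) (j : Fin k) : Prop :=
  ∃ x y, G.edge j x y ∧ ¬ G.edge (j - 1) x y

end LabeledGraph

/-- A base curve: a closed curve in the sphere that divides it into two topological hemispheres. It
is given as the image of the extended real line under a homeomorphism of the sphere; by the
Schoenflies theorem these are all Jordan curves, and the point that comes from `∞` can be any
point of the curve. -/
structure BaseCurve where
  homeo : OnePoint ℂ ≃ₜ OnePoint ℂ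

namespace BaseCurve

/-- The point of the sphere with coordinate `z`. -/
noncomputable def point (β : BaseCurve) (z : ℂ) : OnePoint ℂ := β.homeo (z : OnePoint ℂ)

/-- The curve itself. -/
noncomputable def curve (β : BaseCurve) : Set (OnePoint ℂ) :=
  insert (β.homeo OnePoint.infty) (β.point '' {z | z.im = 0})

/-- The upper hemisphere. -/
noncomputable def upper (β : BaseCurve) : Set (OnePoint ℂ) := β.point '' {z | 0 < z.im}

/-- The lower hemisphere. -/
noncomputable def lower (β : BaseCurve) : Set (OnePoint ℂ) := β.point '' {z | z.im < 0}

/-- The `m + 1` labels on the curve given by `m` real parameters `t 0 < ⋯ < t (m - 1)`: the first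
label is the point that comes from `∞`, and the others follow in the cyclic order of the curve. -/
noncomputable def label (β : BaseCurve) {m : ℕ} (t : Fin m → ℝ) : Fin (m + 1) → OnePoint ℂ :=
  Fin.cons (β.homeo OnePoint.infty) (fun i => β.point (t i : ℂ))

/-- Parameters of the open arc of the curve from the `j`-th label to the cyclically next one:
`(-∞, t 0)`, then `(t 0, t 1)`, and so on, and finally `(t (m - 1), ∞)`. -/
def arc {m : ℕ} (t : Fin m → ℝ) (j : Fin (m + 1)) : Set ℝ :=
  {s | ∀ i : Fin m, (i.castSucc < j → t i < s) ∧ (j ≤ i.castSucc → s < t i)}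

/-- The vertex `×` of the graph `G_β`, in the upper hemisphere. -/
noncomputable def crossPt (β : BaseCurve) : OnePoint ℂ := β.point Complex.I

/-- The vertex `∘` of the graph `G_β`, in the lower hemisphere. -/
noncomputable def circPt (β : BaseCurve) : OnePoint ℂ := β.point (-Complex.I)

/-- The edge of the graph `G_β` that runs from `×` to `∘` and crosses the curve once, at the parameter
`s`; in coordinates it is the polygon `i, s, -i`, run through for `r` from `0` to `1`. -/
noncomputable def crossing (β : BaseCurve) (s : ℝ) (r : ℝ) : OnePoint ℂ :=
  β.point (((s * (1 - |1 - 2 * r|) : ℝ) : ℂ) + ((1 - 2 * r : ℝ) : ℂ) * Complex.I)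

end BaseCurve

namespace SpreadSurface

/-- The labeled Speiser graph of `S` for the base curve `β` and the labels with parameters `t`: the
preimage of `G_β` under the projection. The vertices are the points over `×` and `∘`, and the edges
are the lifts of the edges of `G_β`. -/
def speiserGraph (S : SpreadSurface.{u}) (β : BaseCurve) {m : ℕ} (t : Fin m → ℝ) :
    LabeledGraph.{u} (m + 1) where
  Cross := {x : S.carrier // S.proj x = β.crossPt}
  Circ := {y : S.carrier // S.proj y = β.circPt}
  edge j x y := ∃ s ∈ BaseCurve.arc t j, ∃ c : Path x.1 y.1,
    ∀ r : unitInterval, S.proj (c r) = β.crossing s r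

/-- The hemisphere of `S` that corresponds to a vertex of the Speiser graph: the connected component
of the preimage of the upper or the lower hemisphere that contains the vertex. -/
def hemisphere (S : SpreadSurface.{u}) (β : BaseCurve) {m : ℕ} (t : Fin m → ℝ) :
    (S.speiserGraph β t).Vertex → Set S.carrier
  | Sum.inl x => connectedComponentIn (S.proj ⁻¹' β.upper) x.1
  | Sum.inr y => connectedComponentIn (S.proj ⁻¹' β.lower) y.1

end SpreadSurface

/-- Append one more label, at the parameter `s`, behind all the others. -/
def appendMark {m : ℕ} (t : Fin m → ℝ) (s : ℝ) : Fin (m + 1) → ℝ :=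
  Fin.snoc (α := fun _ => ℝ) t s

/-! Put `a_1` at infinity and the base curve on the extended real line. Then `a_k(n)` is a real
parameter `s n` with `|s n| → ∞`, while the other labels and the base value stay in a fixed disk.
Cut along the preimage of the curve, each surface falls into half-planes, one for every vertex of
its Speiser graph, glued along the arcs between labels as the edges prescribe. This is the notion
`IsSheeting`; path lifting provides it for the given surfaces
(`SpreadSurface.exists_isSheeting_speiserGraph`). On a bounded part of the plane one of the two arcs
that end at `a_k(n)` is eventually out of sight, and gluings along it cannot be noticed. To make
this exact, the plane is retracted to a half-plane on one side of `s n` by clamping the real part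
(`IsSheeting.comp_clampAbove`). Composed with the retraction the half-planes are glued according to
`Γ` without the edges of one index, and on large disks the retraction is the identity.

The core is that a kernel is decomposed into half-planes indexed by the component `Γ'` of `p`
(`IsKernel.exists_isSheeting`). On the one hand, every surface with such a decomposition and the
right base point approximates the sequence, as its compact parts are mapped sheet by sheet
(`approximates_of_isSheeting`). On the other hand, let `T` be any approximating surface. The
embeddings of its compact parts lead to pull-backs of the members of the sequence under the
retractions, and these pull-backs depend on the graph only (`exists_pullback_map`). All the
embeddings start on the sheet of `p`, so by uniqueness of lifts they unite to one injection of `T`,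
minus the points over labels, into the component of `p` in a fixed pull-back. Gluing `T` to this
component gives a larger surface that is decomposed along `Γ'` (`exists_embeds_isSheeting`); it
approximates the sequence, so by maximality it is `T` itself.

The rest is local at the labels. A decomposed surface has no singular values off the labels, and its
graph is its Speiser graph (`IsSheeting.iso`). In a corner of a face that is not a digon one runs
into a critical point or out of the surface (`mem_singularValues_of_hasNonDigon`). A digon is a
punctured disk mapped injectively, and maximality forces a kernel to contain the puncture
(`IsKernel.exists_point_of_digon`); hence a label all of whose faces are digons is not singular. -/

section Topology

/-! ### Uniqueness of lifts, local sections, removal of countable sets -/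

/-- Lifts of a map on a preconnected set that agree at one point agree, provided that the projection
is injective near the points where they agree. -/
theorem IsPreconnected.eqOn_of_lift {Ξ Y S : Type*} [TopologicalSpace Ξ] [TopologicalSpace Y]
    [T2Space Y] {A : Set Ξ} (hA : IsPreconnected A) {f g : Ξ → Y} (hf : ContinuousOn f A)
    (hg : ContinuousOn g A) (π : Y → S) (hπ : ∀ a ∈ A, π (f a) = π (g a))
    (hinj : ∀ a ∈ A, f a = g a → ∃ N ∈ 𝓝 (f a), InjOn π N) {a₀ : Ξ} (ha₀ : a₀ ∈ A)
    (h₀ : f a₀ = g a₀) : EqOn f g A := by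
  have := isPreconnected_iff_preconnectedSpace.1 hA
  rw [continuousOn_iff_continuous_domRestrict] at hf hg
  have hcl : IsClosed {a : A | A.domRestrict f a = A.domRestrict g a} := isClosed_eq hf hg
  have hop : IsOpen {a : A | A.domRestrict f a = A.domRestrict g a} := by
    rw [isOpen_iff_mem_nhds]
    intro a ha
    obtain ⟨N, hN, hNi⟩ := hinj a a.2 ha
    have hN' : N ∈ 𝓝 (A.domRestrict g a) := by
      rw [← show A.domRestrict f a = A.domRestrict g a from ha]; exact hN
    filter_upwards [hf.continuousAt hN, hg.continuousAt hN'] with b hb hb'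
    exact hNi hb hb' (hπ b b.2)
  have huniv := IsClopen.eq_univ ⟨hcl, hop⟩ ⟨⟨a₀, ha₀⟩, h₀⟩
  intro a ha
  have : (⟨a, ha⟩ : A) ∈ {a : A | A.domRestrict f a = A.domRestrict g a} := by rw [huniv]; trivial
  exact this

/-- Near a point of a section of a locally injective map, all points over the domain of the section
lie on the section. -/
theorem eventually_mem_section {Y S : Type*} [TopologicalSpace Y] [TopologicalSpace S]
    {π : Y → S} {s : S → Y} {A : Set S} {w : S} (hw : w ∈ A) (hs : ContinuousWithinAt s A w)
    (hsec : ∀ w' ∈ A, π (s w') = w') (hπ : ContinuousAt π (s w))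
    (hinj : ∃ N ∈ 𝓝 (s w), InjOn π N) : ∀ᶠ y in 𝓝 (s w), π y ∈ A → s (π y) = y := by
  obtain ⟨N, hN, hNi⟩ := hinj
  have h1 : Tendsto π (𝓝 (s w)) (𝓝 w) := by
    have := hπ.tendsto
    rwa [hsec w hw] at this
  have h2 := h1.eventually (eventually_nhdsWithin_iff.1 (hs hN))
  filter_upwards [h2, hN] with y hy hyN hyA
  exact hNi (hy hyA) hyN (hsec _ hyA)

/-- A continuous open map has a continuous inverse near a point where it is locally injective. -/
theorem exists_local_section {Y S : Type*} [TopologicalSpace Y] [TopologicalSpace S]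
    {π : Y → S} (ho : IsOpenMap π) {y : Y} {N : Set Y} (hN : N ∈ 𝓝 y)
    (hNi : InjOn π N) : ∃ (U : Set Y) (s : S → Y), IsOpen U ∧ y ∈ U ∧ U ⊆ N ∧
      (∀ x ∈ U, s (π x) = x) ∧ IsOpen (π '' U) ∧ ContinuousOn s (π '' U) := by
  classical
  have : Nonempty Y := ⟨y⟩
  have hinv : ∀ x ∈ interior N, Function.invFunOn π (interior N) (π x) = x := fun x hx =>
    (hNi.mono interior_subset).leftInvOn_invFunOn hx
  refine ⟨interior N, Function.invFunOn π (interior N), isOpen_interior,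
    mem_interior_iff_mem_nhds.2 hN, interior_subset, hinv, ho _ isOpen_interior, ?_⟩
  rintro _ ⟨x, hx, rfl⟩
  refine ContinuousAt.continuousWithinAt ?_
  intro M hM
  rw [hinv x hx] at hM
  have h1 : π '' (interior M ∩ interior N) ∈ 𝓝 (π x) :=
    (ho _ (isOpen_interior.inter isOpen_interior)).mem_nhds
      ⟨x, ⟨mem_interior_iff_mem_nhds.2 hM, hx⟩, rfl⟩
  rw [mem_map]
  filter_upwards [h1]
  rintro _ ⟨x', hx', rfl⟩
  rw [mem_preimage, hinv x' hx'.2]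
  exact interior_subset hx'.1

/-- In a space that is locally homeomorphic to the plane, every point has arbitrarily small open
neighbourhoods that remain connected if countably many points are removed. -/
theorem exists_nhds_isConnected_diff {Y : Type*} [TopologicalSpace Y] {x : Y}
    (hx : ∃ e : OpenPartialHomeomorph Y ℂ, x ∈ e.source) {N : Set Y} (hN : N ∈ 𝓝 x) :
    ∃ V ⊆ N, IsOpen V ∧ x ∈ V ∧ ∀ F : Set Y, F.Countable → IsConnected (V \ F) := by
  obtain ⟨e, hxe⟩ := hx
  have h1 : e.symm ⁻¹' N ∩ e.target ∈ 𝓝 (e x) := by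
    refine inter_mem ?_ (e.open_target.mem_nhds (e.map_source hxe))
    apply (e.continuousAt_symm (e.map_source hxe))
    rwa [e.left_inv hxe]
  obtain ⟨r, hr, hball⟩ := Metric.mem_nhds_iff.1 h1
  have hmaps : MapsTo (OpenPartialHomeomorph.univBall (e x) r) univ (Metric.ball (e x) r) := by
    have := (OpenPartialHomeomorph.univBall (e x) r).mapsTo
    rwa [OpenPartialHomeomorph.univBall_source,
      OpenPartialHomeomorph.univBall_target _ hr] at this
  have hbt : Metric.ball (e x) r ⊆ e.target := fun z hz => (hball hz).2
  -- A ball in a chart is reparametrized by the whole plane, where complements of countable sets are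
  -- known to be path connected.
  set h : ℂ → Y := fun z => e.symm (OpenPartialHomeomorph.univBall (e x) r z) with hh
  have hcont : Continuous h := by
    refine e.continuousOn_symm.comp_continuous (OpenPartialHomeomorph.continuous_univBall _ _) ?_
    intro z
    exact hbt (hmaps (mem_univ z))
  have hinj : Function.Injective h := by
    intro a b hab
    have h2 := e.symm.injOn (hbt (hmaps (mem_univ a))) (hbt (hmaps (mem_univ b))) hab
    refine (OpenPartialHomeomorph.univBall (e x) r).injOn ?_ ?_ h2 <;>
    simp [OpenPartialHomeomorph.univBall_source]
  have himg : range h = e.symm '' Metric.ball (e x) r := by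
    have : range (OpenPartialHomeomorph.univBall (e x) r) = Metric.ball (e x) r := by
      rw [← image_univ, ← OpenPartialHomeomorph.univBall_source (e x) r,
        OpenPartialHomeomorph.image_source_eq_target, OpenPartialHomeomorph.univBall_target _ hr]
    rw [← this, ← range_comp]
    rfl
  refine ⟨range h, ?_, ?_, ?_, ?_⟩
  · rw [himg]
    rintro _ ⟨z, hz, rfl⟩
    exact (hball hz).1
  · rw [himg]
    exact e.symm.isOpen_image_of_subset_source Metric.isOpen_ball hbt
  · rw [himg]
    exact ⟨e x, Metric.mem_ball_self hr, e.left_inv hxe⟩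
  · intro F hF
    have : range h \ F = h '' (h ⁻¹' F)ᶜ := by
      ext y
      constructor
      · rintro ⟨⟨z, rfl⟩, hz⟩
        exact ⟨z, hz, rfl⟩
      · rintro ⟨z, hz, rfl⟩
        exact ⟨⟨z, rfl⟩, hz⟩
    rw [this]
    refine IsConnected.image ?_ _ hcont.continuousOn
    refine (Set.Countable.isPathConnected_compl_of_one_lt_rank ?_
      (hF.preimage_of_injOn hinj.injOn)).isConnected
    simp

/-- Removing countably many points does not disconnect a connected surface. -/
theorem isPreconnected_compl_countable {Y : Type*} [TopologicalSpace Y] [PreconnectedSpace Y]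
    (hY : ∀ x : Y, ∃ e : OpenPartialHomeomorph Y ℂ, x ∈ e.source) {D : Set Y}
    (hD : D.Countable) : IsPreconnected Dᶜ := by
  have key : ∀ x : Y, ∃ V, IsOpen V ∧ x ∈ V ∧ IsConnected (V \ D) := fun x => by
    obtain ⟨V, -, h1, h2, h3⟩ := exists_nhds_isConnected_diff (hY x) univ_mem
    exact ⟨V, h1, h2, h3 D hD⟩
  intro U W hU hW hUW ⟨a, haD, haU⟩ ⟨b, hbD, hbW⟩
  by_contra hemp
  have hemp' : ∀ z, z ∈ Dᶜ → z ∈ U → z ∈ W → False := fun z h1 h2 h3 => hemp ⟨z, h1, h2, h3⟩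
  -- A separation of the complement of `D` by `U` and `W` is extended to all of `Y`: a point goes to
  -- `A` or `B` according to the side that contains a punctured neighbourhood of it.
  let A : Set Y := {x | ∃ V, IsOpen V ∧ x ∈ V ∧ V \ D ⊆ U}
  let B : Set Y := {x | ∃ V, IsOpen V ∧ x ∈ V ∧ V \ D ⊆ W}
  have hA : IsOpen A := by
    rw [isOpen_iff_mem_nhds]
    rintro x ⟨V, h1, h2, h3⟩
    filter_upwards [h1.mem_nhds h2] with y hy
    exact ⟨V, h1, hy, h3⟩
  have hB : IsOpen B := by
    rw [isOpen_iff_mem_nhds]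
    rintro x ⟨V, h1, h2, h3⟩
    filter_upwards [h1.mem_nhds h2] with y hy
    exact ⟨V, h1, hy, h3⟩
  have hAB : univ ⊆ A ∪ B := by
    intro x _
    obtain ⟨V, h1, h2, h3⟩ := key x
    by_cases hVW : (V \ D ∩ W).Nonempty
    · right
      refine ⟨V, h1, h2, fun z hz => ?_⟩
      by_contra hzW
      have hzU : z ∈ U := (hUW hz.2).resolve_right hzW
      obtain ⟨y, hy, hyU, hyW⟩ := h3.isPreconnected U W hU hW
        (fun y hy => hUW hy.2) ⟨z, hz, hzU⟩ hVW
      exact hemp' y hy.2 hyU hyW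
    · left
      refine ⟨V, h1, h2, fun z hz => (hUW hz.2).resolve_right fun h => hVW ⟨z, hz, h⟩⟩
  obtain ⟨x, -, ⟨V, hV, hxV, hVU⟩, ⟨V', hV', hxV', hVW'⟩⟩ :=
    isPreconnected_univ A B hA hB hAB ⟨a, trivial, U, hU, haU, fun z hz => hz.1⟩
      ⟨b, trivial, W, hW, hbW, fun z hz => hz.1⟩
  obtain ⟨V'', hs, -, -, h3⟩ := exists_nhds_isConnected_diff (hY x)
    ((hV.inter hV').mem_nhds ⟨hxV, hxV'⟩)
  obtain ⟨z, hz⟩ := (h3 D hD).nonempty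
  exact hemp' z hz.2 (hVU ⟨(hs hz.1).1, hz.2⟩) (hVW' ⟨(hs hz.1).2, hz.2⟩)

theorem dense_compl_countable {Y : Type*} [TopologicalSpace Y]
    (hY : ∀ x : Y, ∃ e : OpenPartialHomeomorph Y ℂ, x ∈ e.source) {D : Set Y}
    (hD : D.Countable) : Dense Dᶜ := by
  rw [dense_iff_inter_open]
  rintro U hU ⟨x, hx⟩
  obtain ⟨V, hs, -, -, h3⟩ := exists_nhds_isConnected_diff (hY x) (hU.mem_nhds hx)
  obtain ⟨z, hz⟩ := (h3 D hD).nonempty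
  exact ⟨z, hs hz.1, hz.2⟩

theorem IsDiscrete.countable_of_secondCountable {Y : Type*} [TopologicalSpace Y]
    [SecondCountableTopology Y] {D : Set Y} (hD : IsDiscrete D) : D.Countable := by
  have := hD.to_subtype
  exact countable_of_Lindelof_of_discrete |>.to_set

/-- A path that is not asymptotic returns to some compact set again and again; the cluster point
found there is where the path can be continued or is seen to end. -/
theorem exists_mapClusterPt_of_not_tendsto_cocompact {α Y : Type*} [TopologicalSpace Y]
    {l : Filter α} {γ : α → Y} (h : ¬ Tendsto γ l (cocompact Y)) : ∃ x, MapClusterPt x l γ := by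
  rw [(hasBasis_cocompact (X := Y)).tendsto_right_iff] at h
  push Not at h
  obtain ⟨K, hK, hfr⟩ := h
  have hfr' : ∃ᶠ a in l, γ a ∈ K := by
    refine hfr.mono fun a ha => ?_
    simpa using ha
  obtain ⟨x, -, hx⟩ := hK.exists_mapClusterPt_of_frequently hfr'
  exact ⟨x, hx⟩

theorem eventually_nhdsNE_not_mem_of_isDiscrete {Y : Type*} [TopologicalSpace Y] {D : Set Y}
    (hc : IsClosed D) (hD : IsDiscrete D) (x : Y) : ∀ᶠ y in 𝓝 x, y ∈ D → y = x := by
  by_cases hx : x ∈ D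
  · have h := isDiscrete_iff_nhdsWithin.1 hD x hx
    have h1 : {x} ∈ 𝓝[D] x := by rw [h]; exact mem_pure.2 rfl
    exact eventually_nhdsWithin_iff.1 h1
  · filter_upwards [hc.isOpen_compl.mem_nhds hx] with y hy hyD using absurd hyD hy

end Topology

/-! ### Gluing two surfaces over the sphere -/

section Gluing

/-- The fibres of `π` are discrete if and only if near every point `x` the value `π x` is taken at
`x` only. -/
theorem isDiscrete_fibers_iff {Y S : Type*} [TopologicalSpace Y] {π : Y → S} :
    (∀ y, IsDiscrete (π ⁻¹' {y})) ↔ ∀ x, ∀ᶠ x' in 𝓝 x, π x' = π x → x' = x := by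
  simp only [isDiscrete_iff_nhdsWithin]
  constructor
  · intro h x
    have h1 : {x} ∈ 𝓝[π ⁻¹' {π x}] x := by rw [h (π x) x rfl]; exact mem_pure.2 rfl
    exact eventually_nhdsWithin_iff.1 h1
  · rintro h _ x rfl
    refine le_antisymm ?_ (pure_le_nhdsWithin rfl)
    rw [le_pure_iff]
    exact eventually_nhdsWithin_iff.2 (h x)

/-- The topology on a union of two spaces in which a set is open if its two parts are. -/
@[reducible] def glueTopology {A B X : Type*} [TopologicalSpace A] [TopologicalSpace B] (iA : A → X)
    (iB : B → X) : TopologicalSpace X where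
  IsOpen U := IsOpen (iA ⁻¹' U) ∧ IsOpen (iB ⁻¹' U)
  isOpen_univ := ⟨isOpen_univ, isOpen_univ⟩
  isOpen_inter _ _ h h' := ⟨h.1.inter h'.1, h.2.inter h'.2⟩
  isOpen_sUnion s h := by
    constructor <;> rw [preimage_sUnion]
    · exact isOpen_biUnion fun t ht => (h t ht).1
    · exact isOpen_biUnion fun t ht => (h t ht).2

theorem locally_planar_of_isOpenEmbedding {A X : Type*} [TopologicalSpace A] [TopologicalSpace X]
    {i : A → X} (hi : IsOpenEmbedding i) {a : A}
    (ha : ∃ e : OpenPartialHomeomorph A ℂ, a ∈ e.source) :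
    ∃ e : OpenPartialHomeomorph X ℂ, i a ∈ e.source := by
  obtain ⟨e, he⟩ := ha
  have : Nonempty A := ⟨a⟩
  refine ⟨(hi.toOpenPartialHomeomorph i).symm.trans e, ?_⟩
  rw [OpenPartialHomeomorph.trans_source]
  refine ⟨by simp, ?_⟩
  have h1 : (hi.toOpenPartialHomeomorph i).symm (i a) = a :=
    (hi.toOpenPartialHomeomorph i).left_inv (by simp)
  rw [mem_preimage, h1]
  exact he

/-- A surface spread over the sphere may be glued to another one along open subsets, provided that
the result is Hausdorff. -/
theorem SpreadSurface.exists_glue (T : SpreadSurface.{u}) (B : Type*) [TopologicalSpace B]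
    [T2Space B] [SecondCountableTopology B] [PreconnectedSpace B]
    (hB : ∀ x : B, ∃ e : OpenPartialHomeomorph B ℂ, x ∈ e.source)
    (πB : B → OnePoint ℂ) (hcB : Continuous πB) (hoB : IsOpenMap πB)
    (hdB : ∀ y, IsDiscrete (πB ⁻¹' {y})) (X : Type u) (iA : T.carrier → X) (iB : B → X)
    (hA : Function.Injective iA) (hBi : Function.Injective iB)
    (hAB : ∀ x, x ∈ range iA ∨ x ∈ range iB)
    (hπ : ∀ a b, iA a = iB b → T.proj a = πB b)
    (hoAB : ∀ O : Set B, IsOpen O → IsOpen (iA ⁻¹' (iB '' O)))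
    (hoBA : ∀ O : Set T.carrier, IsOpen O → IsOpen (iB ⁻¹' (iA '' O)))
    (hsep : ∀ a b, T.proj a = πB b → iA a ≠ iB b →
      ∃ U ∈ 𝓝 a, ∃ V ∈ 𝓝 b, Disjoint (iA '' U) (iB '' V))
    (hne : ∃ a b, iA a = iB b) :
    ∃ (S : SpreadSurface.{u}) (jA : T.carrier → S.carrier) (jB : B → S.carrier),
      IsOpenEmbedding jA ∧ IsOpenEmbedding jB ∧ (∀ a, S.proj (jA a) = T.proj a) ∧
      (∀ b, S.proj (jB b) = πB b) ∧ (∀ x, x ∈ range jA ∨ x ∈ range jB) ∧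
      ∀ a b, jA a = jB b ↔ iA a = iB b := by
  classical
  let _ : TopologicalSpace X := glueTopology iA iB
  have hop : ∀ U : Set X, IsOpen U ↔ IsOpen (iA ⁻¹' U) ∧ IsOpen (iB ⁻¹' U) := fun U => Iff.rfl
  have hAo : IsOpenEmbedding iA := by
    refine IsOpenEmbedding.of_continuous_injective_isOpenMap ⟨fun U hU => ((hop U).1 hU).1⟩ hA ?_
    intro U hU
    rw [hop, preimage_image_eq _ hA]
    exact ⟨hU, hoBA U hU⟩
  have hBo : IsOpenEmbedding iB := by
    refine IsOpenEmbedding.of_continuous_injective_isOpenMap ⟨fun U hU => ((hop U).1 hU).2⟩ hBi ?_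
    intro U hU
    rw [hop, preimage_image_eq _ hBi]
    exact ⟨hoAB U hU, hU⟩
  have hex : ∀ x, ∃ w, (∀ a, iA a = x → T.proj a = w) ∧ (∀ b, iB b = x → πB b = w) := by
    intro x
    rcases hAB x with ⟨a, rfl⟩ | ⟨b, rfl⟩
    · exact ⟨T.proj a, fun a' h => by rw [hA h], fun b h => (hπ a b h.symm).symm⟩
    · exact ⟨πB b, fun a h => hπ a b h, fun b' h => by rw [hBi h]⟩
  choose π hπA hπB using hex
  have hπA' : ∀ a, π (iA a) = T.proj a := fun a => (hπA _ a rfl).symm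
  have hπB' : ∀ b, π (iB b) = πB b := fun b => (hπB _ b rfl).symm
  have hcont : Continuous π := by
    refine ⟨fun U hU => ⟨?_, ?_⟩⟩
    · rw [← preimage_comp, show π ∘ iA = T.proj from funext hπA']
      exact hU.preimage T.continuous_proj
    · rw [← preimage_comp, show π ∘ iB = πB from funext hπB']
      exact hU.preimage hcB
  have hopen : IsOpenMap π := by
    intro U hU
    have : π '' U = T.proj '' (iA ⁻¹' U) ∪ πB '' (iB ⁻¹' U) := by
      ext w
      constructor
      · rintro ⟨x, hx, rfl⟩
        rcases hAB x with ⟨a, rfl⟩ | ⟨b, rfl⟩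
        · exact Or.inl ⟨a, hx, (hπA' a).symm⟩
        · exact Or.inr ⟨b, hx, (hπB' b).symm⟩
      · rintro (⟨a, ha, rfl⟩ | ⟨b, hb, rfl⟩)
        · exact ⟨_, ha, hπA' a⟩
        · exact ⟨_, hb, hπB' b⟩
    rw [this]
    exact (T.isOpenMap_proj _ ((hop U).1 hU).1).union (hoB _ ((hop U).1 hU).2)
  have hdisc : ∀ y, IsDiscrete (π ⁻¹' {y}) := by
    rw [isDiscrete_fibers_iff]
    intro x
    rcases hAB x with ⟨a, rfl⟩ | ⟨b, rfl⟩
    · rw [← hAo.map_nhds_eq, eventually_map]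
      filter_upwards [isDiscrete_fibers_iff.1 T.discrete_proj a] with a' ha' h
      rw [hπA', hπA'] at h
      rw [ha' h]
    · rw [← hBo.map_nhds_eq, eventually_map]
      filter_upwards [isDiscrete_fibers_iff.1 hdB b] with a' ha' h
      rw [hπB', hπB'] at h
      rw [ha' h]
  have hmix : ∀ a b, iA a ≠ iB b →
      ∃ U V : Set X, IsOpen U ∧ IsOpen V ∧ iA a ∈ U ∧ iB b ∈ V ∧ Disjoint U V := by
    intro a b hne
    -- Points with different projections are separated by the projection itself, so `hsep` is needed
    -- only for points over the same value.
    by_cases hp : T.proj a = πB b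
    · obtain ⟨U, hU, V, hV, hd⟩ := hsep a b hp hne
      refine ⟨iA '' interior U, iB '' interior V, hAo.isOpenMap _ isOpen_interior,
        hBo.isOpenMap _ isOpen_interior, mem_image_of_mem _ (mem_interior_iff_mem_nhds.2 hU),
        mem_image_of_mem _ (mem_interior_iff_mem_nhds.2 hV), ?_⟩
      exact hd.mono (image_mono interior_subset) (image_mono interior_subset)
    · obtain ⟨U, V, hU, hV, h1, h2, h3⟩ := t2_separation hp
      refine ⟨π ⁻¹' U, π ⁻¹' V, hU.preimage hcont, hV.preimage hcont, ?_, ?_, h3.preimage π⟩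
      · rwa [mem_preimage, hπA']
      · rwa [mem_preimage, hπB']
  have hT2 : T2Space X := by
    constructor
    intro x y hxy
    rcases hAB x with ⟨a, rfl⟩ | ⟨a, rfl⟩ <;> rcases hAB y with ⟨b, rfl⟩ | ⟨b, rfl⟩
    · obtain ⟨U, V, hU, hV, h1, h2, h3⟩ := t2_separation (fun h : a = b => hxy (by rw [h]))
      exact ⟨_, _, hAo.isOpenMap _ hU, hAo.isOpenMap _ hV, mem_image_of_mem _ h1,
        mem_image_of_mem _ h2, (disjoint_image_iff hA).2 h3⟩
    · exact hmix a b hxy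
    · obtain ⟨U, V, hU, hV, h1, h2, h3⟩ := hmix b a hxy.symm
      exact ⟨V, U, hV, hU, h2, h1, h3.symm⟩
    · obtain ⟨U, V, hU, hV, h1, h2, h3⟩ := t2_separation (fun h : a = b => hxy (by rw [h]))
      exact ⟨_, _, hBo.isOpenMap _ hU, hBo.isOpenMap _ hV, mem_image_of_mem _ h1,
        mem_image_of_mem _ h2, (disjoint_image_iff hBi).2 h3⟩
  have hSC : SecondCountableTopology X := by
    have hsA : SecondCountableTopology (range iA) :=
      hAo.isEmbedding.toHomeomorph.symm.secondCountableTopology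
    have hsB : SecondCountableTopology (range iB) :=
      hBo.isEmbedding.toHomeomorph.symm.secondCountableTopology
    have : ∀ b : Bool, SecondCountableTopology (cond b (range iA) (range iB) : Set X) := by
      rintro (_ | _) <;> assumption
    refine TopologicalSpace.secondCountableTopology_of_countable_cover
      (U := fun b : Bool => (cond b (range iA) (range iB) : Set X)) ?_ ?_
    · rintro (_ | _)
      · exact hBo.isOpen_range
      · exact hAo.isOpen_range
    · refine eq_univ_of_forall fun x => mem_iUnion.2 ?_
      rcases hAB x with h | h
      · exact ⟨true, h⟩
      · exact ⟨false, h⟩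
  have hconn : ConnectedSpace X := by
    obtain ⟨a, b, hab⟩ := hne
    have h1 : IsPreconnected (range iA ∪ range iB) :=
      IsPreconnected.union (iA a) ⟨a, rfl⟩ ⟨b, hab.symm⟩ (isPreconnected_range hAo.continuous)
        (isPreconnected_range hBo.continuous)
    have h2 : range iA ∪ range iB = univ := eq_univ_of_forall hAB
    rw [h2] at h1
    exact { isPreconnected_univ := h1, toNonempty := ⟨iA a⟩ }
  refine ⟨{ carrier := X, locally_planar := ?_, proj := π, continuous_proj := hcont,
            isOpenMap_proj := hopen, discrete_proj := hdisc }, iA, iB, hAo, hBo, hπA', hπB', hAB,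
            fun a b => Iff.rfl⟩
  intro x
  rcases hAB x with ⟨a, rfl⟩ | ⟨b, rfl⟩
  · exact locally_planar_of_isOpenEmbedding hAo (T.locally_planar a)
  · exact locally_planar_of_isOpenEmbedding hBo (hB b)

end Gluing

/-! ### Coordinates on the sphere with the first label at infinity -/

namespace BaseCurve

variable (β : BaseCurve) {m : ℕ} (t : Fin m → ℝ)

theorem isOpenEmbedding_point : IsOpenEmbedding β.point :=
  β.homeo.isOpenEmbedding.comp OnePoint.isOpenEmbedding_coe

theorem point_inj {z z' : ℂ} : β.point z = β.point z' ↔ z = z' :=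
  β.isOpenEmbedding_point.injective.eq_iff

theorem continuous_point : Continuous β.point := β.isOpenEmbedding_point.continuous

/-- The coordinate of a point of the sphere; a left inverse of `BaseCurve.point`. -/
noncomputable def coord (w : OnePoint ℂ) : ℂ := (β.homeo.symm w).elim 0 id

@[simp]
theorem coord_point (z : ℂ) : β.coord (β.point z) = z := by
  simp [coord, point]

theorem continuousAt_coord (z : ℂ) : ContinuousAt β.coord (β.point z) := by
  rw [ContinuousAt, ← β.isOpenEmbedding_point.map_nhds_eq, tendsto_map'_iff, coord_point]
  rw [show β.coord ∘ β.point = id from funext β.coord_point]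
  exact tendsto_id

@[simp]
theorem label_zero : β.label t 0 = β.homeo OnePoint.infty := rfl

@[simp]
theorem label_succ (i : Fin m) : β.label t i.succ = β.point (t i : ℂ) := by
  simp [label]

theorem point_ne_label_zero (z : ℂ) : β.point z ≠ β.label t 0 := by
  rw [label_zero, point]
  exact fun h => OnePoint.coe_ne_infty z (β.homeo.injective h)

theorem exists_eq_point {w : OnePoint ℂ} (h : w ≠ β.label t 0) : ∃ z, w = β.point z := by
  have h1 : β.homeo.symm w ≠ OnePoint.infty := by
    intro h2
    apply h
    rw [label_zero, ← h2, β.homeo.apply_symm_apply]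
  obtain ⟨z, hz⟩ := OnePoint.ne_infty_iff_exists.1 h1
  exact ⟨z, by rw [point, hz, β.homeo.apply_symm_apply]⟩

end BaseCurve

/-! ### Half-planes, slit planes and arcs in the coordinate plane -/

section Planar

variable {m : ℕ} (t : Fin m → ℝ)

/-- The plane without the marked points. -/
def markedPlane : Set ℂ := {z | ∀ i, z ≠ (t i : ℂ)}

/-- The closed upper (for `ε = 1`) or lower (for `ε = -1`) half-plane without the marked points. -/
def closedHalf (ε : ℝ) : Set ℂ := {z | 0 ≤ ε * z.im ∧ z ∈ markedPlane t}

/-- The plane slit along those arcs of the real line whose indices do not belong to `J`. -/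
def slitPlane (J : Set (Fin (m + 1))) : Set ℂ :=
  {z | z.im ≠ 0 ∨ ∃ j ∈ J, z.re ∈ BaseCurve.arc t j}

variable {t}

theorem mem_markedPlane_of_im_ne {z : ℂ} (h : z.im ≠ 0) : z ∈ markedPlane t := by
  rintro i rfl
  simp at h

theorem ne_of_mem_arc {j : Fin (m + 1)} {s : ℝ} (hs : s ∈ BaseCurve.arc t j) (i : Fin m) :
    s ≠ t i := by
  rcases lt_or_ge i.castSucc j with h | h
  · exact ((hs i).1 h).ne'
  · exact ((hs i).2 h).ne

theorem ofReal_mem_markedPlane {j : Fin (m + 1)} {s : ℝ} (hs : s ∈ BaseCurve.arc t j) :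
    (s : ℂ) ∈ markedPlane t := fun i h => ne_of_mem_arc hs i (by exact_mod_cast h)

theorem ofReal_mem_closedHalf {j : Fin (m + 1)} {s : ℝ} (hs : s ∈ BaseCurve.arc t j) (ε : ℝ) :
    (s : ℂ) ∈ closedHalf t ε := ⟨by simp, ofReal_mem_markedPlane hs⟩

theorem slitPlane_subset (J : Set (Fin (m + 1))) : slitPlane t J ⊆ markedPlane t := by
  rintro z (h | ⟨j, -, hj⟩) i rfl
  · simp at h
  · exact ne_of_mem_arc hj i (by simp)

theorem isOpen_arc (j : Fin (m + 1)) : IsOpen (BaseCurve.arc t j) := by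
  have : BaseCurve.arc t j = ⋂ i : Fin m,
      {s | (i.castSucc < j → t i < s)} ∩ {s | (j ≤ i.castSucc → s < t i)} := by
    ext s
    simp [BaseCurve.arc]
  rw [this]
  refine isOpen_iInter_of_finite fun i => IsOpen.inter ?_ ?_
  · by_cases h : i.castSucc < j
    · simp only [h, true_imp_iff]; exact isOpen_Ioi
    · simp [h]
  · by_cases h : j ≤ i.castSucc
    · simp only [h, true_imp_iff]; exact isOpen_Iio
    · simp [h]

theorem ordConnected_arc (j : Fin (m + 1)) : (BaseCurve.arc t j).OrdConnected :=
  ⟨fun _ hx _ hy _ hz i => ⟨fun h => ((hx i).1 h).trans_le hz.1, fun h => hz.2.trans_lt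
    ((hy i).2 h)⟩⟩

theorem nonempty_arc (ht : StrictMono t) (j : Fin (m + 1)) : (BaseCurve.arc t j).Nonempty := by
  classical
  obtain ⟨s, h1, h2⟩ := Order.exists_between_finsets
    ((Finset.univ.filter fun i : Fin m => i.castSucc < j).image t)
    ((Finset.univ.filter fun i : Fin m => j ≤ i.castSucc).image t) (by
      simp only [Finset.mem_image, Finset.mem_filter, Finset.mem_univ, true_and]
      rintro _ ⟨i, hi, rfl⟩ _ ⟨i', hi', rfl⟩
      exact ht (Fin.castSucc_lt_castSucc_iff.1 (hi.trans_le hi')))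
  refine ⟨s, fun i => ⟨fun h => h1 _ ?_, fun h => h2 _ ?_⟩⟩
  · simpa using ⟨i, h, rfl⟩
  · simpa using ⟨i, h, rfl⟩

theorem exists_mem_arc (ht : StrictMono t) {s : ℝ} (hs : ∀ i, s ≠ t i) :
    ∃ j, s ∈ BaseCurve.arc t j := by
  classical
  -- The index of the arc is the least `n` such that all marks from `t n` on lie beyond `s`; the
  -- value `m` always qualifies.
  have hex : ∃ n : ℕ, ∀ i : Fin m, n ≤ i → s < t i := ⟨m, fun i hi => absurd i.2 (by omega)⟩
  have hle : Nat.find hex ≤ m := Nat.find_min' hex fun i hi => absurd i.2 (by omega)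
  refine ⟨⟨Nat.find hex, by omega⟩, fun i => ⟨fun h => ?_, fun h => Nat.find_spec hex i ?_⟩⟩
  · have h1 : (i : ℕ) < Nat.find hex := by simpa [Fin.lt_def] using h
    have h2 := Nat.find_min hex (m := Nat.find hex - 1) (by omega)
    push Not at h2
    obtain ⟨i', hi', hs'⟩ := h2
    have h3 : ¬ Nat.find hex ≤ i' := fun h => absurd (Nat.find_spec hex i' h) (not_lt.2 hs')
    have h4 : i ≤ i' := by rw [Fin.le_def]; omega
    exact (ht.monotone h4).trans_lt (lt_of_le_of_ne hs' (hs i').symm)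
  · simpa [Fin.le_def] using h

theorem mem_slitPlane_of_mem_markedPlane (ht : StrictMono t) {z : ℂ} (hz : z ∈ markedPlane t) :
    ∃ j, z ∈ slitPlane t {j} := by
  by_cases h : z.im = 0
  · have h1 : z = (z.re : ℂ) := Complex.ext (by simp) (by simp [h])
    obtain ⟨j, hj⟩ := exists_mem_arc ht (s := z.re) fun i hi => hz i (by rw [h1, hi])
    exact ⟨j, Or.inr ⟨j, rfl, hj⟩⟩
  · exact ⟨0, Or.inl h⟩

theorem isOpen_slitPlane (J : Set (Fin (m + 1))) : IsOpen (slitPlane t J) := by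
  have : slitPlane t J = {z | z.im ≠ 0} ∪ ⋃ j ∈ J, Complex.re ⁻¹' BaseCurve.arc t j := by
    ext z; simp [slitPlane]
  rw [this]
  refine IsOpen.union (isOpen_ne_fun Complex.continuous_im continuous_const) ?_
  exact isOpen_biUnion fun j _ => (isOpen_arc j).preimage Complex.continuous_re

/-- A segment from `± i` into the closed half-plane can meet the real line only at its far end, so
it avoids the marks. -/
theorem starConvex_closedHalf {ε : ℝ} (hε : ε = 1 ∨ ε = -1) :
    StarConvex ℝ ((ε : ℂ) * Complex.I) (closedHalf t ε) := by
  have hεε : ε * ε = 1 := by rcases hε with rfl | rfl <;> norm_num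
  intro z hz a b ha hb hab
  have him : (a • ((ε : ℂ) * Complex.I) + b • z).im = a * ε + b * z.im := by simp
  have h0 : ε * (a • ((ε : ℂ) * Complex.I) + b • z).im = a + b * (ε * z.im) := by
    rw [him]
    linear_combination a * hεε
  have hnn : 0 ≤ b * (ε * z.im) := mul_nonneg hb hz.1
  refine ⟨by rw [h0]; positivity, ?_⟩
  rcases ha.eq_or_lt with rfl | ha'
  · have : b = 1 := by linarith
    subst this
    simpa using hz.2
  · apply mem_markedPlane_of_im_ne
    intro h
    rw [h] at h0
    simp at h0
    linarith

theorem mul_I_mem_closedHalf {ε : ℝ} (hε : ε = 1 ∨ ε = -1) :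
    (ε : ℂ) * Complex.I ∈ closedHalf t ε := by
  have hεε : ε * ε = 1 := by rcases hε with rfl | rfl <;> norm_num
  refine ⟨by simp [hεε], mem_markedPlane_of_im_ne ?_⟩
  rcases hε with rfl | rfl <;> simp

theorem isPreconnected_closedHalf {ε : ℝ} (hε : ε = 1 ∨ ε = -1) :
    IsPreconnected (closedHalf t ε) :=
  ((starConvex_closedHalf hε).isPathConnected (mul_I_mem_closedHalf hε)).isConnected.isPreconnected

theorem isPreconnected_openHalf (ε : ℝ) : IsPreconnected {z : ℂ | 0 < ε * z.im} := by
  refine Convex.isPreconnected ?_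
  have : {z : ℂ | 0 < ε * z.im} = {z | 0 < (ε • Complex.imLm) z} := by ext; simp
  rw [this]
  exact convex_halfSpace_gt (LinearMap.isLinear _) 0

theorem openHalf_subset_closedHalf (ε : ℝ) : {z : ℂ | 0 < ε * z.im} ⊆ closedHalf t ε := by
  intro z hz
  refine ⟨le_of_lt hz, mem_markedPlane_of_im_ne fun h => ?_⟩
  simp [h] at hz

theorem isOpen_openHalf (ε : ℝ) : IsOpen {z : ℂ | 0 < ε * z.im} :=
  isOpen_lt continuous_const (continuous_const.mul Complex.continuous_im)

/-- Indices are cyclic: the arc before the first label is the last one. -/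
theorem Fin.zero_sub_one_eq_last (m : ℕ) : (0 : Fin (m + 1)) - 1 = Fin.last m := by
  rw [sub_eq_iff_eq_add]; simp

theorem Fin.succ_sub_one_eq_castSucc {m : ℕ} (i : Fin m) :
    (i.succ : Fin (m + 1)) - 1 = i.castSucc := by
  rw [sub_eq_iff_eq_add]; simp

/-- The label at `t i` has index `i.succ`, because index `0` is taken by infinity. The arc with the
index of a label starts there, the one with the preceding index ends there. -/
theorem mem_arc_succ (ht : StrictMono t) (i : Fin m) :
    ∀ᶠ x in 𝓝 (t i), (t i < x → x ∈ BaseCurve.arc t i.succ) ∧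
      (x < t i → x ∈ BaseCurve.arc t (i.succ - 1)) := by
  have h1 : ∀ᶠ x in 𝓝 (t i), ∀ i', (i' < i → t i' < x) ∧ (i < i' → x < t i') := by
    rw [eventually_all]
    intro i'
    refine Filter.Eventually.and ?_ ?_
    · by_cases h : i' < i
      · filter_upwards [lt_mem_nhds (ht h)] with x hx _ using hx
      · simp [h]
    · by_cases h : i < i'
      · filter_upwards [gt_mem_nhds (ht h)] with x hx _ using hx
      · simp [h]
  filter_upwards [h1] with x hx
  rw [Fin.succ_sub_one_eq_castSucc]
  refine ⟨fun h i' => ⟨fun h' => ?_, fun h' => ?_⟩, fun h i' => ⟨fun h' => ?_, fun h' => ?_⟩⟩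
  · rcases (show i' ≤ i from Fin.castSucc_lt_succ_iff.1 h').lt_or_eq with h2 | rfl
    · exact (hx i').1 h2
    · exact h
  · exact (hx i').2 (Fin.succ_le_castSucc_iff.1 h')
  · exact (hx i').1 (Fin.castSucc_lt_castSucc_iff.1 h')
  · rcases (Fin.castSucc_le_castSucc_iff.1 h').lt_or_eq with h2 | rfl
    · exact (hx i').2 h2
    · exact h

/-- The two arcs that meet at infinity: far to the right the real line is the last arc, far to the
left the first one. -/
theorem mem_arc_zero (t : Fin m → ℝ) :
    ∃ R : ℝ, 0 < R ∧ ∀ x, (R < x → x ∈ BaseCurve.arc t (0 - 1)) ∧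
      (x < -R → x ∈ BaseCurve.arc t 0) ∧ ∀ i, |t i| < R := by
  obtain ⟨R, hR⟩ := (Set.finite_range fun i => |t i|).bddAbove
  have hR' : ∀ i, |t i| ≤ R := fun i => hR ⟨i, rfl⟩
  refine ⟨|R| + 1, by positivity, fun x => ⟨fun hx i => ?_, fun hx i => ?_, fun i => ?_⟩⟩
  · rw [Fin.zero_sub_one_eq_last]
    refine ⟨fun _ => ?_, fun h => absurd h (not_le.2 (Fin.castSucc_lt_last i))⟩
    linarith [le_abs_self (t i), hR' i, le_abs_self R]
  · refine ⟨fun h => absurd h (not_lt.2 (Fin.zero_le _)), fun _ => ?_⟩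
    linarith [neg_abs_le (t i), hR' i, le_abs_self R]
  · linarith [hR' i, le_abs_self R]

end Planar

/-! ### Neighbourhoods of the labels -/

namespace BaseCurve

variable (β : BaseCurve) {m : ℕ} {t : Fin m → ℝ}

theorem not_mem_range_label_iff {w : OnePoint ℂ} :
    w ∉ range (β.label t) ↔ ∃ z ∈ markedPlane t, w = β.point z := by
  constructor
  · intro h
    obtain ⟨z, rfl⟩ := β.exists_eq_point t fun h' => h ⟨0, h'.symm⟩
    exact ⟨z, fun i hi => h ⟨i.succ, by rw [label_succ, hi]⟩, rfl⟩
  · rintro ⟨z, hz, rfl⟩ ⟨j, hj⟩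
    induction j using Fin.cases with
    | zero => exact β.point_ne_label_zero t z hj.symm
    | succ i =>
      rw [label_succ, point_inj] at hj
      exact hz i hj.symm

theorem hasBasis_nhds_label_zero (t : Fin m → ℝ) :
    (𝓝 (β.label t 0)).HasBasis (fun _ : ℝ => True)
      fun R => insert (β.label t 0) (β.point '' {z | R < ‖z‖}) := by
  rw [label_zero, ← β.homeo.map_nhds_eq, OnePoint.nhds_infty_eq, coclosedCompact_eq_cocompact,
    ← Metric.cobounded_eq_cocompact]
  have h1 : (comap norm atTop : Filter ℂ).HasBasis (fun _ : ℝ => True) fun R => {z | R < ‖z‖} :=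
    (atTop_basis_Ioi (α := ℝ)).comap norm
  rw [comap_norm_atTop] at h1
  have h2 := ((h1.map (fun z : ℂ => (z : OnePoint ℂ))).sup_pure OnePoint.infty).map β.homeo
  refine h2.to_hasBasis (fun R _ => ⟨R, trivial, ?_⟩) (fun R _ => ⟨R, trivial, ?_⟩)
  · rintro _ (rfl | ⟨z, hz, rfl⟩)
    · exact ⟨_, Or.inr rfl, rfl⟩
    · exact ⟨_, Or.inl ⟨z, hz, rfl⟩, rfl⟩
  · rintro _ ⟨_, (⟨z, hz, rfl⟩ | rfl), rfl⟩
    · exact Or.inr ⟨z, hz, rfl⟩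
    · exact Or.inl rfl

/-- Near a label, the sphere is covered by the label, the two hemispheres and the two adjacent
arcs. -/
theorem eventually_mem_slitPlane (ht : StrictMono t) (j : Fin (m + 1)) :
    ∀ᶠ w in 𝓝 (β.label t j), w ≠ β.label t j → ∃ z ∈ slitPlane t {j - 1, j}, w = β.point z := by
  induction j using Fin.cases with
  | zero =>
    obtain ⟨R, -, hR⟩ := mem_arc_zero t
    rw [(β.hasBasis_nhds_label_zero t).eventually_iff]
    refine ⟨R, trivial, ?_⟩
    rintro _ (rfl | ⟨z, hz, rfl⟩) hne
    · exact absurd rfl hne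
    · refine ⟨z, ?_, rfl⟩
      by_cases h : z.im = 0
      · have h1 : z = (z.re : ℂ) := Complex.ext (by simp) (by simp [h])
        rw [mem_ofPred_eq, h1, Complex.norm_real, Real.norm_eq_abs, lt_abs] at hz
        rcases hz with hz | hz
        · exact Or.inr ⟨_, Or.inl rfl, (hR _).1 hz⟩
        · exact Or.inr ⟨0, by simp, (hR _).2.1 (by linarith)⟩
      · exact Or.inl h
  | succ i =>
    rw [label_succ, ← β.isOpenEmbedding_point.map_nhds_eq, eventually_map]
    have h1 := (Complex.continuous_re.tendsto (t i : ℂ)).eventually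
      (show ∀ᶠ x in 𝓝 ((t i : ℂ).re), _ from mem_arc_succ ht i)
    filter_upwards [h1] with z hz hne
    rw [Ne, point_inj] at hne
    refine ⟨z, ?_, rfl⟩
    by_cases h : z.im = 0
    · have h1 : z = (z.re : ℂ) := Complex.ext (by simp) (by simp [h])
      rcases lt_trichotomy z.re (t i) with h2 | h2 | h2
      · exact Or.inr ⟨_, Or.inl rfl, hz.2 h2⟩
      · exact absurd (h1.trans (by rw [h2])) hne
      · exact Or.inr ⟨i.succ, by simp, hz.1 h2⟩
    · exact Or.inl h

/-- A label as a corner of the upper half-plane: a chart from the half-strip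
`{re < M, 0 ≤ im ≤ π}`, the two edges of which go to the two arcs that end at the label. -/
theorem exists_corner_chart (ht : StrictMono t) (j : Fin (m + 1)) :
    ∃ (e : ℂ → ℂ) (M : ℝ), Continuous e ∧
      Tendsto (fun w => β.point (e w)) (comap Complex.re atBot) (𝓝 (β.label t j)) ∧
      Tendsto (fun w => β.point (starRingEnd ℂ (e w))) (comap Complex.re atBot)
        (𝓝 (β.label t j)) ∧
      (∀ w, w.re < M → 0 ≤ w.im → w.im ≤ Real.pi → 0 ≤ (e w).im ∧ e w ∈ markedPlane t) ∧
      ∀ x : ℝ, x < M → ∃ s₁ ∈ BaseCurve.arc t j, ∃ s₂ ∈ BaseCurve.arc t (j - 1),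
        (e x = s₁ ∧ e (x + Real.pi * Complex.I) = s₂) ∨
        (e x = s₂ ∧ e (x + Real.pi * Complex.I) = s₁) := by
  induction j using Fin.cases with
  | zero =>
    obtain ⟨R, hR0, hR⟩ := mem_arc_zero t
    have hnorm : ∀ w : ℂ, ‖Complex.exp (-(starRingEnd ℂ w))‖ = Real.exp (-w.re) := by
      intro w; simp [Complex.norm_exp]
    have hbig : ∀ x : ℝ, x < -Real.log R → R < Real.exp (-x) := by
      intro x hx
      rw [← Real.log_lt_iff_lt_exp hR0]
      linarith
    have hexp : ∀ R', ∀ᶠ x in (atBot : Filter ℝ), R' < Real.exp (-x) := fun R' =>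
      (Real.tendsto_exp_atTop.comp tendsto_neg_atBot_atTop).eventually_gt_atTop R'
    -- At infinity the chart needs modulus `exp (-re w)`, which grows as `re w → -∞`, and argument
    -- `im w`, which keeps the image in the closed upper half-plane. The bound `-log R` makes the
    -- modulus exceed `R`.
    refine ⟨fun w => Complex.exp (-(starRingEnd ℂ w)), -Real.log R, by fun_prop, ?_, ?_, ?_, ?_⟩
    · rw [(β.hasBasis_nhds_label_zero t).tendsto_right_iff]
      intro R' _
      filter_upwards [(hexp R').comap Complex.re] with w hw
      exact Or.inr ⟨_, by rw [mem_ofPred_eq, hnorm]; exact hw, rfl⟩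
    · rw [(β.hasBasis_nhds_label_zero t).tendsto_right_iff]
      intro R' _
      filter_upwards [(hexp R').comap Complex.re] with w hw
      exact Or.inr ⟨_, by rw [mem_ofPred_eq, Complex.norm_conj, hnorm]; exact hw, rfl⟩
    · intro w hw h0 hπ
      refine ⟨?_, fun i hi => ?_⟩
      · rw [Complex.exp_im]
        simp only [Complex.neg_im, Complex.conj_im, neg_neg]
        exact mul_nonneg (Real.exp_pos _).le (Real.sin_nonneg_of_nonneg_of_le_pi h0 hπ)
      · have h1 := hnorm w
        rw [show Complex.exp (-(starRingEnd ℂ w)) = t i from hi, Complex.norm_real, Real.norm_eq_abs] at h1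
        have h2 := (hR 0).2.2 i
        have h3 := hbig _ hw
        linarith
    · intro x hx
      refine ⟨-Real.exp (-x), (hR _).2.1 (by linarith [hbig x hx]), Real.exp (-x),
        (hR _).1 (hbig x hx), Or.inr ⟨?_, ?_⟩⟩
      · simp [Complex.ofReal_exp]
      · simp only [map_add, Complex.conj_ofReal, map_mul, Complex.conj_I]
        rw [show -((x : ℂ) + Real.pi * -Complex.I) = -x + Real.pi * Complex.I by ring,
          Complex.exp_add, Complex.exp_pi_mul_I]
        simp [Complex.ofReal_exp]
  | succ i =>
    have h1 := mem_arc_succ ht i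
    have h2 : ∀ᶠ z : ℂ in 𝓝 (t i : ℂ), ∀ i', i' ≠ i → z ≠ t i' := by
      rw [eventually_all]
      intro i'
      by_cases h : i' = i
      · simp [h]
      · have : (t i : ℂ) ≠ t i' := fun h' => h (ht.injective (by exact_mod_cast h'.symm))
        filter_upwards [isOpen_ne.mem_nhds this] with z hz _ using hz
    obtain ⟨r₁, hr₁, H1⟩ := Metric.eventually_nhds_iff.1 h1
    obtain ⟨r₂, hr₂, H2⟩ := Metric.eventually_nhds_iff.1 h2
    have hr : 0 < min r₁ r₂ := lt_min hr₁ hr₂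
    have hsmall : ∀ x : ℝ, x < Real.log (min r₁ r₂) → Real.exp x < min r₁ r₂ := by
      intro x hx
      rwa [← Real.lt_log_iff_exp_lt hr]
    have h3 : Tendsto (fun w => t i + Complex.exp w) (comap Complex.re atBot) (𝓝 (t i : ℂ)) := by
      simpa using Complex.tendsto_exp_comap_re_atBot.const_add (t i : ℂ)
    -- The half-strip is wrapped onto a punctured half-disk about `t i`. Its radius is so small that
    -- it contains no other mark and meets the real line in the two adjacent arcs only.
    refine ⟨fun w => t i + Complex.exp w, Real.log (min r₁ r₂), by fun_prop, ?_, ?_, ?_, ?_⟩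
    · rw [label_succ]
      exact (β.continuous_point.tendsto _).comp h3
    · rw [label_succ]
      have h4 := ((Complex.continuous_conj.tendsto _).comp h3)
      rw [Complex.conj_ofReal] at h4
      exact (β.continuous_point.tendsto _).comp h4
    · intro w hw h0 hπ
      refine ⟨?_, fun i' hi => ?_⟩
      · simp only [Complex.add_im, Complex.ofReal_im, zero_add, Complex.exp_im]
        exact mul_nonneg (Real.exp_pos _).le (Real.sin_nonneg_of_nonneg_of_le_pi h0 hπ)
      · by_cases h : i' = i
        · subst h
          simp [Complex.exp_ne_zero] at hi
        · refine H2 (y := t i + Complex.exp w) ?_ i' h hi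
          rw [dist_eq_norm, add_sub_cancel_left, Complex.norm_exp]
          exact (hsmall _ hw).trans_le (min_le_right _ _)
    · intro x hx
      have hd := (hsmall x hx).trans_le (min_le_left _ _)
      refine ⟨t i + Real.exp x, (H1 ?_).1 ?_, t i - Real.exp x, (H1 ?_).2 ?_, Or.inl ⟨?_, ?_⟩⟩
      · rw [Real.dist_eq, add_sub_cancel_left, abs_of_pos (Real.exp_pos x)]
        exact hd
      · linarith [Real.exp_pos x]
      · rw [Real.dist_eq, sub_sub_cancel_left, abs_neg, abs_of_pos (Real.exp_pos x)]
        exact hd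
      · linarith [Real.exp_pos x]
      · simp [Complex.ofReal_exp]
      · simp only [Complex.exp_add, Complex.exp_pi_mul_I]
        simp [Complex.ofReal_exp, sub_eq_add_neg]

end BaseCurve

/-! ### Charts of the sphere -/

/-- The sphere is locally homeomorphic to the plane. -/
theorem OnePoint.locally_planar (x : OnePoint ℂ) :
    ∃ e : OpenPartialHomeomorph (OnePoint ℂ) ℂ, x ∈ e.source := by
  induction x using OnePoint.rec with
  | coe z =>
    exact locally_planar_of_isOpenEmbedding (OnePoint.isOpenEmbedding_coe (X := ℂ))
      ⟨OpenPartialHomeomorph.refl ℂ, trivial⟩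
  | infty =>
    have h0 : ∀ z : ℂ, (Option.elim (OnePoint.some z) 0 (fun z => z⁻¹) : ℂ) = z⁻¹ := fun _ => rfl
    have hinf : (Option.elim (OnePoint.infty : OnePoint ℂ) 0 (fun z => z⁻¹) : ℂ) = 0 := rfl
    classical
    refine ⟨{
      toFun := fun x => Option.elim x 0 fun z => z⁻¹
      invFun := fun z => if z = 0 then OnePoint.infty else ((z⁻¹ : ℂ) : OnePoint ℂ)
      source := {((0 : ℂ) : OnePoint ℂ)}ᶜ
      target := univ
      map_source' := fun _ _ => trivial
      map_target' := ?_
      left_inv' := ?_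
      right_inv' := ?_
      open_source := isOpen_compl_singleton
      open_target := isOpen_univ
      continuousOn_toFun := ?_
      continuousOn_invFun := ?_ }, ?_⟩
    · intro z _
      by_cases h : z = 0 <;> simp [h]
    · intro x hx
      induction x using OnePoint.rec with
      | coe z =>
        have : z ≠ 0 := fun h => hx (by rw [h]; rfl)
        rw [h0]
        simp [this]
      | infty => rw [hinf]; simp
    · intro z _
      by_cases h : z = 0
      · simp only [h, if_true]; exact hinf
      · simp only [h, if_false]; rw [h0, inv_inv]
    · intro x hx
      refine ContinuousAt.continuousWithinAt ?_
      induction x using OnePoint.rec with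
      | coe z =>
        have : z ≠ 0 := fun h => hx (by rw [h]; rfl)
        rw [OnePoint.continuousAt_coe]
        exact continuousAt_inv₀ this
      | infty =>
        rw [OnePoint.continuousAt_infty', hinf, coclosedCompact_eq_cocompact,
          ← Metric.cobounded_eq_cocompact]
        exact tendsto_inv₀_cobounded
    · intro z _
      refine ContinuousAt.continuousWithinAt ?_
      by_cases h : z = 0
      · subst h
        rw [ContinuousAt, if_pos rfl, ← nhdsNE_sup_pure, tendsto_sup]
        constructor
        · have h1 : Tendsto (fun z : ℂ => z⁻¹) (𝓝[≠] 0) (coclosedCompact ℂ) := by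
            rw [coclosedCompact_eq_cocompact, ← Metric.cobounded_eq_cocompact]
            exact tendsto_inv₀_nhdsNE_zero
          refine (OnePoint.tendsto_coe_infty.comp h1).congr' ?_
          filter_upwards [self_mem_nhdsWithin] with z hz
          exact (if_neg hz).symm
        · rw [tendsto_pure_left]
          intro s hs
          simpa using mem_of_mem_nhds hs
      · have h1 : ContinuousAt (fun z : ℂ => ((z⁻¹ : ℂ) : OnePoint ℂ)) z :=
          (OnePoint.continuous_coe.continuousAt).comp (continuousAt_inv₀ h)
        refine h1.congr ?_
        filter_upwards [isOpen_ne.mem_nhds h] with z' hz'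
        rw [if_neg hz']
    · simp

/-! ### Vertices, adjacency and components of labeled graphs -/

/-- The sign of a vertex: positive for the vertices `×`, negative for the vertices `∘`. -/
def LabeledGraph.sign {k : ℕ} {G : LabeledGraph.{v} k} : G.Vertex → ℝ :=
  Sum.elim (fun _ => 1) fun _ => -1

namespace LabeledGraph

variable {k : ℕ} {G : LabeledGraph.{v} k}

@[simp] theorem sign_inl (x : G.Cross) : sign (Sum.inl x : G.Vertex) = 1 := rfl

@[simp] theorem sign_inr (y : G.Circ) : sign (Sum.inr y : G.Vertex) = -1 := rfl

theorem sign_eq (p : G.Vertex) : sign p = 1 ∨ sign p = -1 := by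
  rcases p with x | y <;> simp

theorem reachable_of_edge {j : Fin k} {x : G.Cross} {y : G.Circ} (h : G.edge j x y) :
    G.simple.Reachable (Sum.inl x) (Sum.inr y) := by
  refine SimpleGraph.Adj.reachable ?_
  rw [simple, SimpleGraph.fromRel_adj]
  exact ⟨by simp, Or.inl ⟨j, x, y, rfl, rfl, h⟩⟩

theorem exists_edge_of_adj {p q : G.Vertex} (h : G.simple.Adj p q) :
    ∃ j x y, G.edge j x y ∧ ((p = Sum.inl x ∧ q = Sum.inr y) ∨ (q = Sum.inl x ∧ p = Sum.inr y)) := by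
  rw [simple, SimpleGraph.fromRel_adj] at h
  obtain ⟨-, ⟨j, x, y, h1, h2, h3⟩ | ⟨j, x, y, h1, h2, h3⟩⟩ := h
  · exact ⟨j, x, y, h3, Or.inl ⟨h1, h2⟩⟩
  · exact ⟨j, x, y, h3, Or.inr ⟨h1, h2⟩⟩

/-- The inclusion of the vertices of a component. -/
def component.val {p : G.Vertex} : (G.component p).Vertex → G.Vertex :=
  Sum.map Subtype.val Subtype.val

theorem component.sign_val {p : G.Vertex} (v : (G.component p).Vertex) :
    sign (component.val v) = sign v := by
  rcases v with x | y <;> rfl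

theorem component.reachable_val {p : G.Vertex} (v : (G.component p).Vertex) :
    G.simple.Reachable p (component.val v) := by
  rcases v with x | y
  · exact x.2
  · exact y.2

theorem component.val_injective {p : G.Vertex} :
    Function.Injective (component.val : (G.component p).Vertex → G.Vertex) :=
  Function.Injective.sumMap Subtype.val_injective Subtype.val_injective

theorem component.exists_val_eq {p v : G.Vertex} (h : G.simple.Reachable p v) :
    ∃ v' : (G.component p).Vertex, component.val v' = v := by
  rcases v with x | y
  · exact ⟨Sum.inl ⟨x, h⟩, rfl⟩
  · exact ⟨Sum.inr ⟨y, h⟩, rfl⟩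

theorem component.val_root (p : G.Vertex) : component.val (G.root p) = p := by
  rcases p with x | y <;> rfl

end LabeledGraph

open LabeledGraph

/-! ### Decompositions into half-planes -/

/-- A decomposition of `X` over the marked plane into half-planes that are indexed by the vertices
of a labeled graph `G` and glued along the arcs between the marked points in the way prescribed by
the edges of `G`: the map `σ v` parametrizes the half-plane that belongs to the vertex `v`. -/
structure IsSheeting {X S : Type*} [TopologicalSpace X] (π : X → S) (pt : ℂ → S) {m : ℕ}
    (t : Fin m → ℝ) (G : LabeledGraph.{v} (m + 1)) (σ : G.Vertex → ℂ → X) : Prop where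
  continuousOn : ∀ v, ContinuousOn (σ v) (closedHalf t (sign v))
  map_sheet : ∀ v, ∀ z ∈ closedHalf t (sign v), π (σ v z) = pt z
  exists_sheet : ∀ x z ε, (ε = 1 ∨ ε = -1) → z ∈ closedHalf t ε → π x = pt z →
    ∃ v, sign v = ε ∧ σ v z = x
  sheet_unique : ∀ v v' z, z ∈ closedHalf t (sign v) → sign v = sign v' → σ v z = σ v' z → v = v'
  edge_iff : ∀ j x y, ∀ s ∈ BaseCurve.arc t j,
    G.edge j x y ↔ σ (Sum.inl x) (s : ℂ) = σ (Sum.inr y) (s : ℂ)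
  -- Local injectivity is required of `π` only: `pt` may be constant along horizontal rays, as it is
  -- after clamping.
  locInj : ∀ x, ∀ z ∈ markedPlane t, π x = pt z → ∃ U ∈ 𝓝 x, InjOn π U

open Classical in
/-- The map that agrees with `σ x` in the upper and with `σ y` in the lower half-plane. -/
noncomputable def sheetPair {X : Type*} {k : ℕ} {G : LabeledGraph.{v} k} (σ : G.Vertex → ℂ → X)
    (x : G.Cross) (y : G.Circ) (z : ℂ) : X :=
  if 0 ≤ z.im then σ (Sum.inl x) z else σ (Sum.inr y) z

theorem sheetPair_of_im_nonneg {X : Type*} {k : ℕ} {G : LabeledGraph.{v} k}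
    {σ : G.Vertex → ℂ → X} {x : G.Cross} {y : G.Circ} {z : ℂ} (hz : 0 ≤ z.im) :
    sheetPair σ x y z = σ (Sum.inl x) z := if_pos hz

namespace IsSheeting

variable {X S : Type*} [TopologicalSpace X] {π : X → S} {pt : ℂ → S} {m : ℕ}
  {t : Fin m → ℝ} {G : LabeledGraph.{v} (m + 1)} {σ : G.Vertex → ℂ → X}

theorem mem_inl {z : ℂ} (hz : 0 ≤ z.im) (h : z ∈ markedPlane t) (x : G.Cross) :
    z ∈ closedHalf t (sign (Sum.inl x : G.Vertex)) := ⟨by simpa using hz, h⟩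

theorem mem_inr {z : ℂ} (hz : z.im ≤ 0) (h : z ∈ markedPlane t) (y : G.Circ) :
    z ∈ closedHalf t (sign (Sum.inr y : G.Vertex)) := ⟨by simpa using hz, h⟩

theorem exists_circ (h : IsSheeting π pt t G σ) (ht : StrictMono t) (j : Fin (m + 1))
    (x : G.Cross) : ∃ y, G.edge j x y := by
  obtain ⟨s, hs⟩ := nonempty_arc ht j
  obtain ⟨v, hv, hv'⟩ := h.exists_sheet (σ (Sum.inl x) s) s (-1) (Or.inr rfl)
    (ofReal_mem_closedHalf hs _) (h.map_sheet _ _ (ofReal_mem_closedHalf hs _))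
  rcases v with x' | y
  · simp only [sign_inl] at hv; norm_num at hv
  · exact ⟨y, (h.edge_iff j x y s hs).2 hv'.symm⟩

theorem exists_cross (h : IsSheeting π pt t G σ) (ht : StrictMono t) (j : Fin (m + 1))
    (y : G.Circ) : ∃ x, G.edge j x y := by
  obtain ⟨s, hs⟩ := nonempty_arc ht j
  obtain ⟨v, hv, hv'⟩ := h.exists_sheet (σ (Sum.inr y) s) s 1 (Or.inl rfl)
    (ofReal_mem_closedHalf hs _) (h.map_sheet _ _ (ofReal_mem_closedHalf hs _))
  rcases v with x | y'
  · exact ⟨x, (h.edge_iff j x y s hs).2 hv'⟩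
  · simp only [sign_inr] at hv; norm_num at hv

theorem circ_unique (h : IsSheeting π pt t G σ) (ht : StrictMono t) {j : Fin (m + 1)}
    {x : G.Cross} {y y' : G.Circ} (hy : G.edge j x y) (hy' : G.edge j x y') : y = y' := by
  obtain ⟨s, hs⟩ := nonempty_arc ht j
  rw [h.edge_iff j _ _ s hs] at hy hy'
  simpa using h.sheet_unique (Sum.inr y) (Sum.inr y') s (ofReal_mem_closedHalf hs _) rfl
    (hy.symm.trans hy')

theorem cross_unique (h : IsSheeting π pt t G σ) (ht : StrictMono t) {j : Fin (m + 1)}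
    {x x' : G.Cross} {y : G.Circ} (hx : G.edge j x y) (hx' : G.edge j x' y) : x = x' := by
  obtain ⟨s, hs⟩ := nonempty_arc ht j
  rw [h.edge_iff j _ _ s hs] at hx hx'
  simpa using h.sheet_unique (Sum.inl x) (Sum.inl x') s (ofReal_mem_closedHalf hs _) rfl
    (hx.trans hx'.symm)

/-- Two sheets that meet at a point coincide, or are adjacent along an arc. -/
theorem eq_or_edge (h : IsSheeting π pt t G σ) (ht : StrictMono t) {v v' : G.Vertex} {z : ℂ}
    (hz : z ∈ closedHalf t (sign v)) (hz' : z ∈ closedHalf t (sign v')) (hv : σ v z = σ v' z) :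
    v = v' ∨ ∃ j, ∃ s ∈ BaseCurve.arc t j, z = (s : ℂ) ∧ ∃ x y, G.edge j x y ∧
      ((v = Sum.inl x ∧ v' = Sum.inr y) ∨ (v' = Sum.inl x ∧ v = Sum.inr y)) := by
  have hreal : 0 ≤ z.im → z.im ≤ 0 → ∃ j, ∃ s ∈ BaseCurve.arc t j, z = (s : ℂ) := by
    intro h1 h2
    have h3 : z = (z.re : ℂ) := Complex.ext (by simp) (by simp [le_antisymm h2 h1])
    obtain ⟨j, hj⟩ := exists_mem_arc ht (s := z.re) fun i hi => hz.2 i (by rw [h3, hi])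
    exact ⟨j, z.re, hj, h3⟩
  rcases v with x | y <;> rcases v' with x' | y'
  · exact Or.inl (h.sheet_unique _ _ z hz rfl hv)
  · obtain ⟨j, s, hs, rfl⟩ := hreal (by simpa using hz.1) (by simpa using hz'.1)
    exact Or.inr ⟨j, s, hs, rfl, x, y', (h.edge_iff j x y' s hs).2 hv, Or.inl ⟨rfl, rfl⟩⟩
  · obtain ⟨j, s, hs, rfl⟩ := hreal (by simpa using hz'.1) (by simpa using hz.1)
    exact Or.inr ⟨j, s, hs, rfl, x', y, (h.edge_iff j x' y s hs).2 hv.symm, Or.inr ⟨rfl, rfl⟩⟩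
  · exact Or.inl (h.sheet_unique _ _ z hz rfl hv)

theorem reachable_of_meet (h : IsSheeting π pt t G σ) (ht : StrictMono t) {v v' : G.Vertex} {z : ℂ}
    (hz : z ∈ closedHalf t (sign v)) (hz' : z ∈ closedHalf t (sign v')) (hv : σ v z = σ v' z) :
    G.simple.Reachable v v' := by
  rcases h.eq_or_edge ht hz hz' hv with rfl | ⟨j, s, -, -, x, y, he, ⟨rfl, rfl⟩ | ⟨rfl, rfl⟩⟩
  · exact SimpleGraph.Reachable.refl _
  · exact reachable_of_edge he
  · exact (reachable_of_edge he).symm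

/-- On an arc in `J` both sheets take the same value, because `x` and `y` are joined over it; so it
does not matter that `sheetPair` prefers the upper one on the real line. -/
theorem sheetPair_of_nonpos (h : IsSheeting π pt t G σ) {J : Set (Fin (m + 1))} {x : G.Cross}
    {y : G.Circ} (he : ∀ j ∈ J, G.edge j x y) {z : ℂ} (hz : z.im ≤ 0) (hJ : z ∈ slitPlane t J) :
    sheetPair σ x y z = σ (Sum.inr y) z := by
  rcases hz.lt_or_eq with h1 | h1
  · exact if_neg (not_le.2 h1)
  · rw [sheetPair_of_im_nonneg h1.ge]
    obtain h2 | ⟨j, hj, h2⟩ := hJ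
    · exact absurd h1 h2
    · rw [show z = (z.re : ℂ) from Complex.ext (by simp) (by simp [h1])]
      exact (h.edge_iff j x y _ h2).1 (he j hj)

theorem map_sheetPair (h : IsSheeting π pt t G σ) (x : G.Cross) (y : G.Circ) {z : ℂ}
    (hz : z ∈ markedPlane t) : π (sheetPair σ x y z) = pt z := by
  rcases le_total 0 z.im with h1 | h1
  · rw [sheetPair_of_im_nonneg h1]
    exact h.map_sheet _ _ (mem_inl h1 hz x)
  · rcases h1.lt_or_eq with h2 | h2
    · rw [sheetPair, if_neg (not_le.2 h2)]
      exact h.map_sheet _ _ (mem_inr h1 hz y)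
    · rw [sheetPair_of_im_nonneg h2.ge]
      exact h.map_sheet _ _ (mem_inl h2.ge hz x)

/-- The two sheets are pasted along the arcs in `J`, each half being closed in the slit plane. This
yields sections over open sets that cross the real line, the tool for all local questions below. -/
theorem continuousOn_sheetPair (h : IsSheeting π pt t G σ) {J : Set (Fin (m + 1))} {x : G.Cross}
    {y : G.Circ} (he : ∀ j ∈ J, G.edge j x y) :
    ContinuousOn (sheetPair σ x y) (slitPlane t J) := by
  have h1 : ContinuousOn (sheetPair σ x y) (slitPlane t J ∩ {z | 0 ≤ z.im}) := by
    refine ((h.continuousOn (Sum.inl x)).mono ?_).congr ?_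
    · exact fun z hz => mem_inl hz.2 (slitPlane_subset J hz.1) x
    · exact fun z hz => sheetPair_of_im_nonneg hz.2
  have h2 : ContinuousOn (sheetPair σ x y) (slitPlane t J ∩ {z | z.im ≤ 0}) := by
    refine ((h.continuousOn (Sum.inr y)).mono ?_).congr ?_
    · exact fun z hz => mem_inr hz.2 (slitPlane_subset J hz.1) y
    · exact fun z hz => h.sheetPair_of_nonpos he hz.2 hz.1
  have hc1 : IsClosed {z : ℂ | 0 ≤ z.im} := isClosed_le continuous_const Complex.continuous_im
  have hc2 : IsClosed {z : ℂ | z.im ≤ 0} := isClosed_le Complex.continuous_im continuous_const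
  intro z hz
  have hU : slitPlane t J = (slitPlane t J ∩ {z | 0 ≤ z.im}) ∪ (slitPlane t J ∩ {z | z.im ≤ 0}) := by
    rw [← inter_union_distrib_left]
    refine (inter_eq_left.2 fun z _ => ?_).symm
    exact le_total 0 z.im
  rw [hU]
  refine ContinuousWithinAt.union ?_ ?_
  · by_cases hz' : 0 ≤ z.im
    · exact h1 z ⟨hz, hz'⟩
    · refine continuousWithinAt_of_notMem_closure fun h3 => hz' ?_
      exact closure_minimal inter_subset_right hc1 h3
  · by_cases hz' : z.im ≤ 0
    · exact h2 z ⟨hz, hz'⟩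
    · refine continuousWithinAt_of_notMem_closure fun h3 => hz' ?_
      exact closure_minimal inter_subset_right hc2 h3

/-- The index `j` can be prescribed, since every vertex has exactly one edge of each index. The pair
passes through `x₀` provided that `z` does not lie on the slits left by `j`. -/
theorem exists_sheetPair (h : IsSheeting π pt t G σ) (ht : StrictMono t) {j : Fin (m + 1)} {x₀ : X}
    {z : ℂ} (hz : z ∈ markedPlane t) (hx : π x₀ = pt z) :
    ∃ x y, G.edge j x y ∧ (z ∈ slitPlane t {j} → sheetPair σ x y z = x₀) := by
  rcases le_total 0 z.im with h1 | h1
  · obtain ⟨v, hv, hv'⟩ := h.exists_sheet x₀ z 1 (Or.inl rfl) ⟨by simpa using h1, hz⟩ hx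
    rcases v with x | y
    · obtain ⟨y, hy⟩ := h.exists_circ ht j x
      exact ⟨x, y, hy, fun _ => (sheetPair_of_im_nonneg h1).trans hv'⟩
    · simp only [sign_inr] at hv; norm_num at hv
  · obtain ⟨v, hv, hv'⟩ := h.exists_sheet x₀ z (-1) (Or.inr rfl) ⟨by simpa using h1, hz⟩ hx
    rcases v with x | y
    · simp only [sign_inl] at hv; norm_num at hv
    · obtain ⟨x, hx⟩ := h.exists_cross ht j y
      exact ⟨x, y, hx, fun hzs => (h.sheetPair_of_nonpos (by simpa using hx) h1 hzs).trans hv'⟩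

/-- A coordinate for the map `π`: a function `κ` on `X` that recovers `z` from `pt z`. -/
structure IsCoordinate (π : X → S) (pt : ℂ → S) (t : Fin m → ℝ) (κ : X → ℂ) : Prop where
  eq : ∀ x, ∀ z ∈ markedPlane t, π x = pt z → κ x = z
  continuousAt : ∀ x, ∀ z ∈ markedPlane t, π x = pt z → ContinuousAt κ x
  isOpen : IsOpen {x | ∃ z ∈ markedPlane t, π x = pt z}

variable {κ : X → ℂ}

theorem IsCoordinate.locInj (hκ : IsCoordinate π pt t κ) (h : IsSheeting π pt t G σ) {x : X} {z : ℂ}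
    (hz : z ∈ markedPlane t) (hx : π x = pt z) : ∃ U ∈ 𝓝 x, InjOn κ U := by
  obtain ⟨U, hU, hUi⟩ := h.locInj x z hz hx
  refine ⟨U ∩ {x | ∃ z ∈ markedPlane t, π x = pt z},
    inter_mem hU (hκ.isOpen.mem_nhds ⟨z, hz, hx⟩), ?_⟩
  rintro a ⟨ha, za, hza, ha'⟩ b ⟨hb, zb, hzb, hb'⟩ hab
  refine hUi ha hb ?_
  rw [hκ.eq a za hza ha', hκ.eq b zb hzb hb'] at hab
  rw [ha', hb', hab]

theorem eventually_mem_sheet (h : IsSheeting π pt t G σ) (hκ : IsCoordinate π pt t κ)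
    {v : G.Vertex} {z : ℂ} (hz : z ∈ closedHalf t (sign v)) :
    ∀ᶠ x in 𝓝 (σ v z), κ x ∈ closedHalf t (sign v) → σ v (κ x) = x :=
  eventually_mem_section hz (h.continuousOn v z hz)
    (fun w hw => hκ.eq _ w hw.2 (h.map_sheet v w hw)) (hκ.continuousAt _ z hz.2 (h.map_sheet v z hz))
    (hκ.locInj h hz.2 (h.map_sheet v z hz))

/-- In contrast to a closed half-plane the slit plane is open, so the section covers a full
neighbourhood and no condition on the coordinate remains. -/
theorem eventually_mem_sheetPair (h : IsSheeting π pt t G σ) (hκ : IsCoordinate π pt t κ)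
    {J : Set (Fin (m + 1))} {x : G.Cross} {y : G.Circ} (he : ∀ j ∈ J, G.edge j x y) {z : ℂ}
    (hz : z ∈ slitPlane t J) :
    ∀ᶠ x' in 𝓝 (sheetPair σ x y z), κ x' ∈ slitPlane t J ∧ sheetPair σ x y (κ x') = x' := by
  have hz' := slitPlane_subset J hz
  have hc := hκ.continuousAt _ z hz' (h.map_sheetPair x y hz')
  have h1 := eventually_mem_section hz (h.continuousOn_sheetPair he z hz)
    (fun w hw => hκ.eq _ w (slitPlane_subset J hw) (h.map_sheetPair x y (slitPlane_subset J hw)))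
    hc (hκ.locInj h hz' (h.map_sheetPair x y hz'))
  have h2 : ∀ᶠ x' in 𝓝 (sheetPair σ x y z), κ x' ∈ slitPlane t J := by
    apply hc
    rw [hκ.eq _ z hz' (h.map_sheetPair x y hz')]
    exact (isOpen_slitPlane J).mem_nhds hz
  filter_upwards [h1, h2] with x' h3 h4 using ⟨h4, h3 h4⟩

/-- Maps that are given on the half-planes of a sheeting and agree along the arcs define a
continuous map. -/
theorem exists_lift (h : IsSheeting π pt t G σ) (ht : StrictMono t) (hκ : IsCoordinate π pt t κ)
    {Y : Type*} [TopologicalSpace Y] [Nonempty Y] (σ' : G.Vertex → ℂ → Y)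
    (hσ' : ∀ v, ContinuousOn (σ' v) (closedHalf t (sign v)))
    (he : ∀ j x y, ∀ s ∈ BaseCurve.arc t j, G.edge j x y →
      σ' (Sum.inl x) (s : ℂ) = σ' (Sum.inr y) (s : ℂ)) :
    ∃ F : X → Y, ContinuousOn F {x | ∃ z ∈ markedPlane t, π x = pt z} ∧
      ∀ v, ∀ z ∈ closedHalf t (sign v), F (σ v z) = σ' v z := by
  -- The value at a point does not depend on the sheet through it: two sheets through one point
  -- coincide or are joined over an arc, where `he` applies.
  have hex : ∀ x, ∃ y, ∀ v, ∀ z ∈ closedHalf t (sign v), σ v z = x → y = σ' v z := by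
    intro x
    by_cases hx : ∃ v, ∃ z ∈ closedHalf t (sign v), σ v z = x
    · obtain ⟨v, z, hz, rfl⟩ := hx
      refine ⟨σ' v z, fun v' z' hz' hv' => ?_⟩
      have hzz : z = z' := by
        rw [← hκ.eq _ z hz.2 (h.map_sheet v z hz), ← hκ.eq _ z' hz'.2 (h.map_sheet v' z' hz'), hv']
      subst hzz
      rcases h.eq_or_edge ht hz hz' hv'.symm with
        rfl | ⟨j, s, hs, rfl, x, y, hxy, ⟨rfl, rfl⟩ | ⟨rfl, rfl⟩⟩
      · rfl
      · exact he j x y s hs hxy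
      · exact (he j x y s hs hxy).symm
    · exact ⟨Classical.arbitrary Y, fun v z hz hv => absurd ⟨v, z, hz, hv⟩ hx⟩
  choose F hF using hex
  have hF' : ∀ v, ∀ z ∈ closedHalf t (sign v), F (σ v z) = σ' v z := fun v z hz => hF _ v z hz rfl
  refine ⟨F, ?_, hF'⟩
  rintro x ⟨z, hz, hx⟩
  refine ContinuousAt.continuousWithinAt ?_
  intro M hM
  -- Continuity is tested on the upper and on the lower half of a neighbourhood separately; on each
  -- half the map is `σ' v ∘ κ` for one vertex `v`, if points of that half are near `x` at all.
  have key : ∀ ε : ℝ, (ε = 1 ∨ ε = -1) → ∀ᶠ x' in 𝓝 x, 0 ≤ ε * (κ x').im → F x' ∈ M := by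
    intro ε hε
    have hc := hκ.continuousAt x z hz hx
    have hDom := hκ.isOpen.mem_nhds ⟨z, hz, hx⟩
    by_cases h0 : 0 ≤ ε * z.im
    · obtain ⟨v, rfl, rfl⟩ := h.exists_sheet x z ε hε ⟨h0, hz⟩ hx
      have hzz := hκ.eq _ z hz hx
      have h1 := h.eventually_mem_sheet hκ ⟨h0, hz⟩
      rw [hF' v z ⟨h0, hz⟩] at hM
      have h2 : ∀ᶠ x' in 𝓝 (σ v z), κ x' ∈ closedHalf t (sign v) → σ' v (κ x') ∈ M := by
        have h3 := eventually_nhdsWithin_iff.1 (hσ' v z ⟨h0, hz⟩ hM)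
        rw [← hzz] at h3
        exact hc.eventually h3
      filter_upwards [h1, h2, hDom] with x' h3 h4 ⟨z', hz', hx'⟩ h5
      have h6 : κ x' ∈ closedHalf t (sign v) := ⟨h5, by rw [hκ.eq x' z' hz' hx']; exact hz'⟩
      have h7 := hF' v _ h6
      rw [h3 h6] at h7
      rw [h7]
      exact h4 h6
    · have h1 : ∀ᶠ w in 𝓝 (κ x), ¬ 0 ≤ ε * w.im := by
        rw [hκ.eq x z hz hx]
        have : IsOpen {w : ℂ | ε * w.im < 0} :=
          isOpen_lt (continuous_const.mul Complex.continuous_im) continuous_const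
        filter_upwards [this.mem_nhds (not_le.1 h0)] with w hw using not_le.2 hw
      filter_upwards [hc.eventually h1] with x' hx' h2 using absurd h2 hx'
  rw [mem_map]
  filter_upwards [key 1 (Or.inl rfl), key (-1) (Or.inr rfl)] with x' h1 h2
  rw [mem_preimage]
  rcases le_total 0 (κ x').im with h3 | h3
  · exact h1 (by simpa using h3)
  · exact h2 (by simpa using h3)

/-- The union of the half-planes that belong to the component of a vertex `p`. -/
def componentSet (σ : G.Vertex → ℂ → X) (t : Fin m → ℝ) (p : G.Vertex) : Set X :=
  {x | ∃ v, G.simple.Reachable p v ∧ ∃ z ∈ closedHalf t (sign v), σ v z = x}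

/-- Adjacent half-planes share an arc, so a walk in the graph gives a chain of connected sets, each
meeting the next. -/
theorem isPreconnected_componentSet (h : IsSheeting π pt t G σ) (ht : StrictMono t)
    (p : G.Vertex) : IsPreconnected (componentSet σ t p) := by
  have hpre : ∀ v, IsPreconnected (σ v '' closedHalf t (sign v)) := fun v =>
    (isPreconnected_closedHalf (sign_eq v)).image _ (h.continuousOn v)
  have hsub : ∀ v, G.simple.Reachable p v →
      σ v '' closedHalf t (sign v) ⊆ componentSet σ t p := by
    rintro v hv _ ⟨z, hz, rfl⟩
    exact ⟨v, hv, z, hz, rfl⟩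
  have key : ∀ v, G.simple.Reachable p v → ∃ A ⊆ componentSet σ t p, IsPreconnected A ∧
      σ p ((sign p : ℂ) * Complex.I) ∈ A ∧ σ v '' closedHalf t (sign v) ⊆ A := by
    intro v hv
    have hv' := (SimpleGraph.reachable_iff_reflTransGen _ _).1 hv
    induction hv' with
    | refl =>
      exact ⟨_, hsub p hv, hpre p, ⟨_, mul_I_mem_closedHalf (sign_eq p), rfl⟩, Subset.rfl⟩
    | tail hab hbc ih =>
      rename_i b c
      obtain ⟨A, hA, hAp, hpA, hbA⟩ := ih ((SimpleGraph.reachable_iff_reflTransGen _ _).2 hab)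
      refine ⟨A ∪ σ c '' closedHalf t (sign c), union_subset hA (hsub c hv), ?_, Or.inl hpA,
        subset_union_right⟩
      obtain ⟨j, x, y, he, hbc'⟩ := exists_edge_of_adj hbc
      obtain ⟨s, hs⟩ := nonempty_arc ht j
      have heq := (h.edge_iff j x y s hs).1 he
      have hmem : ∀ v : G.Vertex, σ v s ∈ σ v '' closedHalf t (sign v) := fun v =>
        mem_image_of_mem _ (ofReal_mem_closedHalf hs _)
      rcases hbc' with ⟨rfl, rfl⟩ | ⟨rfl, rfl⟩
      · exact IsPreconnected.union (σ (Sum.inl x) s) (hbA (hmem _)) (heq ▸ hmem _) hAp (hpre _)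
      · exact IsPreconnected.union (σ (Sum.inl x) s) (hbA (heq ▸ hmem _)) (hmem _) hAp (hpre _)
  refine isPreconnected_of_forall (σ p ((sign p : ℂ) * Complex.I)) ?_
  rintro _ ⟨v, hv, z, hz, rfl⟩
  obtain ⟨A, hA, hAp, hpA, hvA⟩ := key v hv
  exact ⟨A, hA, hpA, hvA (mem_image_of_mem _ hz), hAp⟩

/-- Other sheets through the same point are equal or adjacent to `v`, so they lie in the same
component of the graph. -/
theorem mem_componentSet_iff (h : IsSheeting π pt t G σ) (ht : StrictMono t)
    (hκ : IsCoordinate π pt t κ) {p v : G.Vertex} {z : ℂ} (hz : z ∈ closedHalf t (sign v)) :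
    σ v z ∈ componentSet σ t p ↔ G.simple.Reachable p v := by
  refine ⟨?_, fun hv => ⟨v, hv, z, hz, rfl⟩⟩
  rintro ⟨v', hv', z', hz', hvv⟩
  have hzz : z = z' := by
    rw [← hκ.eq _ z hz.2 (h.map_sheet v z hz), ← hκ.eq _ z' hz'.2 (h.map_sheet v' z' hz'), hvv]
  subst hzz
  exact hv'.trans (h.reachable_of_meet ht hz' hz hvv)

/-- Near a point over the marked plane all points lie on two sheets that are joined by an edge,
hence all in the component or all outside. -/
theorem eventually_mem_componentSet_iff (h : IsSheeting π pt t G σ) (ht : StrictMono t)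
    (hκ : IsCoordinate π pt t κ) (p : G.Vertex) {x : X} {z : ℂ} (hz : z ∈ markedPlane t)
    (hx : π x = pt z) :
    ∀ᶠ x' in 𝓝 x, x' ∈ componentSet σ t p ↔ x ∈ componentSet σ t p := by
  obtain ⟨j, hj⟩ := mem_slitPlane_of_mem_markedPlane ht hz
  obtain ⟨a, b, hab, hx'⟩ := h.exists_sheetPair ht (j := j) hz hx
  have he : ∀ j' ∈ ({j} : Set (Fin (m + 1))), G.edge j' a b := by simpa using hab
  have key : ∀ w ∈ slitPlane t {j}, sheetPair σ a b w ∈ componentSet σ t p ↔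
      G.simple.Reachable p (Sum.inl a) := by
    intro w hw
    have hw' := slitPlane_subset _ hw
    rcases le_total 0 w.im with h1 | h1
    · rw [sheetPair_of_im_nonneg h1, h.mem_componentSet_iff ht hκ (mem_inl h1 hw' a)]
    · rw [h.sheetPair_of_nonpos he h1 hw, h.mem_componentSet_iff ht hκ (mem_inr h1 hw' b)]
      exact ⟨fun h2 => h2.trans (reachable_of_edge hab).symm,
        fun h2 => h2.trans (reachable_of_edge hab)⟩
  have h1 := h.eventually_mem_sheetPair hκ he hj
  rw [hx' hj] at h1
  have h2 : x ∈ componentSet σ t p ↔ G.simple.Reachable p (Sum.inl a) := by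
    rw [← hx' hj]; exact key z hj
  filter_upwards [h1] with x' ⟨h3, h4⟩
  rw [h2, ← key _ h3, h4]

/-- A preconnected set over the marked plane that meets a component lies in it. -/
theorem subset_componentSet (h : IsSheeting π pt t G σ) (ht : StrictMono t)
    (hκ : IsCoordinate π pt t κ) (p : G.Vertex) {A : Set X} (hA : IsPreconnected A)
    (hAD : ∀ x ∈ A, ∃ z ∈ markedPlane t, π x = pt z) {a : X} (ha : a ∈ A)
    (hap : a ∈ componentSet σ t p) : A ⊆ componentSet σ t p := by
  set D := {x | ∃ z ∈ markedPlane t, π x = pt z}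
  have h1 : IsOpen (D ∩ componentSet σ t p) := by
    rw [isOpen_iff_mem_nhds]
    rintro x ⟨⟨z, hz, hx⟩, hxp⟩
    filter_upwards [h.eventually_mem_componentSet_iff ht hκ p hz hx,
      hκ.isOpen.mem_nhds ⟨z, hz, hx⟩] with x' hx' h' using ⟨h', hx'.2 hxp⟩
  have h2 : IsOpen (D ∩ (componentSet σ t p)ᶜ) := by
    rw [isOpen_iff_mem_nhds]
    rintro x ⟨⟨z, hz, hx⟩, hxp⟩
    filter_upwards [h.eventually_mem_componentSet_iff ht hκ p hz hx,
      hκ.isOpen.mem_nhds ⟨z, hz, hx⟩] with x' hx' h' using ⟨h', fun h'' => hxp (hx'.1 h'')⟩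
  intro b hb
  by_contra hbp
  obtain ⟨x, -, hx1, hx2⟩ := hA _ _ h1 h2 (fun x hx => by
    by_cases hxp : x ∈ componentSet σ t p
    · exact Or.inl ⟨hAD x hx, hxp⟩
    · exact Or.inr ⟨hAD x hx, hxp⟩) ⟨a, ha, hAD a ha, hap⟩ ⟨b, hb, hAD b hb, hbp⟩
  exact hx2.2 hx1.2

end IsSheeting

/-! ### Open half-planes of vertices, and the part of a surface off the labels -/

/-- The open half-plane that belongs to a vertex. -/
def vertexHalf {k : ℕ} {G : LabeledGraph.{v} k} (p : G.Vertex) : Set ℂ := {z | 0 < sign p * z.im}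

theorem vertexHalf_subset {m : ℕ} {t : Fin m → ℝ} {k : ℕ} {G : LabeledGraph.{v} k} (p : G.Vertex) :
    vertexHalf p ⊆ closedHalf t (sign p) := openHalf_subset_closedHalf _

/-- A vertical shift of `z` into the half-plane stays in it and differs from `z`, even if `z` is on
the real line. Base points are allowed to lie over the curve. -/
theorem neBot_nhdsWithin_vertexHalf {k : ℕ} {G : LabeledGraph.{v} k} {p : G.Vertex} {z : ℂ}
    (hz : 0 ≤ sign p * z.im) : (𝓝[vertexHalf p \ {z}] z).NeBot := by
  have hs : sign p * sign p = 1 := by rcases sign_eq p with h | h <;> rw [h] <;> norm_num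
  rw [← mem_closure_iff_nhdsWithin_neBot]
  have h1 : Tendsto (fun δ : ℝ => z + (sign p * δ : ℝ) * Complex.I) (𝓝[>] 0) (𝓝 z) := by
    have : Continuous fun δ : ℝ => z + (sign p * δ : ℝ) * Complex.I := by fun_prop
    have h2 := this.tendsto 0
    simp only [mul_zero, Complex.ofReal_zero, zero_mul, add_zero] at h2
    exact h2.mono_left nhdsWithin_le_nhds
  refine mem_closure_of_tendsto h1 ?_
  filter_upwards [self_mem_nhdsWithin] with δ hδ
  have hδ' : 0 < δ := hδ
  have him : (z + (sign p * δ : ℝ) * Complex.I).im = z.im + sign p * δ := by simp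
  refine ⟨?_, fun h => ?_⟩
  · change 0 < sign p * (z + (sign p * δ : ℝ) * Complex.I).im
    rw [him, mul_add, ← mul_assoc, hs]
    linarith
  · have h2 := congrArg Complex.im (show z + (sign p * δ : ℝ) * Complex.I = z from h)
    rw [him] at h2
    have h3 : sign p * (sign p * δ) = 0 := by rw [show sign p * δ = 0 by linarith, mul_zero]
    rw [← mul_assoc, hs] at h3
    linarith

namespace SpreadSurface

variable (T : SpreadSurface.{u}) (β : BaseCurve) {m : ℕ} (t : Fin m → ℝ)

/-- The part of the surface that lies over the complement of the labels. -/
def unlabeled : Set T.carrier := {x | ∃ z ∈ markedPlane t, T.proj x = β.point z}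

theorem unlabeled_eq : T.unlabeled β t = (T.proj ⁻¹' range (β.label t))ᶜ := by
  ext x
  rw [mem_compl_iff, mem_preimage, β.not_mem_range_label_iff]
  rfl

theorem isClosed_labeled : IsClosed (T.proj ⁻¹' range (β.label t)) :=
  (finite_range _).isClosed.preimage T.continuous_proj

theorem isDiscrete_labeled : IsDiscrete (T.proj ⁻¹' range (β.label t)) := by
  have : T.proj ⁻¹' range (β.label t) = ⋃ j, T.proj ⁻¹' {β.label t j} := by
    ext x; simp [eq_comm]
  rw [this]
  have h : ∀ j, IsClosed (T.proj ⁻¹' {β.label t j}) := fun j =>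
    isClosed_singleton.preimage T.continuous_proj
  exact IsDiscrete.iUnion (fun j => T.discrete_proj _) h

theorem countable_labeled : (T.proj ⁻¹' range (β.label t)).Countable :=
  (T.isDiscrete_labeled β t).countable_of_secondCountable

theorem isOpen_unlabeled : IsOpen (T.unlabeled β t) := by
  rw [unlabeled_eq]
  exact (T.isClosed_labeled β t).isOpen_compl

theorem isPreconnected_unlabeled : IsPreconnected (T.unlabeled β t) := by
  rw [unlabeled_eq]
  exact isPreconnected_compl_countable T.locally_planar (T.countable_labeled β t)

theorem dense_unlabeled : Dense (T.unlabeled β t) := by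
  rw [unlabeled_eq]
  exact dense_compl_countable T.locally_planar (T.countable_labeled β t)

theorem eventually_unlabeled (x : T.carrier) : ∀ᶠ y in 𝓝 x, y ≠ x → y ∈ T.unlabeled β t := by
  filter_upwards [eventually_nhdsNE_not_mem_of_isDiscrete (T.isClosed_labeled β t)
    (T.isDiscrete_labeled β t) x] with y hy hne
  rw [unlabeled_eq]
  exact fun h => hne (hy h)

/-- The coordinate of the projection. -/
noncomputable def coord (x : T.carrier) : ℂ := β.coord (T.proj x)

theorem coord_eq {x : T.carrier} {z : ℂ} (h : T.proj x = β.point z) : T.coord β x = z := by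
  rw [coord, h, β.coord_point]

theorem continuousAt_coord {x : T.carrier} {z : ℂ} (h : T.proj x = β.point z) :
    ContinuousAt (T.coord β) x := by
  have h1 := β.continuousAt_coord z
  rw [← h] at h1
  exact h1.comp T.continuous_proj.continuousAt

theorem isCoordinate : IsSheeting.IsCoordinate T.proj β.point t (T.coord β) where
  eq _ _ _ h := T.coord_eq β h
  continuousAt _ _ _ h := T.continuousAt_coord β h
  isOpen := T.isOpen_unlabeled β t

theorem neBot_nhdsNE (x : T.carrier) : (𝓝[≠] x).NeBot := by
  rw [← mem_closure_iff_nhdsWithin_neBot]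
  exact dense_compl_countable T.locally_planar (countable_singleton x) x

end SpreadSurface

/-! ### Surfaces decomposed along the component approximate the sequence -/

/-- A sequence of pointed surfaces with compatible half-plane decompositions whose projections are
given, in larger and larger disks, by the coordinate in the marked plane, and whose base points lie
over a common point in the closure of the half-plane of the vertex `p`. -/
structure IsSheetedSequence (β : BaseCurve) {m : ℕ} (t : Fin m → ℝ) (G : LabeledGraph.{v} (m + 1))
    (p : G.Vertex) (z₀ : ℂ) (X : ℕ → PointedSpreadSurface.{u}) (g : ℕ → ℂ → ℂ)
    (σ : ∀ n, G.Vertex → ℂ → (X n).carrier) : Prop where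
  sheeting : ∀ n, IsSheeting (X n).proj (β.point ∘ g n) t G (σ n)
  eventually_eq : ∀ R : ℝ, ∀ᶠ n in atTop, ∀ z, ‖z‖ ≤ R → g n z = z
  proj_base : ∀ n, (X n).proj (X n).base = β.point z₀
  sign_mul_nonneg : 0 ≤ sign p * z₀.im
  tendsto_base : ∀ n, Tendsto (σ n p) (𝓝[vertexHalf p] z₀) (𝓝 (X n).base)

namespace PointedSpreadSurface

/-- A pointed surface with a half-plane decomposition indexed by the component of `p`, so that its
base point corresponds to those of the sequence, approximates the sequence. -/
theorem approximates_of_isSheeting {β : BaseCurve} {m : ℕ} {t : Fin m → ℝ} (ht : StrictMono t)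
    {G : LabeledGraph.{v} (m + 1)} {p : G.Vertex} {z₀ : ℂ} {X : ℕ → PointedSpreadSurface.{u}}
    {g : ℕ → ℂ → ℂ} {σX : ∀ n, G.Vertex → ℂ → (X n).carrier}
    (hX : IsSheetedSequence β t G p z₀ X g σX) (T : PointedSpreadSurface.{u})
    {σ : (G.component p).Vertex → ℂ → T.carrier}
    (hT : IsSheeting T.proj β.point t (G.component p) σ) (hp : T.proj T.base = β.point z₀)
    (hb : Tendsto (σ (G.root p)) (𝓝[vertexHalf p] z₀) (𝓝 T.base)) : T.Approximates X := by
  have hroot : sign (G.root p) = sign p := by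
    rw [← component.sign_val, component.val_root]
  -- All points over labels are exceptional, apart from the base point, which may itself lie over a
  -- label.
  refine ⟨T.proj ⁻¹' range (β.label t) \ {T.base}, ?_, (T.isDiscrete_labeled β t).mono sdiff_subset,
    fun h => h.2 rfl, ?_⟩
  · rw [← isOpen_compl_iff, isOpen_iff_mem_nhds]
    intro x hx
    filter_upwards [eventually_nhdsNE_not_mem_of_isDiscrete (T.isClosed_labeled β t)
      (T.isDiscrete_labeled β t) x] with y hy hyE
    rw [hy hyE.1] at hyE
    exact hx hyE
  intro K hK hKE hbK
  have hKu : ∀ x ∈ K, x ≠ T.base → x ∈ T.unlabeled β t := by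
    intro x hx hne
    rw [SpreadSurface.unlabeled_eq]
    exact fun h => disjoint_left.1 hKE hx ⟨h, hne⟩
  have hKp : ∀ x ∈ K, T.proj x = β.point (T.coord β x) := by
    intro x hx
    by_cases hne : x = T.base
    · rw [hne, T.coord_eq β hp, hp]
    · obtain ⟨z, -, hz⟩ := hKu x hx hne
      rw [T.coord_eq β hz, hz]
  have hcK : ContinuousOn (T.coord β) K := fun x hx =>
    (T.continuousAt_coord β (hKp x hx)).continuousWithinAt
  obtain ⟨R, hR⟩ := (hK.image_of_continuousOn hcK).isBounded.exists_norm_le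
  have hR' : ∀ x ∈ K, ‖T.coord β x‖ ≤ R := fun x hx => hR _ (mem_image_of_mem _ hx)
  -- One unit more than the bound on `K`, because near the base point the lift is studied also
  -- outside `K`.
  obtain ⟨N, hN⟩ := eventually_atTop.1 (hX.eventually_eq (R + 1))
  refine ⟨N, fun n hn => ?_⟩
  have hg : ∀ z, ‖z‖ ≤ R + 1 → g n z = z := hN n hn.le
  have hXn := hX.sheeting n
  have : Nonempty (X n).carrier := ⟨(X n).base⟩
  -- Each sheet of `T` is sent to the sheet of `X n` with the same vertex.
  obtain ⟨F, hFc, hF⟩ := hT.exists_lift ht (T.isCoordinate β t)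
    (fun v => σX n (component.val v))
    (fun v => by rw [← component.sign_val]; exact hXn.continuousOn _)
    (fun j x y s hs he => (hXn.edge_iff j x.1 y.1 s hs).1 he)
  change ContinuousOn F (T.unlabeled β t) at hFc
  have hFp : ∀ x ∈ T.unlabeled β t, ‖T.coord β x‖ ≤ R + 1 → (X n).proj (F x) = T.proj x := by
    rintro x ⟨z, hz, hx⟩ hle
    rw [T.coord_eq β hx] at hle
    obtain ⟨j, hj⟩ : ∃ ε : ℝ, (ε = 1 ∨ ε = -1) ∧ 0 ≤ ε * z.im := by
      rcases le_total 0 z.im with h | h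
      · exact ⟨1, Or.inl rfl, by simpa using h⟩
      · exact ⟨-1, Or.inr rfl, by simpa using h⟩
    obtain ⟨v, rfl, rfl⟩ := hT.exists_sheet x z j hj.1 ⟨hj.2, hz⟩ hx
    rw [hF v z ⟨hj.2, hz⟩, hx, hXn.map_sheet _ z (by rw [component.sign_val]; exact ⟨hj.2, hz⟩)]
    simp [hg z hle]
  have hz₀ : ‖z₀‖ ≤ R := by
    rw [← T.coord_eq β hp]; exact hR' _ hbK
  -- the lift extends continuously by the base points
  have hlim : Tendsto F (𝓝[≠] T.base) (𝓝 (X n).base) := by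
    obtain ⟨N₁, hN₁, hN₁i⟩ := not_not.1 (X n).base_not_critical
    obtain ⟨U, s, hU, hbU, hUN, hsU, hUo, hsc⟩ :=
      exists_local_section (X n).isOpenMap_proj hN₁ hN₁i
    have hbase : T.proj T.base = (X n).proj (X n).base := by rw [hp, hX.proj_base]
    have hnb : T.proj ⁻¹' ((X n).proj '' U) ∩ {y | y ≠ T.base → y ∈ T.unlabeled β t} ∩
        {y | ‖T.coord β y‖ < R + 1} ∈ 𝓝 T.base := by
      refine inter_mem (inter_mem ?_ (T.eventually_unlabeled β t _)) ?_
      · refine T.continuous_proj.continuousAt (hUo.mem_nhds ?_)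
        rw [hbase]
        exact mem_image_of_mem _ hbU
      · refine (T.continuousAt_coord β hp).norm.eventually_lt continuousAt_const ?_
        rw [T.coord_eq β hp]
        linarith
    obtain ⟨V, hVs, hVo, hbV, hVconn⟩ := exists_nhds_isConnected_diff (T.locally_planar _) hnb
    have hVd := (hVconn {T.base} (countable_singleton _)).isPreconnected
    have hsproj : ∀ w ∈ (X n).proj '' U, s w ∈ U ∧ (X n).proj (s w) = w := by
      rintro _ ⟨x, hx, rfl⟩
      rw [hsU x hx]
      exact ⟨hx, rfl⟩
    have hmem : ∀ x ∈ V \ {T.base}, x ∈ T.unlabeled β t := fun x hx => (hVs hx.1).1.2 hx.2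
    have := neBot_nhdsWithin_vertexHalf hX.sign_mul_nonneg
    have hle : 𝓝[vertexHalf p \ {z₀}] z₀ ≤ 𝓝[vertexHalf p] z₀ :=
      nhdsWithin_mono _ sdiff_subset
    -- A point of the half-plane of `p` so close to `z₀` that its sheet values in `T` and in `X n`
    -- are both close to the base points. There `F` already agrees with the local inverse `s`, and
    -- the punctured neighbourhood is connected.
    obtain ⟨z, ⟨hz1, hz2⟩, hz3, hz4⟩ := (((hb.mono_left hle).eventually (hVo.mem_nhds hbV)).and
      (((hX.tendsto_base n).mono_left hle).eventually (hU.mem_nhds hbU)) |>.and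
      self_mem_nhdsWithin).exists
    have hzh : z ∈ closedHalf t (sign (G.root p)) := by
      rw [hroot]; exact vertexHalf_subset p hz3
    have hzn : σ (G.root p) z ≠ T.base := by
      intro h
      apply hz4
      have := hT.map_sheet _ z hzh
      rw [h, hp, β.point_inj] at this
      exact this.symm
    have hFz : F (σ (G.root p) z) = σX n p z := by
      rw [hF _ z hzh, component.val_root]
    have heq : EqOn F (fun x => s (T.proj x)) (V \ {T.base}) := by
      refine hVd.eqOn_of_lift (hFc.mono hmem) ?_ (X n).proj ?_ ?_
        (a₀ := σ (G.root p) z) ⟨hz1, hzn⟩ ?_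
      · exact hsc.comp T.continuous_proj.continuousOn fun x hx => (hVs hx.1).1.1
      · intro x hx
        rw [hFp x (hmem x hx) (hVs hx.1).2.le, (hsproj _ (hVs hx.1).1.1).2]
      · intro x hx hxe
        refine ⟨N₁, ?_, hN₁i⟩
        rw [hxe]
        exact mem_of_superset (hU.mem_nhds (hsproj _ (hVs hx.1).1.1).1) hUN
      · have h1 := hFp _ (hmem _ ⟨hz1, hzn⟩) (hVs hz1).2.le
        rw [hFz] at h1 ⊢
        change _ = s _
        rw [← h1, hsU _ hz2]
    have h2 : Tendsto (fun x => s (T.proj x)) (𝓝[≠] T.base) (𝓝 (X n).base) := by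
      have h3 : ContinuousAt s (T.proj T.base) := by
        rw [hbase]
        exact hsc.continuousAt (hUo.mem_nhds (mem_image_of_mem _ hbU))
      have h4 := (h3.comp T.continuous_proj.continuousAt).tendsto
      have h5 : (s ∘ T.proj) T.base = (X n).base := by
        rw [Function.comp_apply, hbase, hsU _ hbU]
      rw [h5] at h4
      exact h4.mono_left nhdsWithin_le_nhds
    refine h2.congr' ?_
    have h6 : V \ {T.base} ∈ 𝓝[≠] T.base := sdiff_mem_nhdsWithin_compl (hVo.mem_nhds hbV) _
    filter_upwards [h6] with x hx using (heq hx).symm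
  classical
  have hbase_val : T.base ∈ T.unlabeled β t → F T.base = (X n).base := by
    intro h
    have := T.neBot_nhdsNE T.base
    have h1 := (hFc.continuousAt ((T.isOpen_unlabeled β t).mem_nhds h)).tendsto
    exact tendsto_nhds_unique (h1.mono_left nhdsWithin_le_nhds) hlim
  set φ := Function.update F T.base (X n).base with hφ
  have hφne : ∀ x, x ≠ T.base → φ x = F x := fun x hx => Function.update_of_ne hx _ _
  have hφb : φ T.base = (X n).base := Function.update_self ..
  have hφp : ∀ x ∈ K, (X n).proj (φ x) = T.proj x := by
    intro x hx
    by_cases hne : x = T.base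
    · rw [hne, hφb, hX.proj_base, hp]
    · rw [hφne x hne]
      exact hFp x (hKu x hx hne) ((hR' x hx).trans (by linarith))
  -- Equal images have equal coordinates, so the two points lie at the same `z` on sheets of the
  -- same sign; in `X n` such sheets are disjoint.
  have hFinj : InjOn F (T.unlabeled β t ∩ {x | ‖T.coord β x‖ ≤ R + 1}) := by
    rintro a ⟨ha, haR⟩ b ⟨hb, hbR⟩ hab
    have h1 : T.proj a = T.proj b := by rw [← hFp a ha haR, ← hFp b hb hbR, hab]
    obtain ⟨z, hz, haz⟩ := ha
    rw [haz] at h1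
    obtain ⟨ε, hε⟩ : ∃ ε : ℝ, (ε = 1 ∨ ε = -1) ∧ 0 ≤ ε * z.im := by
      rcases le_total 0 z.im with h | h
      · exact ⟨1, Or.inl rfl, by simpa using h⟩
      · exact ⟨-1, Or.inr rfl, by simpa using h⟩
    obtain ⟨v, rfl, rfl⟩ := hT.exists_sheet a z ε hε.1 ⟨hε.2, hz⟩ haz
    obtain ⟨v', hv', rfl⟩ := hT.exists_sheet b z _ hε.1 ⟨hε.2, hz⟩ h1.symm
    have hz1 : z ∈ closedHalf t (sign v) := ⟨hε.2, hz⟩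
    rw [hF v z hz1, hF v' z (hv' ▸ hz1)] at hab
    have := hXn.sheet_unique (component.val v) (component.val v') z
      (by rw [component.sign_val]; exact hz1)
      (by rw [component.sign_val, component.sign_val, hv']) hab
    rw [component.val_injective this]
  have hinj_base : ∀ x ∈ K, x ≠ T.base → φ x ≠ φ T.base := by
    intro x hx hne heq
    have h1 : T.proj x = T.proj T.base := by rw [← hφp x hx, ← hφp _ hbK, heq]
    have hxu := hKu x hx hne
    have hbu : T.base ∈ T.unlabeled β t := by
      obtain ⟨z, hz, hz'⟩ := hxu
      exact ⟨z, hz, by rw [← h1, hz']⟩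
    rw [hφne x hne, hφb, ← hbase_val hbu] at heq
    refine hne (hFinj ⟨hxu, ?_⟩ ⟨hbu, ?_⟩ heq)
    · exact (hR' x hx).trans (by linarith)
    · exact (hR' _ hbK).trans (by linarith)
  refine ⟨φ, ?_, ?_, hφb, hφp⟩
  · intro x hx
    refine ContinuousAt.continuousWithinAt ?_
    by_cases hne : x = T.base
    · rw [hne]
      exact continuousAt_update_same.2 hlim
    · rw [hφ, continuousAt_update_of_ne hne]
      exact hFc.continuousAt ((T.isOpen_unlabeled β t).mem_nhds (hKu x hx hne))
  · intro a ha b hb hab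
    by_cases hne : a = T.base
    · by_cases hne' : b = T.base
      · rw [hne, hne']
      · rw [hne] at hab
        exact absurd hab.symm (hinj_base b hb hne')
    · by_cases hne' : b = T.base
      · rw [hne'] at hab
        exact absurd hab (hinj_base a ha hne)
      · rw [hφne a hne, hφne b hne'] at hab
        exact hFinj ⟨hKu a ha hne, (hR' a ha).trans (by linarith)⟩
          ⟨hKu b hb hne', (hR' b hb).trans (by linarith)⟩ hab

/-- Two maps over the sphere that preserve base points agree. -/
theorem eq_of_base {β : BaseCurve} {m : ℕ} {t : Fin m → ℝ} {T T' : PointedSpreadSurface.{u}}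
    (hT' : ∀ x, ∀ z ∈ markedPlane t, T'.proj x = β.point z → ∃ U ∈ 𝓝 x, InjOn T'.proj U)
    {φ ψ : T.carrier → T'.carrier} (hφ : Continuous φ) (hψ : Continuous ψ)
    (hφp : ∀ x, T'.proj (φ x) = T.proj x) (hψp : ∀ x, T'.proj (ψ x) = T.proj x)
    (hφb : φ T.base = T'.base) (hψb : ψ T.base = T'.base) : φ = ψ := by
  -- Agreement near the base point rests on the base point not being critical, since it may lie over
  -- a label; from there it spreads over the connected unlabeled part.
  obtain ⟨N, hN, hNi⟩ := not_not.1 T'.base_not_critical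
  have h1 : ∀ᶠ x in 𝓝 T.base, φ x = ψ x := by
    filter_upwards [hφ.continuousAt (by rw [hφb]; exact hN),
      hψ.continuousAt (by rw [hψb]; exact hN)] with x hx hx'
    exact hNi hx hx' (by rw [hφp, hψp])
  obtain ⟨a, hau, ha⟩ := (T.dense_unlabeled β t).inter_nhds_nonempty h1
  have h2 : EqOn φ ψ (T.unlabeled β t) := by
    refine (T.isPreconnected_unlabeled β t).eqOn_of_lift hφ.continuousOn hψ.continuousOn T'.proj
      (fun x _ => by rw [hφp, hψp]) ?_ hau ha
    rintro x ⟨z, hz, hx⟩ -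
    exact hT' _ z hz (by rw [hφp, hx])
  exact hφ.ext_on (T.dense_unlabeled β t) hψ h2

end PointedSpreadSurface

/-! ### Pull-backs to the marked plane -/

namespace SpreadSurface

variable (T : SpreadSurface.{u})

theorem exists_isCompact_nhds {x : T.carrier} {N : Set T.carrier} (hN : N ∈ 𝓝 x) :
    ∃ K ⊆ N, IsCompact K ∧ K ∈ 𝓝 x := by
  obtain ⟨e, he⟩ := T.locally_planar x
  have h1 : e.symm ⁻¹' N ∩ e.target ∈ 𝓝 (e x) := by
    refine inter_mem ?_ (e.open_target.mem_nhds (e.map_source he))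
    apply e.continuousAt_symm (e.map_source he)
    rwa [e.left_inv he]
  obtain ⟨r, hr, hball⟩ := Metric.nhds_basis_closedBall.mem_iff.1 h1
  refine ⟨e.symm '' Metric.closedBall (e x) r, ?_, ?_, ?_⟩
  · rintro _ ⟨z, hz, rfl⟩
    exact (hball hz).1
  · exact (isCompact_closedBall _ _).image_of_continuousOn
      (e.continuousOn_symm.mono fun z hz => (hball hz).2)
  · have h2 := e.symm.image_mem_nhds (e.map_source he)
      (Metric.closedBall_mem_nhds (e x) hr)
    rwa [e.left_inv he] at h2

/-- The pull-back of a surface spread over the sphere to the marked plane under a map `g`. -/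
abbrev Pullback (β : BaseCurve) {m : ℕ} (t : Fin m → ℝ) (g : ℂ → ℂ) : Type u :=
  {y : ℂ × T.carrier // y.1 ∈ markedPlane t ∧ T.proj y.2 = β.point (g y.1)}

end SpreadSurface

namespace IsSheeting

variable {T : SpreadSurface.{u}} {β : BaseCurve} {m : ℕ} {t : Fin m → ℝ} {g : ℂ → ℂ}
  {G : LabeledGraph.{v} (m + 1)} {σ : G.Vertex → ℂ → T.carrier}

open Classical in
/-- The half-planes in the pull-back. -/
noncomputable def pullbackSheet (h : IsSheeting T.proj (β.point ∘ g) t G σ) (v : G.Vertex) (z : ℂ) :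
    T.Pullback β t g :=
  -- Values outside the closed half-plane are irrelevant; the centre of the sheet serves as a
  -- default, so that no point of the pull-back has to be assumed.
  if hz : z ∈ closedHalf t (sign v) then ⟨(z, σ v z), hz.2, h.map_sheet v z hz⟩
  else ⟨((sign v : ℂ) * Complex.I, σ v ((sign v : ℂ) * Complex.I)),
    (mul_I_mem_closedHalf (sign_eq v)).2, h.map_sheet v _ (mul_I_mem_closedHalf (sign_eq v))⟩

theorem pullbackSheet_val (h : IsSheeting T.proj (β.point ∘ g) t G σ) {v : G.Vertex} {z : ℂ}
    (hz : z ∈ closedHalf t (sign v)) : (h.pullbackSheet v z).1 = (z, σ v z) := by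
  rw [pullbackSheet, dif_pos hz]

/-- The pull-back remembers `z` together with the point over `g z`. It thus has a coordinate
although `g` need not be injective, and its graph is unchanged. -/
theorem isSheeting_pullbackSheet (h : IsSheeting T.proj (β.point ∘ g) t G σ) :
    IsSheeting (fun y : T.Pullback β t g => y.1.1) id t G h.pullbackSheet where
  continuousOn v := by
    rw [Topology.IsEmbedding.subtypeVal.isInducing.continuousOn_iff]
    refine ((continuousOn_id.prodMk (h.continuousOn v))).congr fun z hz => ?_
    exact h.pullbackSheet_val hz
  map_sheet v z hz := by
    rw [h.pullbackSheet_val hz]; rfl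
  exists_sheet x z ε hε hz hx := by
    obtain ⟨⟨z', x⟩, hz', hx'⟩ := x
    obtain rfl : z' = z := hx
    obtain ⟨v, rfl, hv⟩ := h.exists_sheet x z' ε hε hz hx'
    refine ⟨v, rfl, Subtype.ext ?_⟩
    rw [h.pullbackSheet_val hz, hv]
  sheet_unique v v' z hz hv hvv := by
    have h1 := congrArg Subtype.val hvv
    rw [h.pullbackSheet_val hz, h.pullbackSheet_val (hv ▸ hz)] at h1
    exact h.sheet_unique v v' z hz hv (Prod.ext_iff.1 h1).2
  edge_iff j x y s hs := by
    rw [h.edge_iff j x y s hs, Subtype.ext_iff, h.pullbackSheet_val (ofReal_mem_closedHalf hs _),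
      h.pullbackSheet_val (ofReal_mem_closedHalf hs _), Prod.ext_iff]
    simp
  locInj x z hz hx := by
    obtain ⟨⟨z', x⟩, hz', hx'⟩ := x
    obtain ⟨U, hU, hUi⟩ := h.locInj x z' hz' hx'
    refine ⟨{y | y.1.2 ∈ U}, ?_, ?_⟩
    · exact (continuous_snd.comp continuous_subtype_val).continuousAt hU
    · intro a ha b hb hab
      have h1 : a.1.1 = b.1.1 := hab
      refine Subtype.ext (Prod.ext h1 (hUi ha hb ?_))
      rw [a.2.2, b.2.2, h1]

theorem isCoordinate_pullback :
    IsCoordinate (fun y : T.Pullback β t g => y.1.1) id t fun y => y.1.1 where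
  eq _ _ _ h := h
  continuousAt _ _ _ _ := (continuous_fst.comp continuous_subtype_val).continuousAt
  isOpen := by
    convert isOpen_univ
    refine eq_univ_of_forall fun y => ⟨y.1.1, y.2.1, rfl⟩

/-- Pull-backs with equal labeled graphs are isomorphic over the marked plane. -/
theorem exists_pullback_map (ht : StrictMono t) (h : IsSheeting T.proj (β.point ∘ g) t G σ)
    {T' : SpreadSurface.{u}} {g' : ℂ → ℂ} {σ' : G.Vertex → ℂ → T'.carrier}
    (h' : IsSheeting T'.proj (β.point ∘ g') t G σ') :
    ∃ F : T.Pullback β t g → T'.Pullback β t g', Continuous F ∧ Function.Injective F ∧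
      (∀ y, (F y).1.1 = y.1.1) ∧
      ∀ v, ∀ z ∈ closedHalf t (sign v), F (h.pullbackSheet v z) = h'.pullbackSheet v z := by
  by_cases hne : Nonempty (T'.Pullback β t g')
  · obtain ⟨F, hF, hF'⟩ := h.isSheeting_pullbackSheet.exists_lift ht isCoordinate_pullback
      h'.pullbackSheet h'.isSheeting_pullbackSheet.continuousOn
      fun j x y s hs he => (h'.isSheeting_pullbackSheet.edge_iff j x y s hs).1 he
    have hall : ∀ y : T.Pullback β t g, ∀ ε : ℝ, (ε = 1 ∨ ε = -1) → 0 ≤ ε * y.1.1.im →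
        ∃ v, sign v = ε ∧ h.pullbackSheet v y.1.1 = y := fun y ε hε hy =>
      h.isSheeting_pullbackSheet.exists_sheet y y.1.1 ε hε ⟨hy, y.2.1⟩ rfl
    have hsgn : ∀ y : T.Pullback β t g, ∃ ε : ℝ, (ε = 1 ∨ ε = -1) ∧ 0 ≤ ε * y.1.1.im := by
      intro y
      rcases le_total 0 y.1.1.im with h | h
      · exact ⟨1, Or.inl rfl, by simpa using h⟩
      · exact ⟨-1, Or.inr rfl, by simpa using h⟩
    have hq : ∀ y, (F y).1.1 = y.1.1 := by
      intro y
      obtain ⟨ε, hε, hy⟩ := hsgn y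
      obtain ⟨v, rfl, hv⟩ := hall y ε hε hy
      rw [← hv, hF' v _ ⟨hy, y.2.1⟩, h'.pullbackSheet_val ⟨hy, y.2.1⟩,
        h.pullbackSheet_val ⟨hy, y.2.1⟩]
    refine ⟨F, ?_, ?_, hq, hF'⟩
    · refine hF.comp_continuous continuous_id fun y => ⟨y.1.1, y.2.1, rfl⟩
    · intro a b hab
      have h1 : a.1.1 = b.1.1 := by rw [← hq a, ← hq b, hab]
      obtain ⟨ε, hε, ha⟩ := hsgn a
      obtain ⟨v, rfl, hv⟩ := hall a ε hε ha
      obtain ⟨v', hv', hv''⟩ := hall b _ hε (h1 ▸ ha)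
      rw [← h1] at hv''
      have hz : a.1.1 ∈ closedHalf t (sign v) := ⟨ha, a.2.1⟩
      rw [← hv, ← hv'', hF' v _ hz, hF' v' _ (hv'.symm ▸ hz)] at hab
      rw [← hv, ← hv'', h'.isSheeting_pullbackSheet.sheet_unique v v' _ hz hv'.symm hab]
  -- `exists_lift` needs a point in the target. If there is none, the source is empty as well: a
  -- point of it would lie on a sheet, and the vertex of that sheet would give a point of the
  -- target.
  · have hemp : IsEmpty (T.Pullback β t g) := by
      refine ⟨fun y => hne ?_⟩
      obtain ⟨v, -, -⟩ : ∃ v : G.Vertex, True ∧ True := by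
        rcases le_total 0 y.1.1.im with h1 | h1
        · obtain ⟨v, -⟩ := h.exists_sheet y.1.2 y.1.1 1 (Or.inl rfl) ⟨by simpa using h1, y.2.1⟩ y.2.2
          exact ⟨v, trivial, trivial⟩
        · obtain ⟨v, -⟩ := h.exists_sheet y.1.2 y.1.1 (-1) (Or.inr rfl) ⟨by simpa using h1, y.2.1⟩
            y.2.2
          exact ⟨v, trivial, trivial⟩
      exact ⟨h'.pullbackSheet v 0⟩
    refine ⟨fun y => hemp.elim y, ?_, fun a => hemp.elim a, fun y => hemp.elim y, fun v z _ =>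
      hemp.elim (h.pullbackSheet v z)⟩
    rw [continuous_iff_continuousAt]
    exact fun y => hemp.elim y

end IsSheeting

/-! ### Germ maps of an approximating surface -/

namespace PointedSpreadSurface

variable {β : BaseCurve} {m : ℕ} {t : Fin m → ℝ} {G : LabeledGraph.{v} (m + 1)} {p : G.Vertex}
  {z₀ : ℂ} {X : ℕ → PointedSpreadSurface.{u}} {g : ℕ → ℂ → ℂ}
  {σX : ∀ n, G.Vertex → ℂ → (X n).carrier}

/-- A map from `A` to the pull-back of the first surface of the sequence that preserves the
coordinates and agrees near the base point with the half-plane of the vertex `p`. -/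
structure IsGermMap (hX : IsSheetedSequence β t G p z₀ X g σX) (T : PointedSpreadSurface.{u})
    (A : Set T.carrier) (ψ : T.carrier → (X 0).Pullback β t (g 0)) : Prop where
  continuousOn : ContinuousOn ψ A
  injOn : InjOn ψ A
  coord_eq : ∀ x ∈ A, (ψ x).1.1 = T.coord β x
  eventually_base : ∀ᶠ x in 𝓝 T.base, x ≠ T.base → T.coord β x ∈ vertexHalf p →
    ψ x = (hX.sheeting 0).pullbackSheet p (T.coord β x)

/-- The projection is open and `z₀` is a limit of the half-plane. Points of this kind are where germ
maps get compared. -/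
theorem frequently_coord_mem_vertexHalf (T : PointedSpreadSurface.{u})
    (hp : T.proj T.base = β.point z₀) (hz₀ : 0 ≤ sign p * z₀.im) :
    ∃ᶠ x in 𝓝 T.base, x ≠ T.base ∧ T.coord β x ∈ vertexHalf p := by
  rw [frequently_iff]
  intro U hU
  have h1 : T.proj '' U ∈ 𝓝 (β.point z₀) := by
    rw [← hp]; exact T.isOpenMap_proj.image_mem_nhds hU
  have h2 := β.continuous_point.continuousAt (x := z₀) h1
  have := neBot_nhdsWithin_vertexHalf hz₀
  obtain ⟨z, hz1, hz2, hz3⟩ := ((eventually_nhdsWithin_of_eventually_nhds h2).and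
    (self_mem_nhdsWithin (s := vertexHalf p \ {z₀}))).exists
  obtain ⟨x, hx, hxz⟩ := hz1
  refine ⟨x, hx, ?_, ?_⟩
  · rintro rfl
    rw [hp, β.point_inj] at hxz
    exact hz3 hxz.symm
  · rw [T.coord_eq β hxz]
    exact hz2

/-- Both maps lift the same coordinate and follow the sheet of `p` near the base point, so
uniqueness of lifts applies. This makes germ maps on different domains compatible. -/
theorem IsGermMap.eqOn {hX : IsSheetedSequence β t G p z₀ X g σX} {T : PointedSpreadSurface.{u}}
    {A A' : Set T.carrier} {ψ ψ' : T.carrier → (X 0).Pullback β t (g 0)}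
    (h : IsGermMap hX T A ψ) (h' : IsGermMap hX T A' ψ') (hp : T.proj T.base = β.point z₀)
    {B : Set T.carrier} (hB : IsPreconnected B) (hBA : B ⊆ A) (hBA' : B ⊆ A')
    (hBb : B ∈ 𝓝[≠] T.base) : EqOn ψ ψ' B := by
  obtain ⟨x, ⟨hne, hxp⟩, ⟨hx, hx'⟩, hxB⟩ := ((frequently_coord_mem_vertexHalf T hp
    hX.sign_mul_nonneg).and_eventually ((h.eventually_base.and h'.eventually_base).and
      (eventually_nhdsWithin_iff.1 hBb))).exists
  refine hB.eqOn_of_lift (h.continuousOn.mono hBA) (h'.continuousOn.mono hBA') (fun y => y.1.1) ?_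
    ?_ (hxB hne) ((hx hne hxp).trans (hx' hne hxp).symm)
  · intro a ha
    rw [h.coord_eq a (hBA ha), h'.coord_eq a (hBA' ha)]
  · intro a ha _
    exact (hX.sheeting 0).isSheeting_pullbackSheet.locInj _ _ (ψ a).2.1 rfl

/-- A compact set with connected part `A` on which the surface embeds into the members of the
sequence carries a germ map. -/
theorem exists_isGermMap (ht : StrictMono t) (hX : IsSheetedSequence β t G p z₀ X g σX)
    (T : PointedSpreadSurface.{u}) (hp : T.proj T.base = β.point z₀) {K A : Set T.carrier}
    (hK : IsCompact K) (hAK : A ⊆ K) (hbK : K ∈ 𝓝 T.base)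
    (hKu : ∀ x ∈ K, x ≠ T.base → x ∈ T.unlabeled β t) (hbA : T.base ∉ A)
    (happ : ∃ N : ℕ, ∀ n, N < n → ∃ φ : T.carrier → (X n).carrier,
        ContinuousOn φ K ∧ InjOn φ K ∧ φ T.base = (X n).base ∧
          ∀ x ∈ K, (X n).proj (φ x) = T.proj x) : ∃ ψ, IsGermMap hX T A ψ := by
  classical
  have hbK' := mem_of_mem_nhds hbK
  have hKp : ∀ x ∈ K, T.proj x = β.point (T.coord β x) := by
    intro x hx
    by_cases hne : x = T.base
    · rw [hne, T.coord_eq β hp, hp]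
    · obtain ⟨z, -, hz⟩ := hKu x hx hne
      rw [T.coord_eq β hz, hz]
  have hcK : ContinuousOn (T.coord β) K := fun x hx =>
    (T.continuousAt_coord β (hKp x hx)).continuousWithinAt
  obtain ⟨R, hR⟩ := (hK.image_of_continuousOn hcK).isBounded.exists_norm_le
  have hR' : ∀ x ∈ K, ‖T.coord β x‖ ≤ R := fun x hx => hR _ (mem_image_of_mem _ hx)
  obtain ⟨N, hN⟩ := happ
  -- A single large `n` suffices: the pull-back of `X n` is then carried to that of `X 0`, which is
  -- the common target for all compact sets.
  obtain ⟨n, hg, hn⟩ := ((hX.eventually_eq R).and (eventually_gt_atTop N)).exists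
  obtain ⟨φ, hφc, hφi, hφb, hφp⟩ := hN n hn
  obtain ⟨F, hFc, hFi, hFq, hF⟩ := (hX.sheeting n).exists_pullback_map ht (hX.sheeting 0)
  have hmem : ∀ x ∈ K, x ≠ T.base → T.coord β x ∈ markedPlane t ∧
      (X n).proj (φ x) = β.point (g n (T.coord β x)) := by
    intro x hx hne
    refine ⟨?_, ?_⟩
    · obtain ⟨z, hz, hxz⟩ := hKu x hx hne
      rwa [T.coord_eq β hxz]
    · rw [hg _ (hR' x hx), hφp x hx, hKp x hx]
  -- The embedding `φ`, paired with the coordinate; off `K` the value is arbitrary.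
  let ψ' : T.carrier → (X n).Pullback β t (g n) := fun x =>
    if h : T.coord β x ∈ markedPlane t ∧ (X n).proj (φ x) = β.point (g n (T.coord β x)) then
      ⟨(T.coord β x, φ x), h⟩ else (hX.sheeting n).pullbackSheet p 0
  have hψ' : ∀ x ∈ K, x ≠ T.base → (ψ' x).1 = (T.coord β x, φ x) := by
    intro x hx hne
    simp only [ψ']
    rw [dif_pos (hmem x hx hne)]
  have hAne : ∀ x ∈ A, x ≠ T.base := fun x hx h => hbA (h ▸ hx)
  refine ⟨F ∘ ψ', ?_, ?_, ?_, ?_⟩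
  · refine hFc.comp_continuousOn ?_
    rw [Topology.IsEmbedding.subtypeVal.isInducing.continuousOn_iff]
    refine ((hcK.prodMk hφc).mono hAK).congr fun x hx => hψ' x (hAK hx) (hAne x hx)
  · intro a ha b hb hab
    have h1 := congrArg Subtype.val (hFi hab)
    rw [hψ' a (hAK ha) (hAne a ha), hψ' b (hAK hb) (hAne b hb)] at h1
    exact hφi (hAK ha) (hAK hb) (Prod.ext_iff.1 h1).2
  · intro x hx
    rw [Function.comp_apply, hFq, hψ' x (hAK hx) (hAne x hx)]
  -- Near the base point `φ x` and the point of the sheet of `p` over the same value both lie in a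
  -- set on which the projection is injective, hence they coincide.
  · obtain ⟨U, hU, hUi⟩ := not_not.1 (X n).base_not_critical
    have h1 : ∀ᶠ x in 𝓝 T.base, φ x ∈ U :=
      (hφc.continuousAt hbK) (by rw [hφb]; exact hU)
    have h2 : ∀ᶠ x in 𝓝 T.base, T.coord β x ∈ vertexHalf p → σX n p (T.coord β x) ∈ U := by
      have h3 := eventually_nhdsWithin_iff.1 ((hX.tendsto_base n) hU)
      rw [← T.coord_eq β hp] at h3
      exact (T.continuousAt_coord β hp).eventually h3
    filter_upwards [h1, h2, hbK] with x hx1 hx2 hxK hne hxp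
    have hz := vertexHalf_subset (t := t) p hxp
    rw [Function.comp_apply, ← hF p _ hz]
    congr 1
    refine Subtype.ext ?_
    rw [hψ' x hxK hne, (hX.sheeting n).pullbackSheet_val hz]
    refine Prod.ext rfl (hUi hx1 (hx2 hxp) ?_)
    rw [hφp x hxK, (hX.sheeting n).map_sheet _ _ hz, Function.comp_apply, hg _ (hR' x hxK),
      hKp x hxK]

/-- If `T` approximates the sequence with the exceptional set `E`, then there is a germ map on the
part of `T` outside `E` and over the marked plane. -/
theorem exists_isGermMap_compl (ht : StrictMono t) (hX : IsSheetedSequence β t G p z₀ X g σX)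
    (T : PointedSpreadSurface.{u}) (hp : T.proj T.base = β.point z₀) {E : Set T.carrier}
    (hEc : IsClosed E) (hEd : IsDiscrete E) (hbE : T.base ∉ E)
    (happ : ∀ K : Set T.carrier, IsCompact K → Disjoint K E → T.base ∈ K →
      ∃ N : ℕ, ∀ n, N < n → ∃ φ : T.carrier → (X n).carrier,
        ContinuousOn φ K ∧ InjOn φ K ∧ φ T.base = (X n).base ∧
          ∀ x ∈ K, (X n).proj (φ x) = T.proj x) :
    ∃ ψ, IsGermMap hX T (T.unlabeled β t \ (E ∪ {T.base})) ψ := by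
  set Y := T.unlabeled β t \ (E ∪ {T.base}) with hY
  have hYo : IsOpen Y := (T.isOpen_unlabeled β t).sdiff (hEc.union isClosed_singleton)
  have hYpre : IsPreconnected Y := by
    have : Y = (T.proj ⁻¹' range (β.label t) ∪ (E ∪ {T.base}))ᶜ := by
      rw [hY, SpreadSurface.unlabeled_eq, compl_union, sdiff_eq]
    rw [this]
    exact isPreconnected_compl_countable T.locally_planar ((T.countable_labeled β t).union
      (hEd.countable_of_secondCountable.union (countable_singleton _)))
  -- Open connected sets that reach the base point and lie in admissible compact sets. Any two of
  -- them meet near the base point, so the family is closed under unions; it is shown to cover `Y`.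
  let 𝒜 : Set (Set T.carrier) := {A | IsOpen A ∧ IsPreconnected A ∧ A ⊆ Y ∧ A ∈ 𝓝[≠] T.base ∧
    ∃ K, IsCompact K ∧ A ⊆ K ∧ K ∈ 𝓝 T.base ∧ K ⊆ insert T.base Y}
  have hgerm : ∀ A ∈ 𝒜, ∃ ψ, IsGermMap hX T A ψ := by
    rintro A ⟨-, -, hAY, -, K, hK, hAK, hKb, hKY⟩
    refine exists_isGermMap ht hX T hp hK hAK hKb ?_ (fun h => (hAY h).2 (Or.inr rfl))
      (happ K hK ?_ (mem_of_mem_nhds hKb))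
    · intro x hx hne
      exact ((hKY hx).resolve_left hne).1
    · rw [disjoint_left]
      intro x hx hxE
      rcases hKY hx with rfl | h
      · exact hbE hxE
      · exact h.2 (Or.inl hxE)
  -- a first member of the family
  have hnear : ∀ᶠ y in 𝓝 T.base, y ∈ insert T.base Y := by
    filter_upwards [T.eventually_unlabeled β t T.base, hEc.isOpen_compl.mem_nhds hbE] with y hy hyE
    by_cases hne : y = T.base
    · exact Or.inl hne
    · exact Or.inr ⟨hy hne, fun h => h.elim hyE hne⟩
  obtain ⟨K₀, hK₀Y, hK₀, hK₀b⟩ := T.exists_isCompact_nhds hnear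
  obtain ⟨V₀, hV₀K, hV₀o, hbV₀, hV₀⟩ := exists_nhds_isConnected_diff (T.locally_planar T.base) hK₀b
  have hA₀ : V₀ \ {T.base} ∈ 𝒜 := by
    refine ⟨hV₀o.sdiff isClosed_singleton, (hV₀ _ (countable_singleton _)).isPreconnected, ?_,
      sdiff_mem_nhdsWithin_compl (hV₀o.mem_nhds hbV₀) _, K₀, hK₀, fun x hx => hV₀K hx.1, hK₀b, hK₀Y⟩
    intro x hx
    exact (hK₀Y (hV₀K hx.1)).resolve_left hx.2
  have hunion : ∀ A ∈ 𝒜, ∀ A' ∈ 𝒜, A ∪ A' ∈ 𝒜 := by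
    rintro A ⟨h1, h2, h3, h4, K, h5, h6, h7, h8⟩ A' ⟨h1', h2', h3', h4', K', h5', h6', h7', h8'⟩
    have := T.neBot_nhdsNE T.base
    obtain ⟨x, hx, hx'⟩ := (Filter.inter_mem h4 h4' |> Filter.nonempty_of_mem)
    refine ⟨h1.union h1', h2.union x hx hx' h2', union_subset h3 h3',
      mem_of_superset h4 subset_union_left, K ∪ K', h5.union h5', union_subset_union h6 h6',
      mem_of_superset h7 subset_union_left, union_subset h8 h8'⟩
  have hext : ∀ x ∈ Y, ∃ V, IsOpen V ∧ x ∈ V ∧ ∀ A ∈ 𝒜, (V ∩ A).Nonempty → V ∪ A ∈ 𝒜 := by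
    intro x hx
    obtain ⟨K₁, hK₁Y, hK₁, hK₁x⟩ := T.exists_isCompact_nhds (hYo.mem_nhds hx)
    obtain ⟨V, hVK, hVo, hxV, hV⟩ := exists_nhds_isConnected_diff (T.locally_planar x) hK₁x
    have hVc : IsPreconnected V := by
      have := (hV ∅ countable_empty).isPreconnected
      rwa [sdiff_empty] at this
    refine ⟨V, hVo, hxV, ?_⟩
    rintro A ⟨h1, h2, h3, h4, K, h5, h6, h7, h8⟩ ⟨y, hyV, hyA⟩
    refine ⟨hVo.union h1, hVc.union y hyV hyA h2, union_subset (hVK.trans hK₁Y) h3,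
      mem_of_superset h4 subset_union_right, K₁ ∪ K, hK₁.union h5, union_subset_union hVK h6,
      mem_of_superset h7 subset_union_right,
      union_subset (hK₁Y.trans (subset_insert _ _)) h8⟩
  have hcover : ∀ x ∈ Y, ∃ A ∈ 𝒜, x ∈ A := by
    by_contra! hcon
    obtain ⟨x, hxY, hx⟩ := hcon
    choose! V hVo hxV hV using hext
    -- The covered points and suitable neighbourhoods of the others are open and would disconnect
    -- `Y`: a neighbourhood that meets a member of the family could be added to it.
    let W₁ : Set T.carrier := ⋃₀ 𝒜
    let W₂ : Set T.carrier := ⋃ y ∈ {y | y ∈ Y ∧ ∀ A ∈ 𝒜, y ∉ A}, V y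
    have h1 : IsOpen W₁ := isOpen_sUnion fun A hA => hA.1
    have h2 : IsOpen W₂ := isOpen_biUnion fun y hy => hVo y hy.1
    have := T.neBot_nhdsNE T.base
    obtain ⟨a, ha⟩ := Filter.nonempty_of_mem hA₀.2.2.2.1
    obtain ⟨y, -, ⟨A, hA, hyA⟩, hy2⟩ := hYpre W₁ W₂ h1 h2 (fun y hy => by
      by_cases h : ∃ A ∈ 𝒜, y ∈ A
      · exact Or.inl h
      · push Not at h
        exact Or.inr (mem_biUnion (x := y) ⟨hy, h⟩ (hxV y hy)))
      ⟨a, hA₀.2.2.1 ha, _, hA₀, ha⟩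
      ⟨x, hxY, mem_biUnion (x := x) ⟨hxY, hx⟩ (hxV x hxY)⟩
    obtain ⟨y', ⟨hy'Y, hy'⟩, hyy'⟩ := mem_iUnion₂.1 hy2
    exact hy' _ (hV y' hy'Y A hA ⟨y, hyy', hyA⟩) (Or.inl (hxV y' hy'Y))
  have : Nonempty (T.carrier → (X 0).Pullback β t (g 0)) := ⟨(hgerm _ hA₀).choose⟩
  choose! ψA hψA using hgerm
  choose! Ax hAx hxAx using hcover
  have hagree : ∀ A ∈ 𝒜, ∀ A' ∈ 𝒜, A ⊆ A' → EqOn (ψA A) (ψA A') A := by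
    intro A hA A' hA' hAA'
    exact (hψA A hA).eqOn (hψA A' hA') hp hA.2.1 Subset.rfl hAA' hA.2.2.2.1
  have hψ : ∀ A ∈ 𝒜, ∀ x ∈ A, ψA (Ax x) x = ψA A x := by
    intro A hA x hx
    have hxY := hA.2.2.1 hx
    have hu := hunion _ (hAx x hxY) A hA
    rw [hagree _ (hAx x hxY) _ hu subset_union_left (hxAx x hxY),
      hagree A hA _ hu subset_union_right hx]
  refine ⟨fun x => ψA (Ax x) x, ?_, ?_, ?_, ?_⟩
  · intro x hx
    have hA := hAx x hx
    have hxA := hxAx x hx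
    have h1 := ((hψA _ hA).continuousOn.continuousAt (hA.1.mem_nhds hxA))
    refine (h1.congr ?_).continuousWithinAt
    filter_upwards [hA.1.mem_nhds hxA] with y hy using (hψ _ hA y hy).symm
  -- Two points lie in a common member of the family, on which the germ map is injective.
  · intro a ha b hb hab
    have hu := hunion _ (hAx a ha) _ (hAx b hb)
    refine (hψA _ hu).injOn (Or.inl (hxAx a ha)) (Or.inr (hxAx b hb)) ?_
    rw [← hψ _ hu a (Or.inl (hxAx a ha)), ← hψ _ hu b (Or.inr (hxAx b hb))]
    exact hab
  · intro x hx
    exact (hψA _ (hAx x hx)).coord_eq x (hxAx x hx)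
  · filter_upwards [(hψA _ hA₀).eventually_base, hV₀o.mem_nhds hbV₀] with x hx hxV hne hxp
    rw [hψ _ hA₀ x ⟨hxV, hne⟩]
    exact hx hne hxp

end PointedSpreadSurface

/-! ### Transport of decompositions, and restriction to a component -/

/-- A continuous, open and locally injective map to the plane provides charts. -/
theorem locally_planar_of_isOpenMap {B : Type*} [TopologicalSpace B] {q : B → ℂ}
    (hc : Continuous q) (ho : IsOpenMap q) {b : B} (hq : ∃ U ∈ 𝓝 b, InjOn q U) :
    ∃ e : OpenPartialHomeomorph B ℂ, b ∈ e.source := by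
  obtain ⟨U, hU, hUi⟩ := hq
  have : Nonempty B := ⟨b⟩
  refine ⟨OpenPartialHomeomorph.ofContinuousOpen
    ((hUi.mono interior_subset).bijOn_image.toPartialEquiv q (interior U) _) hc.continuousOn ho
    isOpen_interior, mem_interior_iff_mem_nhds.2 hU⟩

/-- The gluing yields limits only off `z₀`. If `z₀` is inside the half-plane, continuity identifies
the limit with `f z₀`; otherwise nothing has been removed. -/
theorem tendsto_vertexHalf_of_punctured {Y : Type*} [TopologicalSpace Y] [T2Space Y] {m : ℕ}
    {t : Fin m → ℝ} {k : ℕ} {G : LabeledGraph.{v} k} {p : G.Vertex} {z₀ : ℂ}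
    (hz₀ : 0 ≤ sign p * z₀.im) {f : ℂ → Y} (hf : ContinuousOn f (closedHalf t (sign p))) {b : Y}
    (h : Tendsto f (𝓝[vertexHalf p \ {z₀}] z₀) (𝓝 b)) : Tendsto f (𝓝[vertexHalf p] z₀) (𝓝 b) := by
  by_cases hz : z₀ ∈ vertexHalf p
  · have h1 : ContinuousAt f z₀ := (hf.mono (vertexHalf_subset p)).continuousAt
      ((isOpen_openHalf _).mem_nhds hz)
    have := neBot_nhdsWithin_vertexHalf hz₀
    have h2 := tendsto_nhds_unique h (h1.tendsto.mono_left nhdsWithin_le_nhds)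
    rw [h2]
    exact h1.tendsto.mono_left nhdsWithin_le_nhds
  · rwa [sdiff_singleton_eq_self hz] at h

namespace SpreadSurface

variable (T : SpreadSurface.{u})

theorem weaklyLocallyCompactSpace : WeaklyLocallyCompactSpace T.carrier :=
  ⟨fun _ => by
    obtain ⟨K, -, hK, hx⟩ := T.exists_isCompact_nhds univ_mem
    exact ⟨K, hK, hx⟩⟩

theorem image_coord_mem_nhds (β : BaseCurve) {x : T.carrier} {z : ℂ} (h : T.proj x = β.point z)
    {N : Set T.carrier} (hN : N ∈ 𝓝 x) : ∀ᶠ w in 𝓝 z, ∃ y ∈ N, T.proj y = β.point w := by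
  have h1 := T.isOpenMap_proj.image_mem_nhds hN
  rw [h] at h1
  exact β.continuous_point.continuousAt h1

end SpreadSurface

namespace IsSheeting

/-- Sections over slit planes are local inverses of the coordinate, so the coordinate is open. -/
theorem image_mem_nhds {X S : Type*} [TopologicalSpace X] {π : X → S} {pt : ℂ → S} {m : ℕ}
    {t : Fin m → ℝ} {G : LabeledGraph.{v} (m + 1)} {σ : G.Vertex → ℂ → X} {κ : X → ℂ}
    (h : IsSheeting π pt t G σ) (ht : StrictMono t) (hκ : IsCoordinate π pt t κ) {x : X} {z : ℂ}
    (hz : z ∈ markedPlane t) (hx : π x = pt z) {N : Set X} (hN : N ∈ 𝓝 x) : κ '' N ∈ 𝓝 z := by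
  obtain ⟨j, hj⟩ := mem_slitPlane_of_mem_markedPlane ht hz
  obtain ⟨a, b, hab, hx'⟩ := h.exists_sheetPair ht (j := j) hz hx
  have he : ∀ j' ∈ ({j} : Set (Fin (m + 1))), G.edge j' a b := by simpa using hab
  have h1 := (h.continuousOn_sheetPair he).continuousAt ((isOpen_slitPlane _).mem_nhds hj)
  rw [ContinuousAt, hx' hj] at h1
  filter_upwards [h1 hN, (isOpen_slitPlane {j}).mem_nhds hj] with w hw hw'
  exact ⟨_, hw, hκ.eq _ w (slitPlane_subset _ hw') (h.map_sheetPair a b (slitPlane_subset _ hw'))⟩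

/-- Sheetings are transported by open embeddings over the marked plane. -/
theorem map {B Y S S' : Type*} [TopologicalSpace B] [TopologicalSpace Y] {π : B → S}
    {pt : ℂ → S} {m : ℕ} {t : Fin m → ℝ} {G : LabeledGraph.{v} (m + 1)} {σ : G.Vertex → ℂ → B}
    (h : IsSheeting π pt t G σ) {f : S → S'} (hf : Function.Injective f) {π' : Y → S'} {i : B → Y}
    (hi : IsOpenEmbedding i) (hπ : ∀ b, π' (i b) = f (π b))
    (hr : ∀ y, ∀ z ∈ markedPlane t, π' y = f (pt z) → y ∈ range i) :
    IsSheeting π' (f ∘ pt) t G (fun v z => i (σ v z)) where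
  continuousOn v := hi.continuous.comp_continuousOn (h.continuousOn v)
  map_sheet v z hz := by rw [hπ, h.map_sheet v z hz]; rfl
  exists_sheet y z ε hε hz hy := by
    obtain ⟨b, rfl⟩ := hr y z hz.2 hy
    obtain ⟨v, hv, hv'⟩ := h.exists_sheet b z ε hε hz (hf ((hπ b).symm.trans hy))
    exact ⟨v, hv, by rw [hv']⟩
  sheet_unique v v' z hz hv hvv := h.sheet_unique v v' z hz hv (hi.injective hvv)
  edge_iff j x y s hs := by rw [h.edge_iff j x y s hs, hi.injective.eq_iff]
  locInj y z hz hy := by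
    obtain ⟨b, rfl⟩ := hr y z hz hy
    obtain ⟨U, hU, hUi⟩ := h.locInj b z hz (hf ((hπ b).symm.trans hy))
    refine ⟨i '' U, hi.isOpenMap.image_mem_nhds hU, ?_⟩
    rintro _ ⟨a, ha, rfl⟩ _ ⟨a', ha', rfl⟩ haa
    rw [hπ, hπ] at haa
    rw [hUi ha ha' (hf haa)]

open Classical in
/-- The half-planes of a component. -/
noncomputable def componentSheet {X : Type*} {m : ℕ} (t : Fin m → ℝ) {G : LabeledGraph.{v} (m + 1)}
    (σ : G.Vertex → ℂ → X) (p : G.Vertex) (v : (G.component p).Vertex) (z : ℂ) :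
    componentSet σ t p :=
  if h : σ (component.val v) z ∈ componentSet σ t p then ⟨_, h⟩
  else ⟨σ p ((sign p : ℂ) * Complex.I), p, SimpleGraph.Reachable.refl _, _,
    mul_I_mem_closedHalf (sign_eq p), rfl⟩

theorem componentSheet_val {X : Type*} {m : ℕ} {t : Fin m → ℝ} {G : LabeledGraph.{v} (m + 1)}
    {σ : G.Vertex → ℂ → X} {p : G.Vertex} {v : (G.component p).Vertex} {z : ℂ}
    (hz : z ∈ closedHalf t (sign v)) :
    (componentSheet t σ p v z : X) = σ (component.val v) z := by
  rw [componentSheet, dif_pos]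
  exact ⟨_, component.reachable_val v, z, by rwa [component.sign_val], rfl⟩

theorem isSheeting_componentSheet {X S : Type*} [TopologicalSpace X] {π : X → S} {pt : ℂ → S}
    {m : ℕ} {t : Fin m → ℝ} (ht : StrictMono t) {G : LabeledGraph.{v} (m + 1)}
    {σ : G.Vertex → ℂ → X} {κ : X → ℂ} (h : IsSheeting π pt t G σ) (hκ : IsCoordinate π pt t κ)
    (p : G.Vertex) :
    IsSheeting (fun x : componentSet σ t p => π x) pt t (G.component p) (componentSheet t σ p) where
  continuousOn v := by
    rw [Topology.IsEmbedding.subtypeVal.isInducing.continuousOn_iff]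
    have h1 := h.continuousOn (component.val v)
    rw [component.sign_val] at h1
    exact h1.congr fun z hz => componentSheet_val hz
  map_sheet v z hz := by
    rw [componentSheet_val hz]
    exact h.map_sheet _ z (by rwa [component.sign_val])
  exists_sheet x z ε hε hz hx := by
    obtain ⟨v, rfl, hv⟩ := h.exists_sheet x.1 z ε hε hz hx
    have h1 : G.simple.Reachable p v := by
      rw [← h.mem_componentSet_iff ht hκ hz, hv]
      exact x.2
    obtain ⟨v', rfl⟩ := component.exists_val_eq h1
    refine ⟨v', (component.sign_val v').symm, Subtype.ext ?_⟩
    rw [component.sign_val] at hz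
    rw [componentSheet_val hz, hv]
  sheet_unique v v' z hz hv hvv := by
    have h1 := congrArg Subtype.val hvv
    rw [componentSheet_val hz, componentSheet_val (hv ▸ hz)] at h1
    refine component.val_injective (h.sheet_unique _ _ z (by rwa [component.sign_val]) ?_ h1)
    rw [component.sign_val, component.sign_val, hv]
  edge_iff j x y s hs := by
    rw [Subtype.ext_iff, componentSheet_val (ofReal_mem_closedHalf hs _),
      componentSheet_val (ofReal_mem_closedHalf hs _)]
    exact h.edge_iff j x.1 y.1 s hs
  locInj x z hz hx := by
    obtain ⟨U, hU, hUi⟩ := h.locInj x.1 z hz hx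
    exact ⟨Subtype.val ⁻¹' U, continuous_subtype_val.continuousAt hU,
      fun a ha b hb hab => Subtype.ext (hUi ha hb hab)⟩

end IsSheeting

/-! ### Extension of the germ map over the exceptional set -/

namespace PointedSpreadSurface

variable {β : BaseCurve} {m : ℕ} {t : Fin m → ℝ} {G : LabeledGraph.{v} (m + 1)} {p : G.Vertex}
  {z₀ : ℂ} {X : ℕ → PointedSpreadSurface.{u}} {g : ℕ → ℂ → ℂ}
  {σX : ∀ n, G.Vertex → ℂ → (X n).carrier}

/-- Exceptional points over the marked plane are removable: a connected punctured neighbourhood is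
mapped along one section over a slit plane, and this section is continuous at the point too. -/
theorem exists_isGermMap_unlabeled (ht : StrictMono t) (hX : IsSheetedSequence β t G p z₀ X g σX)
    (T : PointedSpreadSurface.{u}) (hp : T.proj T.base = β.point z₀) (hT : T.Approximates X) :
    ∃ ψ, IsGermMap hX T (T.unlabeled β t) ψ := by
  obtain ⟨E, hEc, hEd, hbE, happ⟩ := hT
  obtain ⟨ψ, hψ⟩ := exists_isGermMap_compl ht hX T hp hEc hEd hbE happ
  set Y := T.unlabeled β t \ (E ∪ {T.base}) with hY
  have hD : (E ∪ {T.base} : Set T.carrier).Countable :=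
    hEd.countable_of_secondCountable.union (countable_singleton _)
  have hP := (hX.sheeting 0).isSheeting_pullbackSheet
  have hYd : T.unlabeled β t ⊆ closure Y := by
    have : Y = (T.proj ⁻¹' range (β.label t) ∪ (E ∪ {T.base}))ᶜ := by
      rw [hY, SpreadSurface.unlabeled_eq, compl_union, sdiff_eq]
    rw [this, (dense_compl_countable T.locally_planar
      ((T.countable_labeled β t).union hD)).closure_eq]
    exact subset_univ _
  have hloc : ∀ x ∈ T.unlabeled β t, ∃ (j : Fin (m + 1)) (a : G.Cross) (b : G.Circ), G.edge j a b ∧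
      T.coord β x ∈ slitPlane t {j} ∧ ∀ᶠ y in 𝓝[Y] x,
        ψ y = sheetPair (hX.sheeting 0).pullbackSheet a b (T.coord β y) := by
    rintro x ⟨z, hz, hxz⟩
    obtain ⟨j, hj⟩ := mem_slitPlane_of_mem_markedPlane ht hz
    have hcx := T.coord_eq β hxz
    have hN : T.coord β ⁻¹' slitPlane t {j} ∩ T.unlabeled β t ∈ 𝓝 x := by
      refine inter_mem (T.continuousAt_coord β hxz ?_)
        ((T.isOpen_unlabeled β t).mem_nhds ⟨z, hz, hxz⟩)
      rw [hcx]
      exact (isOpen_slitPlane _).mem_nhds hj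
    obtain ⟨V, hVN, hVo, hxV, hV⟩ := exists_nhds_isConnected_diff (T.locally_planar x) hN
    have hVD := hV _ hD
    obtain ⟨x₀, hx₀⟩ := hVD.nonempty
    have hVY : V \ (E ∪ {T.base}) ⊆ Y := fun y hy => ⟨(hVN hy.1).2, hy.2⟩
    have hq := hψ.coord_eq x₀ (hVY hx₀)
    obtain ⟨a, b, hab, hsp⟩ := hP.exists_sheetPair ht (j := j) (ψ x₀).2.1 rfl
    have he : ∀ j' ∈ ({j} : Set (Fin (m + 1))), G.edge j' a b := by simpa using hab
    refine ⟨j, a, b, hab, by rw [hcx]; exact hj, ?_⟩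
    have heq : EqOn ψ (fun y => sheetPair (hX.sheeting 0).pullbackSheet a b (T.coord β y))
        (V \ (E ∪ {T.base})) := by
      refine hVD.isPreconnected.eqOn_of_lift (hψ.continuousOn.mono hVY) ?_ (fun y => y.1.1) ?_ ?_
        hx₀ ?_
      · refine (hP.continuousOn_sheetPair he).comp ?_ fun y hy => (hVN hy.1).1
        rintro y hy
        obtain ⟨w, hw, hyw⟩ := (hVN hy.1).2
        exact (T.continuousAt_coord β hyw).continuousWithinAt
      · intro y hy
        rw [hψ.coord_eq y (hVY hy)]
        exact (hP.map_sheetPair a b (slitPlane_subset _ (hVN hy.1).1)).symm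
      · intro y hy _
        exact hP.locInj _ _ (ψ y).2.1 rfl
      · rw [← hq, hsp]
        rw [hq]
        exact (hVN hx₀.1).1
    filter_upwards [inter_mem_nhdsWithin Y (hVo.mem_nhds hxV)] with y hy
    exact heq ⟨hy.2, hy.1.2⟩
  have := T.weaklyLocallyCompactSpace
  have := (X 0).weaklyLocallyCompactSpace
  have hlim : ∀ x ∈ T.unlabeled β t, ∃ y, Tendsto ψ (𝓝[Y] x) (𝓝 y) := by
    intro x hx
    obtain ⟨j, a, b, hab, hj, hev⟩ := hloc x hx
    obtain ⟨z, hz, hxz⟩ := hx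
    have he : ∀ j' ∈ ({j} : Set (Fin (m + 1))), G.edge j' a b := by simpa using hab
    have h1 := (hP.continuousOn_sheetPair he).continuousAt ((isOpen_slitPlane _).mem_nhds hj)
    refine ⟨_, Tendsto.congr' (EventuallyEq.symm hev)
      ((h1.tendsto.comp (T.continuousAt_coord β hxz)).mono_left nhdsWithin_le_nhds)⟩
  have hψ' := continuousOn_extendFrom hYd hlim
  have hYo : IsOpen Y := (T.isOpen_unlabeled β t).sdiff (hEc.union isClosed_singleton)
  have hext : ∀ x ∈ Y, extendFrom Y ψ x = ψ x := by
    intro x hx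
    refine extendFrom_eq (subset_closure hx) ?_
    exact (hψ.continuousOn.continuousAt (hYo.mem_nhds hx)).tendsto.mono_left nhdsWithin_le_nhds
  have hq : ∀ x ∈ T.unlabeled β t, (extendFrom Y ψ x).1.1 = T.coord β x := by
    intro x hx
    obtain ⟨z, hz, hxz⟩ := id hx
    have : (𝓝[Y] x).NeBot := mem_closure_iff_nhdsWithin_neBot.1 (hYd hx)
    have h1 : Tendsto (fun y => (extendFrom Y ψ y).1.1) (𝓝[Y] x) (𝓝 (extendFrom Y ψ x).1.1) := by
      have h2 := (hψ'.continuousAt ((T.isOpen_unlabeled β t).mem_nhds hx)).tendsto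
      exact ((continuous_fst.comp continuous_subtype_val).tendsto _).comp
        (h2.mono_left nhdsWithin_le_nhds)
    have h2 : Tendsto (T.coord β) (𝓝[Y] x) (𝓝 (T.coord β x)) :=
      (T.continuousAt_coord β hxz).tendsto.mono_left nhdsWithin_le_nhds
    refine tendsto_nhds_unique h1 (h2.congr' ?_)
    filter_upwards [self_mem_nhdsWithin] with y hy
    rw [hext y hy, hψ.coord_eq y hy]
  refine ⟨extendFrom Y ψ, hψ', ?_, hq, ?_⟩
  -- If `x` and `x'` had the same image, then near both of them the map would be the same section
  -- composed with the coordinate.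
  · intro x hx x' hx' hxx
    by_contra hne
    obtain ⟨z, hz, hxz⟩ := id hx
    obtain ⟨z', hz', hxz'⟩ := id hx'
    have hzz : z = z' := by
      rw [← T.coord_eq β hxz, ← T.coord_eq β hxz', ← hq x hx, ← hq x' hx', hxx]
    subst hzz
    obtain ⟨N, N', hN, hN', hxN, hxN', hdis⟩ := t2_separation hne
    obtain ⟨j, a, b, hab, hj, hev⟩ := hloc x hx
    have he : ∀ j' ∈ ({j} : Set (Fin (m + 1))), G.edge j' a b := by simpa using hab
    have hlimx : extendFrom Y ψ x =
        sheetPair (hX.sheeting 0).pullbackSheet a b (T.coord β x) := by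
      refine extendFrom_eq (hYd hx) ?_
      have h1 := (hP.continuousOn_sheetPair he).continuousAt ((isOpen_slitPlane _).mem_nhds hj)
      exact Tendsto.congr' (EventuallyEq.symm hev)
        ((h1.tendsto.comp (T.continuousAt_coord β hxz)).mono_left nhdsWithin_le_nhds)
    have hnear : ∀ y ∈ T.unlabeled β t, extendFrom Y ψ y = extendFrom Y ψ x →
        ∀ᶠ y' in 𝓝 y, y' ∈ T.unlabeled β t → extendFrom Y ψ y' =
          sheetPair (hX.sheeting 0).pullbackSheet a b (T.coord β y') := by
      intro y hy hyx
      have h1 := hP.eventually_mem_sheetPair IsSheeting.isCoordinate_pullback he hj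
      rw [← hlimx, ← hyx] at h1
      have h2 := (hψ'.continuousAt ((T.isOpen_unlabeled β t).mem_nhds hy)).eventually h1
      filter_upwards [h2] with y' hy' hy'u
      have h3 := hy'.2
      rw [hq y' hy'u] at h3
      exact h3.symm
    have hM := inter_mem (hnear x hx rfl) (inter_mem (hN.mem_nhds hxN)
      ((T.isOpen_unlabeled β t).mem_nhds hx))
    have hM' := inter_mem (hnear x' hx' hxx.symm) (inter_mem (hN'.mem_nhds hxN')
      ((T.isOpen_unlabeled β t).mem_nhds hx'))
    have h1 := T.isOpenMap_proj.image_mem_nhds hM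
    have h2 := T.isOpenMap_proj.image_mem_nhds hM'
    rw [hxz] at h1
    rw [hxz'] at h2
    -- Disjoint neighbourhoods of `x` and `x'` project to overlapping sets. A common value outside
    -- the countable image of the exceptional set gives two distinct points at which the original
    -- map is already injective.
    obtain ⟨w, hwD, ⟨y, ⟨hy1, hyN, hyu⟩, hyw⟩, ⟨y', ⟨hy'1, hy'N, hy'u⟩, hyw'⟩⟩ :=
      (dense_compl_countable OnePoint.locally_planar (hD.image T.proj)).inter_nhds_nonempty
        (inter_mem h1 h2)
    have hyY : y ∈ Y := ⟨hyu, fun h => hwD ⟨y, h, hyw⟩⟩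
    have hyY' : y' ∈ Y := ⟨hy'u, fun h => hwD ⟨y', h, hyw'⟩⟩
    have hcc : T.coord β y = T.coord β y' := by rw [SpreadSurface.coord, SpreadSurface.coord, hyw, hyw']
    have heq : ψ y = ψ y' := by
      rw [← hext y hyY, ← hext y' hyY', hy1 hyu, hy'1 hy'u, hcc]
    have := hψ.injOn hyY hyY' heq
    subst this
    exact disjoint_left.1 hdis hyN hy'N
  · filter_upwards [hψ.eventually_base, T.eventually_unlabeled β t T.base,
      hEc.isOpen_compl.mem_nhds hbE] with x hx hxu hxE hne hxp
    rw [hext x ⟨hxu hne, fun h => h.elim hxE hne⟩]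
    exact hx hne hxp

end PointedSpreadSurface

/-! ### Kernels are decomposed along the component -/

namespace PointedSpreadSurface

variable {β : BaseCurve} {m : ℕ} {t : Fin m → ℝ} {G : LabeledGraph.{v} (m + 1)} {p : G.Vertex}
  {z₀ : ℂ} {X : ℕ → PointedSpreadSurface.{u}} {g : ℕ → ℂ → ℂ}
  {σX : ∀ n, G.Vertex → ℂ → (X n).carrier}

/-- Source and target are described near `x` by the same section, which makes the germ map open. -/
theorem IsGermMap.eventually_eq_sheetPair (ht : StrictMono t)
    {hX : IsSheetedSequence β t G p z₀ X g σX} {T : PointedSpreadSurface.{u}}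
    {ψ : T.carrier → (X 0).Pullback β t (g 0)} (hψ : IsGermMap hX T (T.unlabeled β t) ψ)
    {x : T.carrier} (hx : x ∈ T.unlabeled β t) :
    ∃ a b, (∀ᶠ y in 𝓝 x, ψ y = sheetPair (hX.sheeting 0).pullbackSheet a b (T.coord β y)) ∧
      ∀ᶠ y in 𝓝 (ψ x), sheetPair (hX.sheeting 0).pullbackSheet a b y.1.1 = y := by
  have hP := (hX.sheeting 0).isSheeting_pullbackSheet
  obtain ⟨z, hz, hxz⟩ := id hx
  obtain ⟨j, hj⟩ := mem_slitPlane_of_mem_markedPlane ht hz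
  have hq := hψ.coord_eq x hx
  rw [T.coord_eq β hxz] at hq
  obtain ⟨a, b, hab, hsp⟩ := hP.exists_sheetPair ht (j := j) hz hq
  have he : ∀ j' ∈ ({j} : Set (Fin (m + 1))), G.edge j' a b := by simpa using hab
  have h1 := hP.eventually_mem_sheetPair IsSheeting.isCoordinate_pullback he hj
  rw [hsp hj] at h1
  refine ⟨a, b, ?_, h1.mono fun y hy => hy.2⟩
  have hnx := (T.isOpen_unlabeled β t).mem_nhds hx
  filter_upwards [(hψ.continuousOn.continuousAt hnx).eventually h1, hnx] with y hy hyu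
  rw [← hψ.coord_eq y hyu]
  exact hy.2.symm

/-- An approximating surface embeds into an approximating surface with a half-plane decomposition
that is indexed by the component of `p`. -/
theorem exists_embeds_isSheeting (ht : StrictMono t) (hX : IsSheetedSequence β t G p z₀ X g σX)
    (T : PointedSpreadSurface.{u}) (hp : T.proj T.base = β.point z₀) (hT : T.Approximates X) :
    ∃ (T' : PointedSpreadSurface.{u}) (σ : (G.component p).Vertex → ℂ → T'.carrier),
      T.Embeds T' ∧ IsSheeting T'.proj β.point t (G.component p) σ ∧
      T'.proj T'.base = β.point z₀ ∧
      Tendsto (σ (G.root p)) (𝓝[vertexHalf p] z₀) (𝓝 T'.base) := by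
  classical
  obtain ⟨ψ, hψ⟩ := exists_isGermMap_unlabeled ht hX T hp hT
  have hroot : sign (G.root p) = sign p := by
    rw [← component.sign_val, component.val_root]
  set τ := (hX.sheeting 0).pullbackSheet with hτ
  have hP : IsSheeting _ _ t G τ := (hX.sheeting 0).isSheeting_pullbackSheet
  have hκ : IsSheeting.IsCoordinate (fun y : (X 0).Pullback β t (g 0) => y.1.1) id t
    (fun y => y.1.1) := IsSheeting.isCoordinate_pullback
  set C := IsSheeting.componentSet τ t p with hC
  have hCo : IsOpen C := by
    rw [isOpen_iff_mem_nhds]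
    intro y hy
    filter_upwards [hP.eventually_mem_componentSet_iff ht hκ p y.2.1 rfl] with y' hy'
    exact hy'.2 hy
  -- The unlabeled part is connected and its image starts on the sheet of `p`.
  have hψC : ∀ x ∈ T.unlabeled β t, ψ x ∈ C := by
    obtain ⟨a, ⟨hne, hap⟩, hau, hag⟩ := ((frequently_coord_mem_vertexHalf T hp
      hX.sign_mul_nonneg).and_eventually
        ((T.eventually_unlabeled β t T.base).and hψ.eventually_base)).exists
    have h1 := hP.subset_componentSet ht hκ p
      ((T.isPreconnected_unlabeled β t).image ψ hψ.continuousOn) (fun y _ => ⟨_, y.2.1, rfl⟩)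
      (mem_image_of_mem ψ (hau hne)) (by
        rw [hag hne hap]
        exact ⟨p, SimpleGraph.Reachable.refl _, _, vertexHalf_subset p hap, rfl⟩)
    exact fun x hx => h1 (mem_image_of_mem ψ hx)
  have hB := hP.isSheeting_componentSheet ht hκ p
  have hqc : Continuous fun y : C => y.1.1.1 :=
    continuous_fst.comp (continuous_subtype_val.comp continuous_subtype_val)
  have hqo : IsOpenMap fun y : C => y.1.1.1 := by
    refine IsOpenMap.comp (g := fun y : (X 0).Pullback β t (g 0) => y.1.1) (f := Subtype.val)
      (IsOpenMap.of_nhds_le fun y => ?_) hCo.isOpenMap_subtype_val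
    intro N hN
    exact mem_of_superset (hP.image_mem_nhds ht hκ y.2.1 rfl hN) (image_preimage_subset _ _)
  have hqi : ∀ y : C, ∃ U ∈ 𝓝 y, InjOn (fun y : C => y.1.1.1) U := fun y =>
    hB.locInj y _ y.1.2.1 rfl
  have : PreconnectedSpace C :=
    isPreconnected_iff_preconnectedSpace.1 (hP.isPreconnected_componentSet ht p)
  have : SecondCountableTopology ((X 0).Pullback β t (g 0)) :=
    Topology.IsEmbedding.subtypeVal.secondCountableTopology
  have : SecondCountableTopology C := Topology.IsEmbedding.subtypeVal.secondCountableTopology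
  obtain ⟨a₀, ha₀⟩ : (T.unlabeled β t).Nonempty :=
    have : Nonempty T.carrier := ⟨T.base⟩
    (T.dense_unlabeled β t).nonempty
  -- The union consists of the component `C` and of those points of `T` that lie over labels; the
  -- remaining points of `T` are identified with their images in `C`.
  let iA : T.carrier → C ⊕ {x : T.carrier // x ∉ T.unlabeled β t} := fun x =>
    if h : x ∈ T.unlabeled β t then Sum.inl ⟨ψ x, hψC x h⟩ else Sum.inr ⟨x, h⟩
  have hiA : ∀ x (h : x ∈ T.unlabeled β t), iA x = Sum.inl ⟨ψ x, hψC x h⟩ := fun x h => dif_pos h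
  have hiA' : ∀ x (h : x ∉ T.unlabeled β t), iA x = Sum.inr ⟨x, h⟩ := fun x h => dif_neg h
  have hAB : ∀ x (y : C), iA x = Sum.inl y ↔ x ∈ T.unlabeled β t ∧ ψ x = y := by
    intro x y
    by_cases h : x ∈ T.unlabeled β t
    · rw [hiA x h, Sum.inl.injEq, Subtype.ext_iff]
      simp [h]
    · rw [hiA' x h]
      simp [h]
  have hcoord : ∀ x ∈ T.unlabeled β t, T.proj x = β.point (ψ x).1.1 := by
    intro x hx
    rw [hψ.coord_eq x hx]
    obtain ⟨z, -, hz⟩ := hx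
    rw [T.coord_eq β hz, hz]
  obtain ⟨S, jA, jB, hjA, hjB, hSA, hSB, hScov, hSAB⟩ :=
    T.toSpreadSurface.exists_glue C
      (fun y => locally_planar_of_isOpenMap hqc hqo (hqi y)) (fun y => β.point y.1.1.1)
      (β.continuous_point.comp hqc) (β.isOpenEmbedding_point.isOpenMap.comp hqo)
      (isDiscrete_fibers_iff.2 fun y => by
        obtain ⟨U, hU, hUi⟩ := hqi y
        filter_upwards [hU] with y' hy' h
        exact hUi hy' (mem_of_mem_nhds hU) (β.point_inj.1 h))
      (C ⊕ {x : T.carrier // x ∉ T.unlabeled β t}) iA Sum.inl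
      (by
        intro a b hab
        by_cases ha : a ∈ T.unlabeled β t
        · rw [hiA a ha] at hab
          obtain ⟨hb, hba⟩ := (hAB b _).1 hab.symm
          exact hψ.injOn ha hb hba.symm
        · by_cases hb : b ∈ T.unlabeled β t
          · rw [hiA b hb] at hab
            exact absurd ((hAB a _).1 hab).1 ha
          · rw [hiA' a ha, hiA' b hb, Sum.inr.injEq] at hab
            exact congrArg Subtype.val hab)
      Sum.inl_injective
      (by
        rintro (y | ⟨x, hx⟩)
        · exact Or.inr ⟨y, rfl⟩
        · exact Or.inl ⟨x, hiA' x hx⟩)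
      (by
        intro a b hab
        obtain ⟨ha, hb⟩ := (hAB a b).1 hab
        rw [hcoord a ha, hb])
      (by
        intro O hO
        obtain ⟨O', hO', rfl⟩ := isOpen_induced_iff.1 hO
        convert hψ.continuousOn.isOpen_inter_preimage (T.isOpen_unlabeled β t) hO' using 1
        ext x
        constructor
        · rintro ⟨y, hy, hyx⟩
          obtain ⟨hx, hxy⟩ := (hAB x y).1 hyx.symm
          exact ⟨hx, by rw [mem_preimage, hxy]; exact hy⟩
        · rintro ⟨hx, hxO⟩
          exact ⟨⟨ψ x, hψC x hx⟩, hxO, (hiA x hx).symm⟩)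
      (by
        intro O hO
        rw [isOpen_iff_mem_nhds]
        rintro y ⟨x, hxO, hxy⟩
        obtain ⟨hx, hψx⟩ := (hAB x y).1 hxy
        -- The image of an open set is open: a nearby point `y'` of `C` is hit by the point of `O`
        -- with the same coordinate, as both are given by one section.
        obtain ⟨a, b, h1, h2⟩ := hψ.eventually_eq_sheetPair ht hx
        have hN := inter_mem h1 (inter_mem (hO.mem_nhds hxO)
          ((T.isOpen_unlabeled β t).mem_nhds hx))
        have h3 := T.image_coord_mem_nhds β (hcoord x hx) hN
        rw [hψx] at h2 h3
        filter_upwards [continuous_subtype_val.continuousAt.eventually h2,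
          hqc.continuousAt.eventually h3] with y' hy' ⟨x', ⟨hx1, hx2, hx3⟩, hx4⟩
        refine ⟨x', hx2, (hAB x' y').2 ⟨hx3, ?_⟩⟩
        rw [hx1, T.coord_eq β hx4, hy'])
      (by
        intro a b hab hne
        -- `C` lies over the marked plane, hence so does `a`, and separation can be done inside the
        -- pull-back.
        have ha : a ∈ T.unlabeled β t := ⟨_, b.1.2.1, hab⟩
        have hne' : ψ a ≠ b := fun h => hne ((hAB a b).2 ⟨ha, h⟩)
        obtain ⟨U, V, hU, hV, haU, hbV, hUV⟩ := t2_separation hne'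
        have hna := (T.isOpen_unlabeled β t).mem_nhds ha
        refine ⟨T.unlabeled β t ∩ ψ ⁻¹' U, inter_mem hna
          (hψ.continuousOn.continuousAt hna (hU.mem_nhds haU)), Subtype.val ⁻¹' V,
          continuous_subtype_val.continuousAt (hV.mem_nhds hbV), ?_⟩
        rw [disjoint_left]
        rintro _ ⟨x, ⟨hx, hxU⟩, rfl⟩ ⟨y, hy, hyx⟩
        obtain ⟨-, hxy⟩ := (hAB x y).1 hyx.symm
        refine disjoint_left.1 hUV hxU ?_
        rw [hxy]
        exact hy)
      ⟨a₀, ⟨ψ a₀, hψC a₀ ha₀⟩, hiA a₀ ha₀⟩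
  have hncrit : ¬ S.IsCriticalPoint (jA T.base) := by
    rw [SpreadSurface.IsCriticalPoint, not_not]
    obtain ⟨U, hU, hUi⟩ := not_not.1 T.base_not_critical
    refine ⟨jA '' U, hjA.isOpenMap.image_mem_nhds hU, ?_⟩
    rintro _ ⟨a, ha, rfl⟩ _ ⟨b, hb, rfl⟩ hab
    rw [hSA, hSA] at hab
    rw [hUi ha hb hab]
  have hS : IsSheeting S.proj β.point t (G.component p)
      (fun v z => jB (IsSheeting.componentSheet t τ p v z)) := by
    refine hB.map (f := β.point) β.isOpenEmbedding_point.injective hjB hSB ?_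
    intro y z hz hy
    rcases hScov y with ⟨x, rfl⟩ | h
    · rw [hSA] at hy
      have hx : x ∈ T.unlabeled β t := ⟨z, hz, hy⟩
      exact ⟨⟨ψ x, hψC x hx⟩, ((hSAB _ _).2 (hiA x hx)).symm⟩
    · exact h
  refine ⟨⟨S, jA T.base, hncrit⟩, fun v z => jB (IsSheeting.componentSheet t τ p v z),
    ⟨jA, hjA.continuous, hjA.injective, rfl, hSA⟩, hS, ?_, ?_⟩
  · exact (hSA _).trans hp
  -- The germ map says nothing about the base point itself, so the limit is first taken off `z₀`.
  · refine tendsto_vertexHalf_of_punctured (t := t) hX.sign_mul_nonneg ?_ ?_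
    · rw [← hroot]
      exact hS.continuousOn _
    intro M hM
    have hN := inter_mem (mem_map.1 (hjA.continuous.continuousAt (x := T.base) hM))
      (inter_mem hψ.eventually_base (T.eventually_unlabeled β t T.base))
    have h3 := T.image_coord_mem_nhds β hp hN
    rw [mem_map]
    filter_upwards [eventually_nhdsWithin_of_eventually_nhds h3, self_mem_nhdsWithin]
      with z ⟨x, ⟨hxM, hxg, hxu⟩, hxz⟩ ⟨hz, hzne⟩
    have hne : x ≠ T.base := by
      rintro rfl
      rw [hp, β.point_inj] at hxz
      exact hzne hxz.symm
    have hcx := T.coord_eq β hxz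
    have h4 := hxg hne (by rw [hcx]; exact hz)
    rw [hcx] at h4
    have hz' : z ∈ closedHalf t (sign (G.root p)) := by
      rw [hroot]; exact vertexHalf_subset p hz
    have h5 : jA x = jB (IsSheeting.componentSheet t τ p (G.root p) z) := by
      rw [hSAB, hAB]
      refine ⟨hxu hne, ?_⟩
      rw [h4, IsSheeting.componentSheet_val hz', component.val_root]
    rw [mem_preimage, ← h5]
    exact hxM

/-- A kernel of a sheeted sequence has a half-plane decomposition that is indexed by the component
of `p`. -/
theorem IsKernel.exists_isSheeting (ht : StrictMono t) (hX : IsSheetedSequence β t G p z₀ X g σX)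
    {T : PointedSpreadSurface.{u}} (hp : T.proj T.base = β.point z₀) (hT : T.IsKernel X) :
    ∃ σ : (G.component p).Vertex → ℂ → T.carrier,
      IsSheeting T.proj β.point t (G.component p) σ ∧
      Tendsto (σ (G.root p)) (𝓝[vertexHalf p] z₀) (𝓝 T.base) := by
  obtain ⟨T', σ, hemb, hσ, hp', hb⟩ := exists_embeds_isSheeting ht hX T hp hT.1
  -- The larger surface approximates the sequence, being decomposed along the component; maximality
  -- makes it equivalent to `T`, and the sheets are carried back.
  obtain ⟨φ, hφb, hφ⟩ := hT.2 T' (approximates_of_isSheeting ht hX T' hσ hp' hb) hemb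
  have hφs : ∀ y, T.proj (φ.symm y) = T'.proj y := fun y => by
    rw [← hφ, φ.apply_symm_apply]
  refine ⟨fun v z => φ.symm (σ v z), ?_, ?_⟩
  · exact hσ.map (f := id) Function.injective_id φ.symm.isOpenEmbedding hφs
      fun y z _ _ => ⟨φ y, φ.symm_apply_apply y⟩
  · have h1 := (φ.symm.continuous.tendsto T'.base).comp hb
    rwa [← hφb, φ.symm_apply_apply] at h1

end PointedSpreadSurface

/-! ### Digons and the points inside them -/

theorem secondCountableTopology_onePoint : SecondCountableTopology (OnePoint ℂ) := by
  choose e he using OnePoint.locally_planar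
  obtain ⟨F, hF⟩ := isCompact_univ.elim_nhds_subcover (fun w => (e w).source)
    (fun w _ => (e w).open_source.mem_nhds (he w))
  have : ∀ w : F, SecondCountableTopology (e w.1).source :=
    fun w => (e w.1).secondCountableTopology_source
  refine TopologicalSpace.secondCountableTopology_of_countable_cover
    (U := fun w : F => (e w.1).source) (fun w => (e w.1).open_source) ?_
  rw [eq_univ_iff_forall]
  intro x
  obtain ⟨w, hw, hx⟩ := mem_iUnion₂.1 (hF.2 (mem_univ x))
  exact mem_iUnion.2 ⟨⟨w, hw⟩, hx⟩

theorem locally_planar_of_isOpenMap_val {V : Set (OnePoint ℂ)} (hV : IsOpen V) (w : V) :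
    ∃ e : OpenPartialHomeomorph V ℂ, w ∈ e.source := by
  obtain ⟨e, he⟩ := OnePoint.locally_planar w.1
  have : Nonempty V := ⟨w⟩
  refine ⟨(hV.isOpenEmbedding_subtypeVal.toOpenPartialHomeomorph Subtype.val).trans e, ?_⟩
  rw [OpenPartialHomeomorph.trans_source]
  exact ⟨by simp, he⟩

namespace IsSheeting

variable {T : SpreadSurface.{u}} {β : BaseCurve} {m : ℕ} {t : Fin m → ℝ}
  {G : LabeledGraph.{v} (m + 1)} {σ : G.Vertex → ℂ → T.carrier}

theorem proj_sheetPair_coord (h : IsSheeting T.proj β.point t G σ) (a : G.Cross) (b : G.Circ)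
    {z : ℂ} (hz : z ∈ markedPlane t) {w : OnePoint ℂ} (hw : w = β.point z) :
    T.proj (sheetPair σ a b (β.coord w)) = w := by
  rw [hw, β.coord_point, h.map_sheetPair a b hz]

/-- Small punctured neighbourhoods of a point over a label lie on one sheet as soon as they meet a
sheet that is bounded by a digon. -/
theorem exists_nhds_sheetPair (h : IsSheeting T.proj β.point t G σ) (ht : StrictMono t)
    {j : Fin (m + 1)} {q : T.carrier} (hq : T.proj q = β.label t j) {M : Set T.carrier}
    (hM : M ∈ 𝓝 q) :
    ∃ N ⊆ M, N ∈ 𝓝 q ∧ (N \ {q}).Nonempty ∧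
      (∀ x ∈ N \ {q}, ∃ z ∈ slitPlane t {j - 1, j}, T.proj x = β.point z) ∧
      ∀ a b, G.edge (j - 1) a b → G.edge j a b →
        (∃ x ∈ N \ {q}, sheetPair σ a b (T.coord β x) = x) →
        ∀ x ∈ N \ {q}, sheetPair σ a b (T.coord β x) = x := by
  have h1 : ∀ᶠ x in 𝓝 q, x ≠ q → ∃ z ∈ slitPlane t {j - 1, j}, T.proj x = β.point z := by
    have h2 := β.eventually_mem_slitPlane ht j
    rw [← hq] at h2
    filter_upwards [T.continuous_proj.continuousAt.eventually h2,
      T.eventually_unlabeled β t q] with x hx hxu hne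
    refine hx fun h3 => ?_
    obtain ⟨z, hz, hxz⟩ := hxu hne
    have h4 := (β.not_mem_range_label_iff (t := t)).2 ⟨z, hz, rfl⟩
    rw [← hxz, h3, hq] at h4
    exact h4 ⟨j, rfl⟩
  obtain ⟨N, hNM, hNo, hqN, hN⟩ := exists_nhds_isConnected_diff (T.locally_planar q)
    (inter_mem hM h1)
  have hNc := hN {q} (countable_singleton q)
  have hs : ∀ x ∈ N \ {q}, ∃ z ∈ slitPlane t {j - 1, j}, T.proj x = β.point z :=
    fun x hx => (hNM hx.1).2 hx.2
  refine ⟨N, fun x hx => (hNM hx).1, hNo.mem_nhds hqN, hNc.nonempty, hs, ?_⟩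
  rintro a b h1 h2 ⟨x₁, hx₁, heq⟩
  have he : ∀ j' ∈ ({j - 1, j} : Set (Fin (m + 1))), G.edge j' a b := by
    rintro j' (rfl | rfl) <;> assumption
  refine hNc.isPreconnected.eqOn_of_lift (f := fun x => sheetPair σ a b (T.coord β x))
    (g := fun x => x) ?_ continuousOn_id T.proj ?_ ?_ hx₁ heq
  · refine (h.continuousOn_sheetPair he).comp ?_ ?_
    · intro x hx
      obtain ⟨z, hz, hxz⟩ := hs x hx
      exact (T.continuousAt_coord β hxz).continuousWithinAt
    · intro x hx
      obtain ⟨z, hz, hxz⟩ := hs x hx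
      rwa [T.coord_eq β hxz]
  · intro x hx
    obtain ⟨z, hz, hxz⟩ := hs x hx
    exact h.proj_sheetPair_coord a b (slitPlane_subset _ hz) hxz
  · intro x hx hxe
    obtain ⟨z, hz, hxz⟩ := hs x hx
    have hxe' : sheetPair σ a b (T.coord β x) = x := hxe
    refine h.locInj _ z (slitPlane_subset _ hz) ?_
    rw [hxe', hxz]

/-- As the projection is open, every value near the label comes from a point near `q`, and the
section returns that point. -/
theorem tendsto_sheetPair (a : G.Cross) (b : G.Circ) {j : Fin (m + 1)} {q : T.carrier}
    (hq : T.proj q = β.label t j) {N : Set T.carrier} (hN : N ∈ 𝓝 q)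
    (hNs : ∀ x ∈ N \ {q}, sheetPair σ a b (T.coord β x) = x) :
    Tendsto (fun w => sheetPair σ a b (β.coord w)) (𝓝[≠] (β.label t j)) (𝓝 q) := by
  intro M hM
  have h1 := T.isOpenMap_proj.image_mem_nhds (inter_mem hM hN)
  rw [hq] at h1
  rw [mem_map]
  filter_upwards [mem_nhdsWithin_of_mem_nhds h1, self_mem_nhdsWithin] with w hw hne
  obtain ⟨x, ⟨hxM, hxN⟩, rfl⟩ := hw
  have hxq : x ≠ q := by
    rintro rfl
    exact hne hq
  have h2 := hNs x ⟨hxN, hxq⟩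
  rw [SpreadSurface.coord] at h2
  rw [mem_preimage, h2]
  exact hxM

/-- If all faces with the label `j` are digons, then the two sheets at any point near the label
are joined along both adjacent arcs. -/
theorem exists_sheetPair_of_digon (h : IsSheeting T.proj β.point t G σ) (ht : StrictMono t)
    {j : Fin (m + 1)} (hd : ¬ G.HasNonDigon j) {x : T.carrier} {z : ℂ}
    (hz : z ∈ slitPlane t {j - 1, j}) (hx : T.proj x = β.point z) :
    ∃ a b, G.edge (j - 1) a b ∧ G.edge j a b ∧ sheetPair σ a b z = x := by
  have hd' : ∀ a b, G.edge j a b → G.edge (j - 1) a b := fun a b hab => by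
    by_contra h1
    exact hd ⟨a, b, hab, h1⟩
  have hz' := slitPlane_subset _ hz
  by_cases hzj : z ∈ slitPlane t {j}
  · obtain ⟨a, b, hab, h1⟩ := h.exists_sheetPair ht (j := j) hz' hx
    exact ⟨a, b, hd' a b hab, hab, h1 hzj⟩
  · have hzj' : z ∈ slitPlane t {j - 1} := by
      rcases hz with h1 | ⟨j', rfl | rfl, h1⟩
      · exact Or.inl h1
      · exact Or.inr ⟨_, rfl, h1⟩
      · exact absurd (Or.inr ⟨_, rfl, h1⟩) hzj
    obtain ⟨a, b, hab, h1⟩ := h.exists_sheetPair ht (j := j - 1) hz' hx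
    -- The edge at `a` with index `j` leads to `b'`, and in a digon so does the one with index `j -
    -- 1`, which leads to `b`.
    obtain ⟨b', hb'⟩ := h.exists_circ ht j a
    obtain rfl := h.circ_unique ht hab (hd' a b' hb')
    exact ⟨a, b, hab, hb', h1 hzj'⟩

/-- A punctured neighbourhood of `q` lies on one pair of sheets joined over both adjacent arcs, and
the section along this pair inverts the projection. -/
theorem not_isCriticalPoint_of_digon (h : IsSheeting T.proj β.point t G σ) (ht : StrictMono t)
    {j : Fin (m + 1)} (hd : ¬ G.HasNonDigon j) {q : T.carrier} (hq : T.proj q = β.label t j) :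
    ¬ T.IsCriticalPoint q := by
  rw [SpreadSurface.IsCriticalPoint, not_not]
  obtain ⟨N, -, hN, ⟨x₁, hx₁⟩, hs, hN'⟩ := h.exists_nhds_sheetPair ht hq univ_mem
  obtain ⟨z, hz, hxz⟩ := hs x₁ hx₁
  obtain ⟨a, b, h1, h2, h3⟩ := h.exists_sheetPair_of_digon ht hd hz hxz
  have hall := hN' a b h1 h2 ⟨x₁, hx₁, by rwa [T.coord_eq β hxz]⟩
  have hne : ∀ x ∈ N \ {q}, T.proj x ≠ T.proj q := by
    intro x hx heq
    obtain ⟨z, hz, hxz⟩ := hs x hx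
    have h4 := (β.not_mem_range_label_iff (t := t)).2 ⟨z, slitPlane_subset _ hz, rfl⟩
    rw [← hxz, heq, hq] at h4
    exact h4 ⟨j, rfl⟩
  refine ⟨N, hN, ?_⟩
  intro x hx y hy hxy
  by_cases hxq : x = q
  · by_cases hyq : y = q
    · rw [hxq, hyq]
    · exact absurd (by rw [← hxy, hxq]) (hne y ⟨hy, hyq⟩)
  · by_cases hyq : y = q
    · exact absurd (by rw [hxy, hyq]) (hne x ⟨hx, hxq⟩)
    · rw [← hall x ⟨hx, hxq⟩, ← hall y ⟨hy, hyq⟩, SpreadSurface.coord, SpreadSurface.coord, hxy]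

theorem not_isCriticalPoint_of_unlabeled (h : IsSheeting T.proj β.point t G σ) {x : T.carrier}
    (hx : x ∈ T.unlabeled β t) : ¬ T.IsCriticalPoint x := by
  obtain ⟨z, hz, hxz⟩ := hx
  rw [SpreadSurface.IsCriticalPoint, not_not]
  exact h.locInj x z hz hxz

end IsSheeting

/-- A surface can be extended over a label at a sheet around the label, unless the surface already
contains the corresponding point. -/
theorem IsSheeting.exists_fill {T : SpreadSurface.{u}} {β : BaseCurve} {m : ℕ} {t : Fin m → ℝ}
    {G : LabeledGraph.{v} (m + 1)} {σ : G.Vertex → ℂ → T.carrier}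
    (h : IsSheeting T.proj β.point t G σ) (ht : StrictMono t) {j : Fin (m + 1)} {a : G.Cross}
    {b : G.Circ} (h1 : G.edge (j - 1) a b) (h2 : G.edge j a b)
    (hno : ¬ ∃ q, T.proj q = β.label t j ∧
      Tendsto (fun w => sheetPair σ a b (β.coord w)) (𝓝[≠] (β.label t j)) (𝓝 q)) :
    ∃ (S : SpreadSurface.{u}) (i : T.carrier → S.carrier), IsOpenEmbedding i ∧
      (∀ x, S.proj (i x) = T.proj x) ∧
      (∀ y, ∀ z ∈ markedPlane t, S.proj y = β.point z → y ∈ range i) ∧ ∃ y, y ∉ range i := by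
  classical
  have he : ∀ j' ∈ ({j - 1, j} : Set (Fin (m + 1))), G.edge j' a b := by
    rintro j' (rfl | rfl) <;> assumption
  set c := β.label t j with hc
  set s : OnePoint ℂ → T.carrier := fun w => sheetPair σ a b (β.coord w) with hs
  obtain ⟨V, hVs, hVo, hcV, hV⟩ := exists_nhds_isConnected_diff (OnePoint.locally_planar c)
    (β.eventually_mem_slitPlane ht j)
  have hVs' : ∀ w ∈ V, w ≠ c → ∃ z ∈ slitPlane t {j - 1, j}, w = β.point z := hVs
  have hsp : ∀ w ∈ V, w ≠ c → T.proj (s w) = w := by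
    intro w hw hne
    obtain ⟨z, hz, hwz⟩ := hVs' w hw hne
    exact h.proj_sheetPair_coord a b (slitPlane_subset _ hz) hwz
  have hsc : ContinuousOn s (V \ {c}) := by
    refine (h.continuousOn_sheetPair he).comp ?_ ?_
    · intro w hw
      obtain ⟨z, hz, rfl⟩ := hVs' w hw.1 hw.2
      exact (β.continuousAt_coord z).continuousWithinAt
    · intro w hw
      obtain ⟨z, hz, rfl⟩ := hVs' w hw.1 hw.2
      rwa [β.coord_point]
  have hsl : ∀ w ∈ V, w ≠ c → ∀ᶠ x in 𝓝 (s w), s (T.proj x) = x := by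
    intro w hw hne
    obtain ⟨z, hz, rfl⟩ := hVs' w hw hne
    have h3 := h.eventually_mem_sheetPair (T.isCoordinate β t) he hz
    rw [hs]
    simp only [β.coord_point]
    exact h3.mono fun x hx => hx.2
  have hVpre : PreconnectedSpace V := by
    have h3 := (hV ∅ countable_empty).isPreconnected
    rw [sdiff_empty] at h3
    exact isPreconnected_iff_preconnectedSpace.1 h3
  have hVsc : SecondCountableTopology V :=
    have : SecondCountableTopology (OnePoint ℂ) := secondCountableTopology_onePoint
    inferInstance
  -- `none` is the new point over the label; the rest of the disk `V` is identified with its image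
  -- under the section.
  let iB : V → Option T.carrier := fun w => if w.1 = c then none else some (s w)
  have hiB : ∀ x (w : V), some x = iB w ↔ w.1 ≠ c ∧ x = s w := by
    intro x w
    by_cases hw : w.1 = c
    · simp [iB, hw]
    · simp [iB, hw]
  have hiBc : iB ⟨c, hcV⟩ = none := if_pos rfl
  obtain ⟨w₀, hw₀V, hw₀c⟩ := (hV {c} (countable_singleton c)).nonempty
  obtain ⟨S, jA, jB, hjA, hjB, hSA, hSB, hScov, hSAB⟩ := T.exists_glue V
    (fun w => locally_planar_of_isOpenMap_val hVo w) Subtype.val continuous_subtype_val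
    hVo.isOpenMap_subtype_val
    (fun y => (Set.subsingleton_singleton.preimage Subtype.val_injective).isDiscrete)
    (Option T.carrier) some iB (Option.some_injective _)
    (by
      intro w w' hww
      by_cases hw : w.1 = c
      · by_cases hw' : w'.1 = c
        · exact Subtype.ext (hw.trans hw'.symm)
        · simp [iB, hw, hw'] at hww
      · by_cases hw' : w'.1 = c
        · simp [iB, hw, hw'] at hww
        · simp only [iB, hw, hw', if_false, Option.some.injEq] at hww
          rw [Subtype.ext_iff, ← hsp w w.2 hw, ← hsp w' w'.2 hw', hww])
    (by
      rintro (_ | x)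
      · exact Or.inr ⟨_, hiBc⟩
      · exact Or.inl ⟨x, rfl⟩)
    (by
      intro x w hxw
      obtain ⟨hw, rfl⟩ := (hiB x w).1 hxw
      exact hsp w w.2 hw)
    (by
      intro O hO
      obtain ⟨O', hO', rfl⟩ := isOpen_induced_iff.1 hO
      rw [isOpen_iff_mem_nhds]
      rintro x ⟨w, hwO, hwx⟩
      obtain ⟨hw, rfl⟩ := (hiB x w).1 hwx.symm
      have h3 : T.proj ⁻¹' (O' ∩ V ∩ {c}ᶜ) ∈ 𝓝 (s w) := by
        refine T.continuous_proj.continuousAt (((hO'.inter hVo).inter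
          isOpen_compl_singleton).mem_nhds ?_)
        rw [hsp w w.2 hw]
        exact ⟨⟨hwO, w.2⟩, hw⟩
      filter_upwards [hsl w w.2 hw, h3] with x hx hx'
      have hne : T.proj x ≠ c := hx'.2
      exact ⟨⟨T.proj x, hx'.1.2⟩, hx'.1.1,
        ((hiB x ⟨T.proj x, hx'.1.2⟩).2 ⟨hne, hx.symm⟩).symm⟩)
    (by
      intro O hO
      have h3 : IsOpen ((V \ {c}) ∩ s ⁻¹' O) :=
        hsc.isOpen_inter_preimage (hVo.sdiff isClosed_singleton) hO
      convert h3.preimage (continuous_subtype_val (p := fun w => w ∈ V)) using 1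
      ext w
      constructor
      · rintro ⟨x, hx, hxw⟩
        obtain ⟨hw, rfl⟩ := (hiB x w).1 hxw
        exact ⟨⟨w.2, hw⟩, hx⟩
      · rintro ⟨⟨-, hw⟩, hx⟩
        exact ⟨s w, hx, (hiB _ _).2 ⟨hw, rfl⟩⟩)
    (by
      intro x w hxw hne
      by_cases hw : w.1 = c
      · rw [hw] at hxw
        -- A point `x` that cannot be separated from the new point would have a punctured
        -- neighbourhood on the section, and would be the limit that `hno` excludes.
        obtain ⟨N, -, hN, -, hs', hN'⟩ := h.exists_nhds_sheetPair ht hxw univ_mem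
        refine ⟨N, hN, univ, univ_mem, ?_⟩
        rw [disjoint_left]
        rintro _ ⟨y, hy, rfl⟩ ⟨w', -, hw'⟩
        obtain ⟨hw'c, hyw⟩ := (hiB y w').1 hw'.symm
        have hyp := hsp w' w'.2 hw'c
        rw [← hyw] at hyp
        have hyx : y ≠ x := by
          rintro rfl
          exact hw'c (hyp.symm.trans hxw)
        refine hno ⟨x, hxw, IsSheeting.tendsto_sheetPair a b hxw hN
          (hN' a b h1 h2 ⟨y, ⟨hy, hyx⟩, ?_⟩)⟩
        rw [SpreadSurface.coord, hyp]
        exact hyw.symm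
      · have hxs : x ≠ s w := fun h3 => hne ((hiB x w).2 ⟨hw, h3⟩)
        obtain ⟨U, U', hU, hU', hxU, hsU, hUU⟩ := t2_separation hxs
        have h3 : (V \ {c}) ∩ s ⁻¹' U' ∈ 𝓝 w.1 :=
          (hsc.isOpen_inter_preimage (hVo.sdiff isClosed_singleton) hU').mem_nhds
            ⟨⟨w.2, hw⟩, hsU⟩
        refine ⟨U, hU.mem_nhds hxU, _, continuous_subtype_val.continuousAt h3, ?_⟩
        rw [disjoint_left]
        rintro _ ⟨y, hy, rfl⟩ ⟨w', hw', hyw⟩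
        obtain ⟨-, rfl⟩ := (hiB y w').1 hyw.symm
        exact disjoint_left.1 hUU hy hw'.2)
    ⟨s w₀, ⟨w₀, hw₀V⟩, (hiB _ _).2 ⟨hw₀c, rfl⟩⟩
  refine ⟨S, jA, hjA, hSA, ?_, jB ⟨c, hcV⟩, ?_⟩
  · intro y z hz hy
    rcases hScov y with hy' | ⟨w, rfl⟩
    · exact hy'
    · refine ⟨s w, (hSAB _ _).2 ((hiB _ _).2 ⟨?_, rfl⟩)⟩
      intro hw
      rw [hSB, hw] at hy
      exact (β.not_mem_range_label_iff (t := t)).2 ⟨z, hz, rfl⟩ ⟨j, hy⟩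
  · rintro ⟨x, hx⟩
    rw [hSAB, hiBc] at hx
    simp at hx

/-! ### Singular values of a decomposed surface -/

namespace SpreadSurface

variable {T : SpreadSurface.{u}}

/-- A path that leaves every compact set cannot follow a section of the projection whose domain
contains the limit of the projected path. -/
theorem false_of_section {γ : ℝ → T.carrier} (hγ : ContinuousOn γ (Ico 0 1))
    (hc : Tendsto γ (𝓝[<] (1 : ℝ)) (cocompact T.carrier)) {a : OnePoint ℂ}
    (hlim : Tendsto (fun r => T.proj (γ r)) (𝓝[<] (1 : ℝ)) (𝓝 a)) {V : Set (OnePoint ℂ)}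
    (ha : a ∈ V) {s : OnePoint ℂ → T.carrier} (hs : ContinuousOn s V)
    (hsec : ∀ w ∈ V, T.proj (s w) = w) (hinj : ∀ w ∈ V, ∃ N ∈ 𝓝 (s w), InjOn T.proj N)
    {r₁ : ℝ} (h0 : 0 ≤ r₁) (h1 : r₁ < 1) (hV : ∀ r ∈ Ico r₁ 1, T.proj (γ r) ∈ V)
    (heq : s (T.proj (γ r₁)) = γ r₁) : False := by
  have hsub : Ico r₁ 1 ⊆ Ico (0 : ℝ) 1 := Ico_subset_Ico_left h0
  have hall : EqOn (fun r => s (T.proj (γ r))) γ (Ico r₁ 1) :=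
    isPreconnected_Ico.eqOn_of_lift
      (hs.comp (T.continuous_proj.comp_continuousOn (hγ.mono hsub)) hV) (hγ.mono hsub) T.proj
      (fun r hr => hsec _ (hV r hr)) (fun r hr _ => hinj _ (hV r hr)) (left_mem_Ico.2 h1) heq
  have hev : ∀ᶠ r in 𝓝[<] (1 : ℝ), r ∈ Ico r₁ 1 := by
    filter_upwards [Ioo_mem_nhdsLT h1] with r hr using ⟨hr.1.le, hr.2⟩
  have hlim' : Tendsto (fun r => T.proj (γ r)) (𝓝[<] (1 : ℝ)) (𝓝[V] a) :=
    tendsto_nhdsWithin_iff.2 ⟨hlim, hev.mono hV⟩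
  have h2 : Tendsto γ (𝓝[<] (1 : ℝ)) (𝓝 (s a)) :=
    ((hs a ha).tendsto.comp hlim').congr' (hev.mono hall)
  have := T.weaklyLocallyCompactSpace
  obtain ⟨K, hK, hKn⟩ := exists_compact_mem_nhds (s a)
  obtain ⟨r, hr, hr'⟩ := ((h2.eventually hKn).and (hc.eventually hK.compl_mem_cocompact)).exists
  exact hr' hr

end SpreadSurface

namespace IsSheeting

variable {T : SpreadSurface.{u}} {β : BaseCurve} {m : ℕ} {t : Fin m → ℝ}
  {G : LabeledGraph.{v} (m + 1)} {σ : G.Vertex → ℂ → T.carrier}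

theorem locInj_sheetPair (h : IsSheeting T.proj β.point t G σ) (a : G.Cross) (b : G.Circ) {z : ℂ}
    (hz : z ∈ markedPlane t) : ∃ N ∈ 𝓝 (sheetPair σ a b z), InjOn T.proj N :=
  h.locInj _ z hz (h.map_sheetPair a b hz)

theorem exists_Ico_subset {γ : ℝ → T.carrier} {a : OnePoint ℂ}
    (hlim : Tendsto (fun r => T.proj (γ r)) (𝓝[<] (1 : ℝ)) (𝓝 a)) {V : Set (OnePoint ℂ)}
    (hV : V ∈ 𝓝 a) : ∃ r₀, 0 ≤ r₀ ∧ r₀ < 1 ∧ ∀ r ∈ Ico r₀ 1, T.proj (γ r) ∈ V := by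
  obtain ⟨l, hl, h1⟩ := mem_nhdsLT_iff_exists_Ioo_subset.1 (hlim hV)
  have hl' : l < 1 := hl
  refine ⟨max 0 ((l + 1) / 2), le_max_left _ _, max_lt one_pos (by linarith), fun r hr => ?_⟩
  exact h1 ⟨lt_of_lt_of_le (by linarith) ((le_max_right _ _).trans hr.1), hr.2⟩

/-- The end of the path lies over a slit plane, where it must follow the section through one of its
points; then it converges in the surface. -/
theorem not_isAsymptoticValue_of_unlabeled (h : IsSheeting T.proj β.point t G σ)
    (ht : StrictMono t) {a : OnePoint ℂ} (ha : a ∉ range (β.label t)) :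
    ¬ T.IsAsymptoticValue a := by
  rintro ⟨γ, hγ, hc, hlim⟩
  obtain ⟨z, hz, rfl⟩ := β.not_mem_range_label_iff.1 ha
  obtain ⟨j, hj⟩ := mem_slitPlane_of_mem_markedPlane ht hz
  have hV : β.point '' slitPlane t {j} ∈ 𝓝 (β.point z) :=
    β.isOpenEmbedding_point.isOpenMap.image_mem_nhds ((isOpen_slitPlane _).mem_nhds hj)
  obtain ⟨r₁, h0, h1, hr⟩ := exists_Ico_subset hlim hV
  obtain ⟨z₁, hz₁, hzr⟩ := hr r₁ (left_mem_Ico.2 h1)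
  obtain ⟨x, y, hxy, hs⟩ := h.exists_sheetPair ht (j := j) (slitPlane_subset _ hz₁) hzr.symm
  refine T.false_of_section hγ hc hlim (V := β.point '' slitPlane t {j}) ⟨z, hj, rfl⟩
    (s := fun w => sheetPair σ x y (β.coord w)) ?_ ?_ ?_ h0 h1 hr ?_
  · refine (h.continuousOn_sheetPair (J := {j}) (by simpa using hxy)).comp ?_ ?_
    · rintro _ ⟨z, -, rfl⟩
      exact (β.continuousAt_coord z).continuousWithinAt
    · rintro _ ⟨z, hz, rfl⟩
      rwa [β.coord_point]
  · rintro _ ⟨z, hz, rfl⟩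
    exact h.proj_sheetPair_coord x y (slitPlane_subset _ hz) rfl
  · rintro _ ⟨z, hz, rfl⟩
    simp only [β.coord_point]
    exact h.locInj_sheetPair x y (slitPlane_subset _ hz)
  · rw [← hzr, β.coord_point, hs hz₁]

theorem singularValues_subset (h : IsSheeting T.proj β.point t G σ) (ht : StrictMono t) :
    T.singularValues ⊆ range (β.label t) := by
  rintro a (⟨x, hx, rfl⟩ | ha)
  · by_contra hn
    exact h.not_isCriticalPoint_of_unlabeled (β.not_mem_range_label_iff.1 hn) hx
  · by_contra hn
    exact h.not_isAsymptoticValue_of_unlabeled ht hn ha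

/-- A label all of whose faces are digons is not singular, if the surface contains the points over
the label inside the digons. -/
theorem not_mem_singularValues_of_digon (h : IsSheeting T.proj β.point t G σ) (ht : StrictMono t)
    {j : Fin (m + 1)} (hd : ¬ G.HasNonDigon j)
    (hfill : ∀ a b, G.edge (j - 1) a b → G.edge j a b → ∃ q, T.proj q = β.label t j ∧
      Tendsto (fun w => sheetPair σ a b (β.coord w)) (𝓝[≠] (β.label t j)) (𝓝 q)) :
    β.label t j ∉ T.singularValues := by
  classical
  have hcrit : ∀ q, T.proj q = β.label t j → ∃ N ∈ 𝓝 q, InjOn T.proj N := fun q hq =>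
    not_not.1 (h.not_isCriticalPoint_of_digon ht hd hq)
  rintro (⟨q, hq, hqj⟩ | ⟨γ, hγ, hc, hlim⟩)
  · exact h.not_isCriticalPoint_of_digon ht hd hqj hq
  obtain ⟨r₀, h0, h1, hr⟩ := exists_Ico_subset hlim (β.eventually_mem_slitPlane ht j)
  -- A path that stays over the label from some time on never enters a sheet and is treated apart:
  -- near an uncritical point over the label it must be constant.
  by_cases hconst : ∀ r ∈ Ico r₀ 1, T.proj (γ r) = β.label t j
  · have h3 := hconst r₀ (left_mem_Ico.2 h1)
    refine T.false_of_section hγ hc hlim (mem_singleton _) (s := fun _ => γ r₀)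
      continuousOn_const ?_ ?_ h0 h1 hconst rfl
    · rintro _ rfl
      exact h3
    · exact fun _ _ => hcrit _ h3
  push Not at hconst
  obtain ⟨r₁, hr₁, hne⟩ := hconst
  obtain ⟨z₁, hz₁, hzr⟩ := hr r₁ hr₁ hne
  obtain ⟨a, b, h2, h3, h4⟩ := h.exists_sheetPair_of_digon ht hd hz₁ hzr
  obtain ⟨q, hq, hqt⟩ := hfill a b h2 h3
  have he : ∀ j' ∈ ({j - 1, j} : Set (Fin (m + 1))), G.edge j' a b := by
    rintro j' (rfl | rfl) <;> assumption
  -- The section along the digon, completed by the point `q` over the label.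
  set s : OnePoint ℂ → T.carrier := Function.update (fun w => sheetPair σ a b (β.coord w))
    (β.label t j) q with hs
  have hsj : s (β.label t j) = q := Function.update_self _ _ _
  have hsne : ∀ w, w ≠ β.label t j → s w = sheetPair σ a b (β.coord w) := fun w hw =>
    Function.update_of_ne hw _ _
  refine T.false_of_section hγ hc hlim
    (V := {w | w ≠ β.label t j → ∃ z ∈ slitPlane t {j - 1, j}, w = β.point z})
    (fun h => absurd rfl h) (s := s) ?_ ?_ ?_ (h0.trans hr₁.1) hr₁.2
    (fun r hr' => hr r ⟨hr₁.1.trans hr'.1, hr'.2⟩) ?_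
  · intro w hw
    refine ContinuousAt.continuousWithinAt ?_
    by_cases hwj : w = β.label t j
    · rw [hwj]
      exact continuousAt_update_same.2 hqt
    · obtain ⟨z, hz, rfl⟩ := hw hwj
      rw [hs, continuousAt_update_of_ne hwj]
      refine ContinuousAt.comp (f := β.coord) (g := sheetPair σ a b) ?_ (β.continuousAt_coord z)
      rw [β.coord_point]
      exact (h.continuousOn_sheetPair he).continuousAt ((isOpen_slitPlane _).mem_nhds hz)
  · intro w hw
    by_cases hwj : w = β.label t j
    · rw [hwj, hsj, hq]
    · obtain ⟨z, hz, hwz⟩ := hw hwj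
      rw [hsne w hwj]
      exact h.proj_sheetPair_coord a b (slitPlane_subset _ hz) hwz
  · intro w hw
    by_cases hwj : w = β.label t j
    · rw [hwj, hsj]
      exact hcrit q hq
    · obtain ⟨z, hz, rfl⟩ := hw hwj
      rw [hsne _ hwj, β.coord_point]
      exact h.locInj_sheetPair a b (slitPlane_subset _ hz)
  · rw [hsne _ hne, hzr, β.coord_point, h4]

theorem isPreconnected_strip (M : ℝ) :
    IsPreconnected {w : ℂ | w.re < M ∧ 0 ≤ w.im ∧ w.im ≤ Real.pi} := by
  refine Convex.isPreconnected ?_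
  exact (convex_halfSpace_re_lt M).inter
    ((convex_halfSpace_im_ge 0).inter (convex_halfSpace_im_le Real.pi))

/-- A label with a face that is not a digon is singular. -/
theorem mem_singularValues_of_hasNonDigon (h : IsSheeting T.proj β.point t G σ)
    (ht : StrictMono t) {j : Fin (m + 1)} (hd : G.HasNonDigon j) :
    β.label t j ∈ T.singularValues := by
  obtain ⟨x₀, y₀, hj, hj'⟩ := hd
  obtain ⟨e, M, hec, he, hec', heM, hex⟩ := β.exists_corner_chart ht j
  set F : ℂ → T.carrier := fun w => σ (Sum.inl x₀) (e w) with hF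
  set F' : ℂ → T.carrier := fun w => σ (Sum.inr y₀) (starRingEnd ℂ (e w)) with hF'
  have hstrip : ∀ {w : ℂ}, w.re < M → 0 ≤ w.im → w.im ≤ Real.pi →
      e w ∈ closedHalf t (sign (Sum.inl x₀ : G.Vertex)) := fun h1 h2 h3 =>
    mem_inl (heM _ h1 h2 h3).1 (heM _ h1 h2 h3).2 x₀
  have hstrip' : ∀ {w : ℂ}, w.re < M → 0 ≤ w.im → w.im ≤ Real.pi →
      starRingEnd ℂ (e w) ∈ closedHalf t (sign (Sum.inr y₀ : G.Vertex)) := fun h1 h2 h3 =>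
    mem_inr (by simpa using (heM _ h1 h2 h3).1)
      (fun i hi => (heM _ h1 h2 h3).2 i (by rw [← Complex.conj_conj (e _), hi, Complex.conj_ofReal]))
      y₀
  -- The middle line of the half-strip, run through towards the corner; the constant `M - 1` keeps
  -- it inside the strip from `r = 0` on.
  set l : ℝ → ℂ := fun r => ((Real.log (1 - r) + (M - 1) : ℝ) : ℂ) + (Real.pi / 2 : ℝ) * Complex.I
    with hl
  have hlre : ∀ r, (l r).re = Real.log (1 - r) + (M - 1) := fun r => by simp [hl]
  have hlim : ∀ r, (l r).im = Real.pi / 2 := fun r => by simp [hl]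
  have hlt : Tendsto l (𝓝[<] (1 : ℝ)) (comap Complex.re atBot) := by
    rw [tendsto_comap_iff]
    have h1 : Tendsto (fun r : ℝ => 1 - r) (𝓝[<] 1) (𝓝[>] 0) := by
      refine tendsto_nhdsWithin_iff.2 ⟨?_, ?_⟩
      · have : Continuous fun r : ℝ => 1 - r := by fun_prop
        have h2 := this.tendsto 1
        rw [sub_self] at h2
        exact h2.mono_left nhdsWithin_le_nhds
      · filter_upwards [self_mem_nhdsWithin] with r hr
        exact sub_pos.2 (show r < 1 from hr)
    refine (tendsto_atBot_add_const_right _ (M - 1)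
      (Real.tendsto_log_nhdsGT_zero.comp h1)).congr fun r => ?_
    exact (hlre r).symm
  have hlM : ∀ r ∈ Ico (0 : ℝ) 1, (l r).re < M := fun r hr => by
    rw [hlre]
    have := Real.log_nonpos (x := 1 - r) (by linarith [hr.2]) (by linarith [hr.1])
    linarith
  have hpi : ∀ r, 0 ≤ (l r).im ∧ (l r).im ≤ Real.pi := fun r => by
    rw [hlim]
    constructor <;> linarith [Real.pi_pos]
  have hFp : ∀ {w : ℂ}, w.re < M → 0 ≤ w.im → w.im ≤ Real.pi → T.proj (F w) = β.point (e w) :=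
    fun h1 h2 h3 => h.map_sheet _ _ (hstrip h1 h2 h3)
  have hlim1 : Tendsto (fun r => T.proj (F (l r))) (𝓝[<] (1 : ℝ)) (𝓝 (β.label t j)) := by
    refine (he.comp hlt).congr' ?_
    filter_upwards [Ioo_mem_nhdsLT one_pos] with r hr
    exact (hFp (hlM r ⟨hr.1.le, hr.2⟩) (hpi r).1 (hpi r).2).symm
  -- Either the path into the corner leaves every compact set and the label is an asymptotic value,
  -- or it accumulates at a point over the label, which is then shown to be critical.
  by_cases hco : Tendsto (fun r => F (l r)) (𝓝[<] (1 : ℝ)) (cocompact T.carrier)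
  · refine Or.inr ⟨_, ?_, hco, hlim1⟩
    refine (h.continuousOn (Sum.inl x₀)).comp (hec.comp_continuousOn ?_)
      fun r hr => hstrip (hlM r hr) (hpi r).1 (hpi r).2
    refine ContinuousOn.add (Complex.continuous_ofReal.comp_continuousOn ?_) continuousOn_const
    refine ContinuousOn.add (ContinuousOn.log (by fun_prop) ?_) continuousOn_const
    exact fun r hr => by linarith [hr.2]
  obtain ⟨q, hq⟩ := exists_mapClusterPt_of_not_tendsto_cocompact hco
  have hqj : T.proj q = β.label t j := by
    have h1 : MapClusterPt (T.proj q) (𝓝[<] (1 : ℝ)) (fun r => T.proj (F (l r))) :=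
      hq.continuousAt_comp T.continuous_proj.continuousAt
    exact eq_of_nhds_neBot (ClusterPt.mono h1 hlim1)
  refine Or.inl ⟨q, fun hcr => ?_, hqj⟩
  obtain ⟨N, hN, hNi⟩ := hcr
  obtain ⟨U, s, hUo, hqU, -, hsU, hVo, hsc⟩ := exists_local_section T.isOpenMap_proj hN hNi
  have hVn : T.proj '' U ∈ 𝓝 (β.label t j) := hVo.mem_nhds ⟨q, hqU, hqj⟩
  obtain ⟨M₂, hM₂M, hM₂⟩ : ∃ M₂ ≤ M, ∀ w : ℂ, w.re < M₂ →
      β.point (e w) ∈ T.proj '' U ∧ β.point (starRingEnd ℂ (e w)) ∈ T.proj '' U := by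
    obtain ⟨B, hB, h1⟩ := (he.eventually hVn).and (hec'.eventually hVn)
    obtain ⟨M', hM'⟩ := mem_atBot_sets.1 hB
    exact ⟨min M M', min_le_left _ _, fun w hw => h1 (hM' _ (hw.le.trans (min_le_right _ _)))⟩
  have hsp : ∀ w ∈ T.proj '' U, T.proj (s w) = w := by
    rintro _ ⟨x, hx, rfl⟩
    rw [hsU x hx]
  obtain ⟨r₁, hr₁U, hr₁M, hr₁0⟩ : ∃ r, F (l r) ∈ U ∧ (l r).re < M₂ ∧ r ∈ Ico (0 : ℝ) 1 := by
    have h1 := hq.frequently (hUo.mem_nhds hqU)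
    have h2 : ∀ᶠ r in 𝓝[<] (1 : ℝ), (l r).re < M₂ :=
      (tendsto_comap_iff.1 hlt).eventually (eventually_lt_atBot M₂)
    have h3 : ∀ᶠ r in 𝓝[<] (1 : ℝ), r ∈ Ico (0 : ℝ) 1 := by
      filter_upwards [Ioo_mem_nhdsLT one_pos] with r hr using ⟨hr.1.le, hr.2⟩
    obtain ⟨r, hr, hr'⟩ := (h1.and_eventually (h2.and h3)).exists
    exact ⟨r, hr, hr'⟩
  set A : Set ℂ := {w : ℂ | w.re < M₂ ∧ 0 ≤ w.im ∧ w.im ≤ Real.pi} with hA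
  have hAM : ∀ w ∈ A, w.re < M := fun w hw => hw.1.trans_le hM₂M
  -- If `q` were not critical, the local inverse `s` would follow the sheet of `x₀` in a whole
  -- half-strip, since the two agree at one point of the path.
  have hFs : EqOn F (fun w => s (β.point (e w))) A := by
    refine (isPreconnected_strip M₂).eqOn_of_lift ?_ ?_ T.proj ?_ ?_
      (a₀ := l r₁) ⟨hr₁M, hpi r₁⟩ ?_
    · exact (h.continuousOn _).comp hec.continuousOn fun w hw => hstrip (hAM w hw) hw.2.1 hw.2.2
    · exact hsc.comp (β.continuous_point.comp hec).continuousOn fun w hw => (hM₂ w hw.1).1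
    · intro w hw
      rw [hsp _ (hM₂ w hw.1).1, hFp (hAM w hw) hw.2.1 hw.2.2]
    · intro w hw _
      exact h.locInj _ _ (hstrip (hAM w hw) hw.2.1 hw.2.2).2 (hFp (hAM w hw) hw.2.1 hw.2.2)
    · rw [← hFp (hAM _ ⟨hr₁M, hpi r₁⟩) (hpi r₁).1 (hpi r₁).2, hsU _ hr₁U]
  have hcorner : ∃ w₁ ∈ A, ∃ w₂ ∈ A, ∃ s₁ ∈ BaseCurve.arc t j, ∃ s₂ ∈ BaseCurve.arc t (j - 1),
      e w₁ = (s₁ : ℂ) ∧ e w₂ = (s₂ : ℂ) := by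
    obtain ⟨s₁, hs₁, s₂, hs₂, h1⟩ := hex (M₂ - 1) (by linarith)
    have hA1 : ((M₂ - 1 : ℝ) : ℂ) ∈ A := ⟨by simp, by simp, by simpa using Real.pi_pos.le⟩
    have hA2 : ((M₂ - 1 : ℝ) : ℂ) + Real.pi * Complex.I ∈ A :=
      ⟨by simp, by simpa using Real.pi_pos.le, by simp⟩
    rcases h1 with ⟨h1, h2⟩ | ⟨h1, h2⟩
    · exact ⟨_, hA1, _, hA2, s₁, hs₁, s₂, hs₂, h1, h2⟩
    · exact ⟨_, hA2, _, hA1, s₁, hs₁, s₂, hs₂, h2, h1⟩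
  obtain ⟨w₁, hw₁, w₂, hw₂, s₁, hs₁, s₂, hs₂, he₁, he₂⟩ := hcorner
  have hFp' : ∀ w ∈ A, T.proj (F' w) = β.point (starRingEnd ℂ (e w)) := fun w hw =>
    h.map_sheet _ _ (hstrip' (hAM w hw) hw.2.1 hw.2.2)
  -- The edge with index `j` lets the same local inverse pass over to the sheet of `y₀`, where it is
  -- followed on the conjugate strip.
  have hFs' : EqOn F' (fun w => s (β.point (starRingEnd ℂ (e w)))) A := by
    refine (isPreconnected_strip M₂).eqOn_of_lift ?_ ?_ T.proj ?_ ?_ (a₀ := w₁) hw₁ ?_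
    · exact (h.continuousOn _).comp (Complex.continuous_conj.comp hec).continuousOn
        fun w hw => hstrip' (hAM w hw) hw.2.1 hw.2.2
    · exact hsc.comp (β.continuous_point.comp (Complex.continuous_conj.comp hec)).continuousOn
        fun w hw => (hM₂ w hw.1).2
    · intro w hw
      rw [hsp _ (hM₂ w hw.1).2, hFp' w hw]
    · intro w hw _
      exact h.locInj _ _ (hstrip' (hAM w hw) hw.2.1 hw.2.2).2 (hFp' w hw)
    · have h1 := hFs hw₁
      simp only [hF, hF', he₁, Complex.conj_ofReal] at h1 ⊢
      rw [← h1, (h.edge_iff j x₀ y₀ s₁ hs₁).1 hj]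
  -- At the other side of the strip both sheets agree with `s` on the arc `j - 1`, which yields the
  -- missing edge.
  refine hj' ((h.edge_iff (j - 1) x₀ y₀ s₂ hs₂).2 ?_)
  have h1 := hFs hw₂
  have h2 := hFs' hw₂
  simp only [hF, hF', he₂, Complex.conj_ofReal] at h1 h2
  rw [h1, h2]

end IsSheeting

/-! ### Singular values of a kernel -/

namespace PointedSpreadSurface

variable {β : BaseCurve} {m : ℕ} {t : Fin m → ℝ} {G : LabeledGraph.{v} (m + 1)} {p : G.Vertex}
  {z₀ : ℂ} {X : ℕ → PointedSpreadSurface.{u}} {g : ℕ → ℂ → ℂ}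
  {σX : ∀ n, G.Vertex → ℂ → (X n).carrier}

/-- A kernel contains the points over the labels inside the digons. -/
theorem IsKernel.exists_point_of_digon (ht : StrictMono t) (hX : IsSheetedSequence β t G p z₀ X g σX)
    {T : PointedSpreadSurface.{u}} (hp : T.proj T.base = β.point z₀) (hT : T.IsKernel X)
    {σ : (G.component p).Vertex → ℂ → T.carrier}
    (hσ : IsSheeting T.proj β.point t (G.component p) σ)
    (hb : Tendsto (σ (G.root p)) (𝓝[vertexHalf p] z₀) (𝓝 T.base)) {j : Fin (m + 1)}
    {a : (G.component p).Cross} {b : (G.component p).Circ} (h1 : (G.component p).edge (j - 1) a b)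
    (h2 : (G.component p).edge j a b) :
    ∃ q, T.proj q = β.label t j ∧
      Tendsto (fun w => sheetPair σ a b (β.coord w)) (𝓝[≠] (β.label t j)) (𝓝 q) := by
  by_contra hno
  obtain ⟨S, i, hi, hSi, hcov, y, hy⟩ := hσ.exists_fill ht h1 h2 hno
  have hbase : ¬ S.IsCriticalPoint (i T.base) := by
    obtain ⟨U, hU, hUi⟩ := not_not.1 T.base_not_critical
    refine not_not.2 ⟨i '' U, hi.isOpenMap.image_mem_nhds hU, ?_⟩
    rintro _ ⟨x, hx, rfl⟩ _ ⟨x', hx', rfl⟩ hxx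
    rw [hSi, hSi] at hxx
    rw [hUi hx hx' hxx]
  set T' : PointedSpreadSurface.{u} := ⟨S, i T.base, hbase⟩ with hT'
  have hσ' : IsSheeting T'.proj β.point t (G.component p) (fun v z => i (σ v z)) :=
    hσ.map (f := id) Function.injective_id hi hSi fun y z hz hyz => hcov y z hz hyz
  have happ : T'.Approximates X := approximates_of_isSheeting ht hX T' hσ' ((hSi _).trans hp)
    ((hi.continuous.tendsto _).comp hb)
  obtain ⟨φ, hφb, hφ⟩ := hT.2 T' happ ⟨i, hi.continuous, hi.injective, rfl, hSi⟩
  -- Maximality gives some equivalence; by uniqueness it is the inclusion, which misses the new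
  -- point.
  have h3 : (φ : T.carrier → T'.carrier) = i :=
    eq_of_base (β := β) (t := t) (T' := T') (fun x z hz hx => hσ'.locInj x z hz hx) φ.continuous
      hi.continuous hφ hSi hφb rfl
  obtain ⟨x, hx⟩ := φ.surjective y
  exact hy ⟨x, by rw [← h3, hx]⟩

theorem IsKernel.label_mem_singularValues_iff (ht : StrictMono t)
    (hX : IsSheetedSequence β t G p z₀ X g σX) {T : PointedSpreadSurface.{u}}
    (hp : T.proj T.base = β.point z₀) (hT : T.IsKernel X)
    {σ : (G.component p).Vertex → ℂ → T.carrier}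
    (hσ : IsSheeting T.proj β.point t (G.component p) σ)
    (hb : Tendsto (σ (G.root p)) (𝓝[vertexHalf p] z₀) (𝓝 T.base)) (j : Fin (m + 1)) :
    β.label t j ∈ T.singularValues ↔ (G.component p).HasNonDigon j := by
  refine ⟨fun h => ?_, hσ.mem_singularValues_of_hasNonDigon ht⟩
  by_contra hd
  exact hσ.not_mem_singularValues_of_digon ht hd
    (fun a b h1 h2 => hT.exists_point_of_digon ht hX hp hσ hb h1 h2) h

end PointedSpreadSurface

/-! ### From a decomposition to the Speiser graph and its hemispheres -/

/-- The coordinate of the point with parameter `r` on the edge that crosses the curve at `s`. -/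
noncomputable def crossingCoord (s r : ℝ) : ℂ :=
  ((s * (1 - |1 - 2 * r|) : ℝ) : ℂ) + ((1 - 2 * r : ℝ) : ℂ) * Complex.I

theorem continuous_crossingCoord (s : ℝ) : Continuous (crossingCoord s) := by
  unfold crossingCoord
  fun_prop

theorem crossingCoord_zero (s : ℝ) : crossingCoord s 0 = Complex.I := by
  simp [crossingCoord]

theorem crossingCoord_one (s : ℝ) : crossingCoord s 1 = -Complex.I := by
  have h : |(1 : ℝ) - 2 * 1| = 1 := by norm_num
  rw [crossingCoord, h]
  norm_num

/-- The polygon meets the real line only at `r = 1/2`, in the point `s`. -/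
theorem crossingCoord_mem_slitPlane {m : ℕ} {t : Fin m → ℝ} {j : Fin (m + 1)} {s : ℝ}
    (hs : s ∈ BaseCurve.arc t j) (r : ℝ) : crossingCoord s r ∈ slitPlane t {j} := by
  by_cases hr : 1 - 2 * r = 0
  · right
    refine ⟨j, rfl, ?_⟩
    simpa [crossingCoord, hr] using hs
  · left
    simpa [crossingCoord] using hr

theorem LabeledGraph.I_mem_closedHalf {m : ℕ} {t : Fin m → ℝ} {k : ℕ} {G : LabeledGraph.{v} k}
    (x : G.Cross) : Complex.I ∈ closedHalf t (sign (Sum.inl x : G.Vertex)) :=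
  vertexHalf_subset (G := G) (Sum.inl x) (by simp [vertexHalf])

theorem LabeledGraph.neg_I_mem_closedHalf {m : ℕ} {t : Fin m → ℝ} {k : ℕ} {G : LabeledGraph.{v} k}
    (y : G.Circ) : -Complex.I ∈ closedHalf t (sign (Sum.inr y : G.Vertex)) :=
  vertexHalf_subset (G := G) (Sum.inr y) (by simp [vertexHalf])

theorem isPreconnected_vertexHalf {k : ℕ} {G : LabeledGraph.{v} k} (p : G.Vertex) :
    IsPreconnected (vertexHalf p) := isPreconnected_openHalf _

theorem LabeledGraph.vertexHalf_inl {k : ℕ} {G : LabeledGraph.{v} k} (x : G.Cross) :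
    vertexHalf (Sum.inl x : G.Vertex) = {z | 0 < z.im} := by
  simp [vertexHalf]

theorem LabeledGraph.vertexHalf_inr {k : ℕ} {G : LabeledGraph.{v} k} (y : G.Circ) :
    vertexHalf (Sum.inr y : G.Vertex) = {z | z.im < 0} := by
  simp [vertexHalf]

namespace IsSheeting

variable {T : SpreadSurface.{u}} {β : BaseCurve} {m : ℕ} {t : Fin m → ℝ}
  {G : LabeledGraph.{v} (m + 1)} {σ : G.Vertex → ℂ → T.carrier}

/-- Edges are the lifts of the paths that cross the curve once. -/
theorem edge_iff_exists_path (h : IsSheeting T.proj β.point t G σ) (ht : StrictMono t)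
    {j : Fin (m + 1)} {s : ℝ} (hs : s ∈ BaseCurve.arc t j) (x : G.Cross) (y : G.Circ)
    {a b : T.carrier} (ha : a = σ (Sum.inl x) Complex.I) (hb : b = σ (Sum.inr y) (-Complex.I)) :
    (∃ c : Path a b, ∀ r : unitInterval, T.proj (c r) = β.crossing s r) ↔ G.edge j x y := by
  have hmem := crossingCoord_mem_slitPlane hs
  have hmem' : ∀ r, crossingCoord s r ∈ markedPlane t := fun r => slitPlane_subset _ (hmem r)
  have hcont : ∀ y', G.edge j x y' →
      Continuous fun r : unitInterval => sheetPair σ x y' (crossingCoord s r) := fun y' hy' =>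
    (h.continuousOn_sheetPair (J := {j}) (by simpa using hy')).comp_continuous
      ((continuous_crossingCoord s).comp continuous_subtype_val) fun r => hmem r
  have h0 : ∀ y', sheetPair σ x y' (crossingCoord s 0) = a := fun y' => by
    rw [crossingCoord_zero, sheetPair_of_im_nonneg (by simp), ha]
  have h1 : ∀ y', sheetPair σ x y' (crossingCoord s 1) = σ (Sum.inr y') (-Complex.I) := fun y' => by
    rw [crossingCoord_one, sheetPair, if_neg (by simp)]
  constructor
  · rintro ⟨c, hc⟩
    -- The given path is compared with the lift that follows the edge from `x` to its neighbour
    -- `y'`; lifts with the same start have the same end.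
    obtain ⟨y', hy'⟩ := h.exists_circ ht j x
    have hall := (isPreconnected_univ (α := unitInterval)).eqOn_of_lift
      (f := fun r => sheetPair σ x y' (crossingCoord s r)) (g := c) (hcont y' hy').continuousOn
      c.continuous.continuousOn T.proj
      (fun r _ => by rw [h.map_sheetPair x y' (hmem' r), hc]; rfl)
      (fun r _ _ => h.locInj_sheetPair x y' (hmem' r)) (mem_univ 0)
      (by rw [c.source]; exact h0 y')
    have h2 := hall (mem_univ 1)
    simp only [c.target, Set.Icc.coe_one, h1, hb] at h2
    have h3 := h.sheet_unique (Sum.inr y') (Sum.inr y) _ (neg_I_mem_closedHalf y') rfl h2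
    rw [← Sum.inr_injective h3]
    exact hy'
  · intro hxy
    refine ⟨⟨⟨fun r => sheetPair σ x y (crossingCoord s r), hcont y hxy⟩, h0 y, ?_⟩, fun r => ?_⟩
    · rw [hb]
      exact h1 y
    · exact h.map_sheetPair x y (hmem' r)

theorem bijective_cross (h : IsSheeting T.proj β.point t G σ) :
    Function.Bijective fun x : G.Cross => (⟨σ (Sum.inl x) Complex.I,
      h.map_sheet _ _ (I_mem_closedHalf x)⟩ : {x : T.carrier // T.proj x = β.crossPt}) := by
  constructor
  · intro x x' hxx
    exact Sum.inl_injective (h.sheet_unique (Sum.inl x) (Sum.inl x') _ (I_mem_closedHalf x) rfl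
      (Subtype.ext_iff.1 hxx))
  · rintro ⟨x, hx⟩
    obtain ⟨v, hv, hvx⟩ := h.exists_sheet x Complex.I 1 (Or.inl rfl)
      (openHalf_subset_closedHalf _ (by simp)) hx
    rcases v with v | v
    · exact ⟨v, Subtype.ext hvx⟩
    · rw [sign_inr] at hv; norm_num at hv

theorem bijective_circ (h : IsSheeting T.proj β.point t G σ) :
    Function.Bijective fun y : G.Circ => (⟨σ (Sum.inr y) (-Complex.I),
      h.map_sheet _ _ (neg_I_mem_closedHalf y)⟩ : {y : T.carrier // T.proj y = β.circPt}) := by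
  constructor
  · intro x x' hxx
    exact Sum.inr_injective (h.sheet_unique (Sum.inr x) (Sum.inr x') _ (neg_I_mem_closedHalf x) rfl
      (Subtype.ext_iff.1 hxx))
  · rintro ⟨x, hx⟩
    obtain ⟨v, hv, hvx⟩ := h.exists_sheet x (-Complex.I) (-1) (Or.inr rfl)
      (openHalf_subset_closedHalf _ (by simp)) hx
    rcases v with v | v
    · rw [sign_inl] at hv; norm_num at hv
    · exact ⟨v, Subtype.ext hvx⟩

/-- A half-plane decomposition identifies its graph with the Speiser graph. -/
noncomputable def iso (h : IsSheeting T.proj β.point t G σ) (ht : StrictMono t) :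
    G.Iso (T.speiserGraph β t) where
  cross := Equiv.ofBijective _ h.bijective_cross
  circ := Equiv.ofBijective _ h.bijective_circ
  edge_iff j x y := by
    constructor
    · rintro ⟨s, hs, hc⟩
      exact (h.edge_iff_exists_path ht hs x y rfl rfl).1 hc
    · intro hxy
      obtain ⟨s, hs⟩ := nonempty_arc ht j
      exact ⟨s, hs, (h.edge_iff_exists_path ht hs x y rfl rfl).2 hxy⟩

/-- A preconnected set over an open half-plane that meets the sheet of a vertex is contained in
it. -/
theorem subset_image_vertexHalf (h : IsSheeting T.proj β.point t G σ) (v : G.Vertex)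
    {A : Set T.carrier} (hA : IsPreconnected A) (hAp : A ⊆ T.proj ⁻¹' (β.point '' vertexHalf v))
    {z : ℂ} (hz : z ∈ vertexHalf v) (hzA : σ v z ∈ A) : A ⊆ σ v '' vertexHalf v := by
  have hco : ∀ x ∈ A, T.coord β x ∈ vertexHalf v ∧ T.proj x = β.point (T.coord β x) := by
    intro x hx
    obtain ⟨w, hw, hwx⟩ := hAp hx
    rw [T.coord_eq β hwx.symm]
    exact ⟨hw, hwx.symm⟩
  have hall := hA.eqOn_of_lift (f := fun x => σ v (T.coord β x)) (g := fun x => x) ?_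
    continuousOn_id T.proj ?_ ?_ hzA ?_
  · exact fun x hx => ⟨T.coord β x, (hco x hx).1, hall hx⟩
  · exact (h.continuousOn v).comp
      (fun x hx => (T.continuousAt_coord β (hco x hx).2).continuousWithinAt)
      fun x hx => vertexHalf_subset v (hco x hx).1
  · intro x hx
    rw [h.map_sheet v _ (vertexHalf_subset v (hco x hx).1), (hco x hx).2.symm]
  · intro x hx _
    have h1 := vertexHalf_subset (t := t) v (hco x hx).1
    exact h.locInj _ _ h1.2 (h.map_sheet v _ h1)
  · rw [T.coord_eq β (h.map_sheet v _ (vertexHalf_subset v hz))]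

theorem connectedComponentIn_eq (h : IsSheeting T.proj β.point t G σ) (v : G.Vertex) {z : ℂ}
    (hz : z ∈ vertexHalf v) :
    connectedComponentIn (T.proj ⁻¹' (β.point '' vertexHalf v)) (σ v z) = σ v '' vertexHalf v := by
  have hmap : σ v '' vertexHalf v ⊆ T.proj ⁻¹' (β.point '' vertexHalf v) := by
    rintro _ ⟨w, hw, rfl⟩
    exact ⟨w, hw, (h.map_sheet v w (vertexHalf_subset v hw)).symm⟩
  have hmem : σ v z ∈ σ v '' vertexHalf v := ⟨z, hz, rfl⟩
  refine Subset.antisymm ?_ ?_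
  · exact h.subset_image_vertexHalf v isPreconnected_connectedComponentIn
      (connectedComponentIn_subset _ _) hz (mem_connectedComponentIn (hmap hmem))
  · exact ((isPreconnected_vertexHalf v).image _
      ((h.continuousOn v).mono (vertexHalf_subset v))).subset_connectedComponentIn hmem hmap

theorem hemisphere_iso (h : IsSheeting T.proj β.point t G σ) (ht : StrictMono t) (v : G.Vertex) :
    T.hemisphere β t ((h.iso ht).vertex v) = σ v '' vertexHalf v := by
  rcases v with x | y
  · have h1 := h.connectedComponentIn_eq (Sum.inl x) (z := Complex.I) (by simp [vertexHalf])
    rw [← h1, vertexHalf_inl]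
    rfl
  · have h1 := h.connectedComponentIn_eq (Sum.inr y) (z := -Complex.I) (by simp [vertexHalf])
    rw [← h1, vertexHalf_inr]
    rfl

theorem mem_closure_hemisphere_iso (h : IsSheeting T.proj β.point t G σ) (ht : StrictMono t)
    {v : G.Vertex} {z : ℂ} (hz : 0 ≤ sign v * z.im) {b : T.carrier}
    (hb : Tendsto (σ v) (𝓝[vertexHalf v] z) (𝓝 b)) :
    b ∈ closure (T.hemisphere β t ((h.iso ht).vertex v)) := by
  rw [h.hemisphere_iso ht v]
  have : (𝓝[vertexHalf v] z).NeBot :=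
    (neBot_nhdsWithin_vertexHalf hz).mono (nhdsWithin_mono _ sdiff_subset)
  exact mem_closure_of_tendsto hb (by
    filter_upwards [self_mem_nhdsWithin] with w hw using ⟨w, hw, rfl⟩)

/-- At a point in the closure of a sheet where the surface is not ramified, the parametrization of
the sheet extends continuously. -/
theorem tendsto_of_mem_closure (h : IsSheeting T.proj β.point t G σ) {v : G.Vertex} {b : T.carrier}
    (hcr : ¬ T.IsCriticalPoint b) (hb : b ∈ closure (σ v '' vertexHalf v)) {z : ℂ}
    (hz : T.proj b = β.point z) :
    0 ≤ sign v * z.im ∧ Tendsto (σ v) (𝓝[vertexHalf v] z) (𝓝 b) := by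
  have hmap : ∀ w ∈ vertexHalf v, T.proj (σ v w) = β.point w := fun w hw =>
    h.map_sheet v w (vertexHalf_subset v hw)
  constructor
  · have h1 : MapsTo (T.coord β) (σ v '' vertexHalf v) (vertexHalf v) := by
      rintro _ ⟨w, hw, rfl⟩
      rwa [T.coord_eq β (hmap w hw)]
    have h2 := (T.continuousAt_coord β hz).continuousWithinAt.mem_closure hb h1
    rw [T.coord_eq β hz] at h2
    have h3 : IsClosed {w : ℂ | 0 ≤ sign v * w.im} :=
      isClosed_le continuous_const (continuous_const.mul Complex.continuous_im)
    have hsub : vertexHalf v ⊆ {w : ℂ | 0 ≤ sign v * w.im} := fun w hw => (le_of_lt hw : 0 ≤ sign v * w.im)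
    exact closure_minimal hsub h3 h2
  · obtain ⟨N, hN, hNi⟩ := not_not.1 hcr
    obtain ⟨U, s, hUo, hbU, -, hsU, hVo, hsc⟩ := exists_local_section T.isOpenMap_proj hN hNi
    have h1 : β.point ⁻¹' (T.proj '' U) ∈ 𝓝 z :=
      β.continuous_point.continuousAt (hVo.mem_nhds ⟨b, hbU, hz⟩)
    obtain ⟨ε, hε, hB⟩ := Metric.mem_nhds_iff.1 h1
    have h2 : T.coord β ⁻¹' Metric.ball z ε ∩ U ∈ 𝓝 b := by
      refine inter_mem (T.continuousAt_coord β hz ?_) (hUo.mem_nhds hbU)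
      rw [T.coord_eq β hz]
      exact Metric.ball_mem_nhds z hε
    obtain ⟨_, ⟨hyB, hyU⟩, w, hw, rfl⟩ := mem_closure_iff_nhds.1 hb _ h2
    rw [mem_preimage, T.coord_eq β (hmap w hw)] at hyB
    -- A small half-disk is convex, so agreement of the sheet with the local inverse at one point
    -- spreads over it, also when `z` lies on the real line.
    have hpre : IsPreconnected (Metric.ball z ε ∩ vertexHalf v) := by
      refine ((convex_ball z ε).inter ?_).isPreconnected
      rcases v with x | y
      · rw [vertexHalf_inl]
        exact convex_halfSpace_im_gt 0
      · rw [vertexHalf_inr]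
        exact convex_halfSpace_im_lt 0
    have hsp : ∀ w ∈ T.proj '' U, T.proj (s w) = w := by
      rintro _ ⟨x, hx, rfl⟩
      rw [hsU x hx]
    have hall := hpre.eqOn_of_lift (f := σ v) (g := fun w => s (β.point w))
      ((h.continuousOn v).mono fun w hw => vertexHalf_subset v hw.2)
      (hsc.comp β.continuous_point.continuousOn fun w hw => hB hw.1) T.proj
      (fun w hw => by rw [hsp _ (hB hw.1), hmap w hw.2])
      (fun w hw _ => h.locInj _ w (vertexHalf_subset (t := t) v hw.2).2 (hmap w hw.2)) ⟨hyB, hw⟩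
      (by rw [← hmap w hw, hsU _ hyU])
    have h3 : Tendsto (fun w => s (β.point w)) (𝓝 z) (𝓝 b) := by
      have h4 := (hsc.continuousAt (hVo.mem_nhds ⟨b, hbU, hz⟩)).tendsto.comp
        β.continuous_point.continuousAt.tendsto
      rwa [← hz, hsU b hbU] at h4
    refine (h3.mono_left nhdsWithin_le_nhds).congr' ?_
    filter_upwards [self_mem_nhdsWithin, mem_nhdsWithin_of_mem_nhds (Metric.ball_mem_nhds z hε)]
      with w hw hwB using (hall ⟨hwB, hw⟩).symm

/-- Transport of a half-plane decomposition along an isomorphism of labeled graphs. -/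
theorem reindex {X S : Type*} [TopologicalSpace X] {π : X → S} {pt : ℂ → S}
    {σ : G.Vertex → ℂ → X} (h : IsSheeting π pt t G σ) {H : LabeledGraph.{w} (m + 1)}
    (ι : H.Iso G) : IsSheeting π pt t H (fun v => σ (ι.vertex v)) := by
  have hs : ∀ v, sign (ι.vertex v) = sign v := by
    rintro (x | y) <;> rfl
  have hinj : Function.Injective ι.vertex :=
    Function.Injective.sumMap ι.cross.injective ι.circ.injective
  have hsurj : Function.Surjective ι.vertex :=
    Function.Surjective.sumMap ι.cross.surjective ι.circ.surjective
  refine ⟨fun v => ?_, fun v => ?_, fun x z ε hε hz hx => ?_, fun v v' z hz hv hvv => ?_,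
    fun j x y s hs => ?_, h.locInj⟩
  · rw [← hs v]
    exact h.continuousOn _
  · rw [← hs v]
    exact h.map_sheet _
  · obtain ⟨v, hv, hvx⟩ := h.exists_sheet x z ε hε hz hx
    obtain ⟨v', rfl⟩ := hsurj v
    exact ⟨v', (hs v').symm.trans hv, hvx⟩
  · rw [← hs v] at hz
    exact hinj (h.sheet_unique _ _ z hz (by rw [hs, hs, hv]) hvv)
  · rw [← ι.edge_iff]
    exact h.edge_iff j _ _ s hs

end IsSheeting

/-! ### Path lifting, and the decomposition along the Speiser graph -/

namespace SpreadSurface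

variable {X : SpreadSurface.{u}}

theorem eqOn_lift {δ : ℝ → OnePoint ℂ}
    (hinj : ∀ x, ∀ r ∈ Icc (0 : ℝ) 1, X.proj x = δ r → ∃ N ∈ 𝓝 x, InjOn X.proj N) {A : Set ℝ}
    (hA : IsPreconnected A) (hA1 : A ⊆ Icc 0 1) {γ γ' : ℝ → X.carrier} (hγ : ContinuousOn γ A)
    (hγ' : ContinuousOn γ' A) (hp : ∀ r ∈ A, X.proj (γ r) = δ r)
    (hp' : ∀ r ∈ A, X.proj (γ' r) = δ r) {r₀ : ℝ} (hr₀ : r₀ ∈ A) (h : γ r₀ = γ' r₀) :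
    EqOn γ γ' A :=
  hA.eqOn_of_lift hγ hγ' X.proj (fun r hr => (hp r hr).trans (hp' r hr).symm)
    (fun r hr _ => hinj _ r (hA1 hr) (hp r hr)) hr₀ h

/-- A half-open lift of a path that avoids the asymptotic values has a cluster point at its end. -/
theorem exists_mapClusterPt_lift {γ : ℝ → X.carrier} {a : ℝ} (ha : 0 < a)
    (hγ : ContinuousOn γ (Ico 0 a)) {δ : ℝ → OnePoint ℂ} (hδ : Continuous δ)
    (hp : ∀ r ∈ Ico 0 a, X.proj (γ r) = δ r) (has : ¬ X.IsAsymptoticValue (δ a)) :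
    ∃ q, MapClusterPt q (𝓝[<] a) γ := by
  refine exists_mapClusterPt_of_not_tendsto_cocompact fun hc => has ?_
  have hmaps : MapsTo (fun r : ℝ => a * r) (Ico 0 1) (Ico 0 a) := fun r hr =>
    ⟨mul_nonneg ha.le hr.1, by nlinarith [hr.2]⟩
  have hcont : Continuous fun r : ℝ => a * r := by fun_prop
  have hlim : Tendsto (fun r : ℝ => a * r) (𝓝[<] 1) (𝓝[<] a) := by
    refine tendsto_nhdsWithin_iff.2 ⟨?_, ?_⟩
    · have h := hcont.tendsto 1
      rw [mul_one] at h
      exact h.mono_left nhdsWithin_le_nhds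
    · filter_upwards [self_mem_nhdsWithin] with r hr
      have hr' : r < 1 := hr
      exact (show a * r < a by nlinarith)
  refine ⟨fun r => γ (a * r), hγ.comp hcont.continuousOn hmaps, hc.comp hlim, ?_⟩
  refine Tendsto.congr' ?_ (((hδ.tendsto a).mono_left nhdsWithin_le_nhds).comp hlim)
  filter_upwards [Ioo_mem_nhdsLT one_pos] with r hr
  exact (hp _ (hmaps ⟨hr.1.le, hr.2⟩)).symm

/-- Paths that avoid the asymptotic values and over which there are no critical points can be
lifted. -/
theorem exists_lift_Icc {δ : ℝ → OnePoint ℂ} (hδ : Continuous δ)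
    (hinj : ∀ x, ∀ r ∈ Icc (0 : ℝ) 1, X.proj x = δ r → ∃ N ∈ 𝓝 x, InjOn X.proj N)
    (has : ∀ r ∈ Icc (0 : ℝ) 1, ¬ X.IsAsymptoticValue (δ r)) {x : X.carrier}
    (hx : X.proj x = δ 0) :
    ∃ γ : ℝ → X.carrier, ContinuousOn γ (Icc 0 1) ∧ γ 0 = x ∧
      ∀ r ∈ Icc (0 : ℝ) 1, X.proj (γ r) = δ r := by
  -- The times up to which a lift exists; `hext` continues lifts past the supremum, unless the end
  -- of the interval is reached.
  set S : Set ℝ := {a | a ∈ Icc (0 : ℝ) 1 ∧ ∃ γ : ℝ → X.carrier, ContinuousOn γ (Icc 0 a) ∧ γ 0 = x ∧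
    ∀ r ∈ Icc (0 : ℝ) a, X.proj (γ r) = δ r} with hS
  have hsec : ∀ q, ∀ r₀ ∈ Icc (0 : ℝ) 1, X.proj q = δ r₀ → ∃ (U : Set X.carrier)
      (s : OnePoint ℂ → X.carrier), IsOpen U ∧ q ∈ U ∧ (∀ x ∈ U, s (X.proj x) = x) ∧
      (∀ w ∈ X.proj '' U, X.proj (s w) = w) ∧ ContinuousOn s (X.proj '' U) ∧
      ∃ η > 0, ∀ r, |r - r₀| < η → δ r ∈ X.proj '' U := by
    intro q r₀ hr₀ hq
    obtain ⟨N, hN, hNi⟩ := hinj q r₀ hr₀ hq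
    obtain ⟨U, s, hUo, hqU, -, hsU, hVo, hsc⟩ := exists_local_section X.isOpenMap_proj hN hNi
    refine ⟨U, s, hUo, hqU, hsU, ?_, hsc, ?_⟩
    · rintro _ ⟨x, hx, rfl⟩
      rw [hsU x hx]
    · obtain ⟨η, hη, h⟩ := Metric.mem_nhds_iff.1 (hδ.continuousAt (hVo.mem_nhds ⟨q, hqU, hq⟩))
      exact ⟨η, hη, fun r hr => h (by rwa [Metric.mem_ball, Real.dist_eq])⟩
  have hstart : ∃ a ∈ S, 0 < a := by
    obtain ⟨U, s, -, hqU, hsU, hsp, hsc, η, hη, hη'⟩ := hsec x 0 (by simp) hx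
    have hmem : ∀ r ∈ Icc (0 : ℝ) (min 1 (η / 2)), δ r ∈ X.proj '' U := fun r hr => by
      refine hη' r ?_
      rw [sub_zero, abs_of_nonneg hr.1]
      linarith [hr.2.trans (min_le_right _ _)]
    refine ⟨min 1 (η / 2), ⟨⟨by positivity, min_le_left _ _⟩, fun r => s (δ r),
      hsc.comp hδ.continuousOn hmem, ?_, fun r hr => hsp _ (hmem r hr)⟩, by positivity⟩
    exact (congrArg s hx.symm).trans (hsU x hqU)
  have hdown : ∀ a ∈ S, ∀ b, 0 ≤ b → b ≤ a → b ∈ S := by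
    rintro a ⟨ha, γ, h1, h2, h3⟩ b hb0 hba
    exact ⟨⟨hb0, hba.trans ha.2⟩, γ, h1.mono (Icc_subset_Icc_right hba), h2,
      fun r hr => h3 r ⟨hr.1, hr.2.trans hba⟩⟩
  have hext : ∀ a, 0 < a → a ≤ 1 → (∀ b, 0 ≤ b → b < a → b ∈ S) → ∃ a' ∈ S, a < a' ∨ a' = 1 := by
    intro a ha0 ha1 hall
    choose! γ hγ using fun b (hb : 0 ≤ b ∧ b < a) => (hall b hb.1 hb.2).2
    have hag : ∀ b c, 0 ≤ b → b < a → 0 ≤ c → c < a → ∀ r, 0 ≤ r → r ≤ b → r ≤ c →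
        γ b r = γ c r := by
      intro b c hb hba hc hca r hr hrb hrc
      obtain ⟨h1, h2, h3⟩ := hγ b ⟨hb, hba⟩
      obtain ⟨h1', h2', h3'⟩ := hγ c ⟨hc, hca⟩
      exact eqOn_lift hinj isPreconnected_Icc
        (fun r' hr' => ⟨hr'.1, hr'.2.trans (hrb.trans (hba.le.trans ha1))⟩)
        (h1.mono (Icc_subset_Icc_right hrb)) (h1'.mono (Icc_subset_Icc_right hrc))
        (fun r' hr' => h3 r' ⟨hr'.1, hr'.2.trans hrb⟩)
        (fun r' hr' => h3' r' ⟨hr'.1, hr'.2.trans hrc⟩) (left_mem_Icc.2 hr) (h2.trans h2'.symm)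
        (right_mem_Icc.2 hr)
    -- All lifts agree where they are defined; at `r` the lift up to the midpoint of `r` and `a` is
    -- used, so that it is defined beyond `r`.
    set Γ : ℝ → X.carrier := fun r => γ ((r + a) / 2) r with hΓ
    have hΓγ : ∀ b, 0 ≤ b → b < a → EqOn Γ (γ b) (Icc 0 b) := fun b hb hba r hr =>
      hag _ _ (by linarith [hr.1]) (by linarith [hr.2]) hb hba r hr.1 (by linarith [hr.2]) hr.2
    have hΓp : ∀ r ∈ Ico 0 a, X.proj (Γ r) = δ r := fun r hr => by
      rw [hΓγ r hr.1 hr.2 (right_mem_Icc.2 hr.1)]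
      exact (hγ r hr).2.2 r (right_mem_Icc.2 hr.1)
    have hΓc : ContinuousOn Γ (Ico 0 a) := by
      intro r hr
      have hb : r < (r + a) / 2 := by linarith [hr.2]
      have hb' : (r + a) / 2 < a := by linarith [hr.2]
      have hb0 : 0 ≤ (r + a) / 2 := by linarith [hr.1]
      have h1 : ContinuousOn Γ (Icc 0 ((r + a) / 2)) :=
        (hγ _ ⟨hb0, hb'⟩).1.congr (hΓγ _ hb0 hb')
      refine (h1 r ⟨hr.1, hb.le⟩).mono_of_mem_nhdsWithin ?_
      filter_upwards [self_mem_nhdsWithin, mem_nhdsWithin_of_mem_nhds (Iio_mem_nhds hb)]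
        with r' hr' hr'' using ⟨hr'.1, le_of_lt hr''⟩
    -- Without a cluster point the lift would be an asymptotic path. A local inverse near `q` takes
    -- over from the lift at a time `r₁` close to `a`.
    obtain ⟨q, hq⟩ := exists_mapClusterPt_lift ha0 hΓc hδ hΓp (has a ⟨ha0.le, ha1⟩)
    have hev : ∀ᶠ r in 𝓝[<] a, r ∈ Ico 0 a := by
      filter_upwards [Ioo_mem_nhdsLT ha0] with r hr using ⟨hr.1.le, hr.2⟩
    have hqa : X.proj q = δ a := by
      have h1 : MapClusterPt (X.proj q) (𝓝[<] a) (fun r => X.proj (Γ r)) :=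
        hq.continuousAt_comp X.continuous_proj.continuousAt
      have h2 : Tendsto (fun r => X.proj (Γ r)) (𝓝[<] a) (𝓝 (δ a)) :=
        ((hδ.tendsto a).mono_left nhdsWithin_le_nhds).congr'
          (hev.mono fun r hr => (hΓp r hr).symm)
      exact eq_of_nhds_neBot (ClusterPt.mono h1 h2)
    obtain ⟨U, s, hUo, hqU, hsU, hsp, hsc, η, hη, hη'⟩ := hsec q a ⟨ha0.le, ha1⟩ hqa
    obtain ⟨r₁, hr₁U, hr₁, hr₁η⟩ : ∃ r, Γ r ∈ U ∧ r ∈ Ico 0 a ∧ a - η < r := by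
      have h2 : ∀ᶠ r in 𝓝[<] a, a - η < r :=
        mem_nhdsWithin_of_mem_nhds (Ioi_mem_nhds (by linarith))
      obtain ⟨r, hr, hr'⟩ :=
        ((hq.frequently (hUo.mem_nhds hqU)).and_eventually (hev.and h2)).exists
      exact ⟨r, hr, hr'⟩
    have hr₁s : s (δ r₁) = Γ r₁ := by rw [← hΓp r₁ hr₁, hsU _ hr₁U]
    set a' := min 1 (a + η / 2) with ha'
    have haa' : a ≤ a' := le_min ha1 (by linarith)
    have hmem : ∀ r ∈ Icc r₁ a', δ r ∈ X.proj '' U := fun r hr => by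
      refine hη' r ?_
      rw [abs_lt]
      constructor <;> linarith [hr.1, hr.2.trans (min_le_right _ _)]
    have hunion : Icc 0 a' = Icc 0 r₁ ∪ Icc r₁ a' :=
      (Icc_union_Icc_eq_Icc hr₁.1 (hr₁.2.le.trans haa')).symm
    refine ⟨a', ⟨⟨ha0.le.trans haa', min_le_left _ _⟩, fun r => if r ≤ r₁ then Γ r else s (δ r),
      ?_, ?_, ?_⟩, ?_⟩
    · rw [hunion]
      refine ContinuousOn.union_of_isClosed ?_ ?_ isClosed_Icc isClosed_Icc
      · exact (hΓc.mono (Icc_subset_Ico_right hr₁.2)).congr fun r hr => if_pos hr.2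
      · refine (hsc.comp hδ.continuousOn hmem).congr fun r hr => ?_
        by_cases h : r ≤ r₁
        · have h' : r = r₁ := le_antisymm h hr.1
          simp [h', hr₁s]
        · exact if_neg h
    · simp only [if_pos hr₁.1]
      rw [hΓγ 0 le_rfl ha0 (by simp)]
      exact (hγ 0 ⟨le_rfl, ha0⟩).2.1
    · intro r hr
      by_cases h : r ≤ r₁
      · simp only [if_pos h]
        exact hΓp r ⟨hr.1, h.trans_lt hr₁.2⟩
      · simp only [if_neg h]
        exact hsp _ (hmem r ⟨le_of_not_ge h, hr.2⟩)
    · rcases le_total 1 (a + η / 2) with h | h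
      · exact Or.inr (min_eq_left h)
      · exact Or.inl (by rw [ha', min_eq_right h]; linarith)
  obtain ⟨a₀, ha₀, ha₀0⟩ := hstart
  have hbdd : BddAbove S := ⟨1, fun a ha => ha.1.2⟩
  obtain ⟨a', ha', h⟩ := hext (sSup S) (ha₀0.trans_le (le_csSup hbdd ha₀))
    (csSup_le ⟨a₀, ha₀⟩ fun a ha => ha.1.2) fun b hb hba => by
      obtain ⟨c, hc, hbc⟩ := exists_lt_of_lt_csSup ⟨a₀, ha₀⟩ hba
      exact hdown c hc b hb hbc.le
  rcases h with h | h
  · exact absurd (le_csSup hbdd ha') (not_le.2 h)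
  · rw [h] at ha'
    exact ha'.2

variable {β : BaseCurve} {m : ℕ} {t : Fin m → ℝ}

theorem locInj_of_singularValues_subset (hsing : X.singularValues ⊆ range (β.label t))
    (x : X.carrier) (z : ℂ) (hz : z ∈ markedPlane t) (hx : X.proj x = β.point z) :
    ∃ N ∈ 𝓝 x, InjOn X.proj N := by
  by_contra h
  exact β.not_mem_range_label_iff.2 ⟨z, hz, hx⟩ (hsing (Or.inl ⟨x, h, rfl⟩))

/-- The segment from `a` to `z`, seen on the sphere. -/
noncomputable def segment (β : BaseCurve) (a z : ℂ) (r : ℝ) : OnePoint ℂ :=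
  β.point (a + r • (z - a))

theorem continuous_segment (a z : ℂ) : Continuous (segment β a z) :=
  β.continuous_point.comp (by fun_prop)

theorem add_smul_mem_closedHalf {ε : ℝ} (hε : ε = 1 ∨ ε = -1) {z : ℂ} (hz : z ∈ closedHalf t ε)
    {r : ℝ} (hr : r ∈ Icc (0 : ℝ) 1) :
    (ε : ℂ) * Complex.I + r • (z - (ε : ℂ) * Complex.I) ∈ closedHalf t ε :=
  (starConvex_closedHalf hε).add_smul_sub_mem hz hr.1 hr.2

theorem add_smul_mem_closedHalf' {ε : ℝ} (hε : ε = 1 ∨ ε = -1) {z : ℂ} (hz : z ∈ closedHalf t ε)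
    {r : ℝ} (hr : r ∈ Icc (0 : ℝ) 1) :
    z + r • ((ε : ℂ) * Complex.I - z) ∈ closedHalf t ε := by
  have h := add_smul_mem_closedHalf hε hz (r := 1 - r) ⟨by linarith [hr.2], by linarith [hr.1]⟩
  convert h using 1
  simp only [Complex.real_smul]
  push_cast
  ring

theorem exists_lift_segment (hsing : X.singularValues ⊆ range (β.label t)) {a z : ℂ}
    (h : ∀ r ∈ Icc (0 : ℝ) 1, a + r • (z - a) ∈ markedPlane t) {x : X.carrier}
    (hx : X.proj x = β.point a) :
    ∃ γ : ℝ → X.carrier, ContinuousOn γ (Icc 0 1) ∧ γ 0 = x ∧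
      ∀ r ∈ Icc (0 : ℝ) 1, X.proj (γ r) = β.point (a + r • (z - a)) := by
  refine exists_lift_Icc (δ := segment β a z) (continuous_segment a z) ?_ ?_ ?_
  · exact fun x r hr hx => locInj_of_singularValues_subset hsing x _ (h r hr) hx
  · exact fun r hr ha => β.not_mem_range_label_iff.2 ⟨_, h r hr, rfl⟩ (hsing (Or.inr ha))
  · rw [hx, segment, zero_smul, add_zero]

theorem isLocalHomeomorph_unlabeled (hsing : X.singularValues ⊆ range (β.label t)) :
    IsLocalHomeomorph fun x : X.unlabeled β t => X.proj x := by
  rw [isLocalHomeomorph_iff_isOpenEmbedding_restrict]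
  rintro ⟨x, z, hz, hx⟩
  obtain ⟨N, hN, hNi⟩ := locInj_of_singularValues_subset hsing x z hz hx
  have hcont : Continuous fun x : X.unlabeled β t => X.proj x :=
    X.continuous_proj.comp continuous_subtype_val
  refine ⟨Subtype.val ⁻¹' interior N,
    continuous_subtype_val.continuousAt (interior_mem_nhds.2 hN), ?_⟩
  refine IsOpenEmbedding.of_continuous_injective_isOpenMap ?_ ?_ ?_
  · exact hcont.comp continuous_subtype_val
  · intro a b hab
    exact Subtype.ext (Subtype.ext (hNi (interior_subset a.2) (interior_subset b.2) hab))
  · exact (X.isOpenMap_proj.comp (X.isOpen_unlabeled β t).isOpenMap_subtype_val).comp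
      (isOpen_interior.preimage continuous_subtype_val).isOpenMap_subtype_val

/-- Sections of the projection in half-planes. -/
theorem exists_section (hsing : X.singularValues ⊆ range (β.label t)) {ε : ℝ}
    (hε : ε = 1 ∨ ε = -1) {x : X.carrier} (hx : X.proj x = β.point ((ε : ℂ) * Complex.I)) :
    ∃ s : ℂ → X.carrier, ContinuousOn s (closedHalf t ε) ∧ s ((ε : ℂ) * Complex.I) = x ∧
      ∀ z ∈ closedHalf t ε, X.proj (s z) = β.point z := by
  have hlift : ∀ z : closedHalf t ε, ∃ γ : ℝ → X.carrier, ContinuousOn γ (Icc 0 1) ∧ γ 0 = x ∧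
      ∀ r ∈ Icc (0 : ℝ) 1,
        X.proj (γ r) = β.point ((ε : ℂ) * Complex.I + r • (z.1 - (ε : ℂ) * Complex.I)) :=
    fun z => exists_lift_segment hsing (fun r hr => (add_smul_mem_closedHalf hε z.2 hr).2) hx
  choose γ hγc hγ0 hγp using hlift
  have hun : ∀ z, ∀ r : unitInterval, γ z r ∈ X.unlabeled β t := fun z r =>
    ⟨_, (add_smul_mem_closedHalf hε z.2 r.2).2, hγp z r r.2⟩
  set f : C(unitInterval × closedHalf t ε, OnePoint ℂ) :=
    ⟨fun a => β.point ((ε : ℂ) * Complex.I + (a.1 : ℝ) • (a.2.1 - (ε : ℂ) * Complex.I)),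
      β.continuous_point.comp (by fun_prop)⟩ with hf
  -- Each segment is lifted on its own; joint continuity of the lifts comes from the lifting of
  -- homotopies along local homeomorphisms.
  have hcont := (isLocalHomeomorph_unlabeled hsing).continuous_lift
    (T2Space.isSeparatedMap _) f (g := fun a => ⟨γ a.2 a.1, hun a.2 a.1⟩)
    (by
      ext a
      exact hγp a.2 a.1 a.1.2)
    (by
      have h : (fun z : closedHalf t ε => (⟨γ z (0 : unitInterval), hun z 0⟩ : X.unlabeled β t)) =
          fun z => ⟨x, _, (mul_I_mem_closedHalf (t := t) hε).2, hx⟩ :=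
        funext fun z => Subtype.ext (hγ0 z)
      exact h ▸ continuous_const)
    (fun z => Continuous.subtype_mk
      ((hγc z).comp_continuous continuous_subtype_val fun r => r.2) _)
  have hcont1 : Continuous fun z : closedHalf t ε => γ z 1 :=
    (continuous_subtype_val.comp hcont).comp (Continuous.prodMk_right (1 : unitInterval))
  classical
  set s : ℂ → X.carrier := fun z => if hz : z ∈ closedHalf t ε then γ ⟨z, hz⟩ 1 else x with hs
  have hsz : ∀ z : closedHalf t ε, s z = γ z 1 := fun z => dif_pos z.2
  refine ⟨s, ?_, ?_, ?_⟩
  · rw [continuousOn_iff_continuous_domRestrict]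
    exact hcont1.congr fun z => (hsz z).symm
  · have hmem := mul_I_mem_closedHalf (t := t) hε
    rw [hsz ⟨_, hmem⟩]
    have hc : ∀ r : ℝ, (ε : ℂ) * Complex.I + r • ((ε : ℂ) * Complex.I - (ε : ℂ) * Complex.I) =
        (ε : ℂ) * Complex.I := fun r => by simp
    refine eqOn_lift (δ := fun _ => β.point ((ε : ℂ) * Complex.I))
      (fun x r _ hx => locInj_of_singularValues_subset hsing x _ hmem.2 hx) isPreconnected_Icc
      subset_rfl (hγc ⟨_, hmem⟩) continuousOn_const (fun r hr => ?_) (fun _ _ => hx)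
      (left_mem_Icc.2 zero_le_one) (hγ0 ⟨_, hmem⟩) (right_mem_Icc.2 zero_le_one)
    rw [hγp ⟨_, hmem⟩ r hr, hc]
  · intro z hz
    rw [hsz ⟨z, hz⟩, hγp ⟨z, hz⟩ 1 (right_mem_Icc.2 zero_le_one)]
    simp

/-- A surface whose singular values are labels is decomposed into half-planes that are indexed by
its Speiser graph. -/
theorem exists_isSheeting_speiserGraph (ht : StrictMono t)
    (hsing : X.singularValues ⊆ range (β.label t)) :
    ∃ σ : (X.speiserGraph β t).Vertex → ℂ → X.carrier,
      IsSheeting X.proj β.point t (X.speiserGraph β t) σ ∧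
      (∀ x, σ (Sum.inl x) Complex.I = x.1) ∧ ∀ y, σ (Sum.inr y) (-Complex.I) = y.1 := by
  have h1 : ∀ x : (X.speiserGraph β t).Cross, ∃ s : ℂ → X.carrier,
      ContinuousOn s (closedHalf t 1) ∧ s Complex.I = x.1 ∧
      ∀ z ∈ closedHalf t 1, X.proj (s z) = β.point z := fun x => by
    have h := exists_section hsing (ε := 1) (Or.inl rfl) (x := x.1) (by
      rw [Complex.ofReal_one, one_mul]; exact x.2)
    simpa only [Complex.ofReal_one, one_mul] using h
  have h2 : ∀ y : (X.speiserGraph β t).Circ, ∃ s : ℂ → X.carrier,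
      ContinuousOn s (closedHalf t (-1)) ∧ s (-Complex.I) = y.1 ∧
      ∀ z ∈ closedHalf t (-1), X.proj (s z) = β.point z := fun y => by
    have h := exists_section hsing (ε := -1) (Or.inr rfl) (x := y.1) (by
      rw [Complex.ofReal_neg, Complex.ofReal_one, neg_one_mul]; exact y.2)
    simpa only [Complex.ofReal_neg, Complex.ofReal_one, neg_one_mul] using h
  choose s₁ hs₁c hs₁I hs₁p using h1
  choose s₂ hs₂c hs₂I hs₂p using h2
  -- Edges are first defined by agreement of the sheets along the whole arc, which suits a sheeting;
  -- they are identified with the edges of the Speiser graph at the end.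
  set G : LabeledGraph.{u} (m + 1) :=
    { Cross := (X.speiserGraph β t).Cross
      Circ := (X.speiserGraph β t).Circ
      edge := fun j x y => ∀ s ∈ BaseCurve.arc t j, s₁ x (s : ℂ) = s₂ y (s : ℂ) } with hG
  set σ : G.Vertex → ℂ → X.carrier := Sum.elim s₁ s₂ with hσ
  have hσc : ∀ v, ContinuousOn (σ v) (closedHalf t (sign v)) := by
    rintro (x | y)
    · exact hs₁c x
    · exact hs₂c y
  have hσp : ∀ v, ∀ z ∈ closedHalf t (sign v), X.proj (σ v z) = β.point z := by
    rintro (x | y)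
    · exact hs₁p x
    · exact hs₂p y
  have hinj := locInj_of_singularValues_subset hsing
  have hbase : ∀ ε : ℝ, (ε = 1 ∨ ε = -1) → ∀ y, X.proj y = β.point ((ε : ℂ) * Complex.I) →
      ∃ v, sign v = ε ∧ σ v ((ε : ℂ) * Complex.I) = y := by
    rintro ε (rfl | rfl) y hy
    · rw [Complex.ofReal_one, one_mul] at hy ⊢
      exact ⟨Sum.inl ⟨y, hy⟩, rfl, hs₁I ⟨y, hy⟩⟩
    · rw [Complex.ofReal_neg, Complex.ofReal_one, neg_one_mul] at hy ⊢
      exact ⟨Sum.inr ⟨y, hy⟩, rfl, hs₂I ⟨y, hy⟩⟩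
  have hsheet : IsSheeting X.proj β.point t G σ := by
    refine ⟨hσc, hσp, ?_, ?_, ?_, hinj⟩
    · intro x z ε hε hz hx
      -- The sheet through `x` is found by lifting the segment from `z` back to `± i`: the end of
      -- the lift is the vertex.
      obtain ⟨γ, hγc, hγ0, hγp⟩ := exists_lift_segment hsing (a := z)
        (z := (ε : ℂ) * Complex.I) (fun r hr => (add_smul_mem_closedHalf' hε hz hr).2) hx
      obtain ⟨v, hv, hv'⟩ := hbase ε hε (γ 1) (by
        rw [hγp 1 (right_mem_Icc.2 zero_le_one), one_smul, add_sub_cancel])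
      refine ⟨v, hv, ?_⟩
      have hseg : ∀ r ∈ Icc (0 : ℝ) 1,
          z + r • ((ε : ℂ) * Complex.I - z) ∈ closedHalf t (sign v) := fun r hr => by
        rw [hv]
        exact add_smul_mem_closedHalf' hε hz hr
      have hcs : Continuous fun r : ℝ => z + r • ((ε : ℂ) * Complex.I - z) := by fun_prop
      have hall := eqOn_lift (X := X) (δ := segment β z ((ε : ℂ) * Complex.I))
        (fun x r hr hx => hinj x _ (hseg r hr).2 hx) isPreconnected_Icc subset_rfl
        ((hσc v).comp hcs.continuousOn hseg) hγc (fun r hr => hσp v _ (hseg r hr)) hγp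
        (right_mem_Icc.2 zero_le_one) (by
          simp only [Function.comp_apply, one_smul, add_sub_cancel]
          exact hv') (left_mem_Icc.2 zero_le_one)
      simpa [hγ0] using hall
    · intro v v' z hz hvv heq
      have hmem := mul_I_mem_closedHalf (t := t) (sign_eq v)
      have hall : EqOn (σ v) (σ v') (closedHalf t (sign v)) :=
        (isPreconnected_closedHalf (sign_eq v)).eqOn_of_lift (hσc v) (by rw [hvv]; exact hσc v')
          X.proj (fun w hw => (hσp v w hw).trans (hσp v' w (by rwa [← hvv])).symm)
          (fun w hw _ => hinj _ w hw.2 (hσp v w hw)) hz heq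
      have h3 := hall hmem
      rcases v with x | y <;> rcases v' with x' | y'
      · simp only [sign_inl, Complex.ofReal_one, one_mul] at h3
        have h4 : s₁ x Complex.I = s₁ x' Complex.I := h3
        rw [hs₁I, hs₁I] at h4
        rw [Subtype.ext h4]
      · simp only [sign_inl, sign_inr] at hvv
        norm_num at hvv
      · simp only [sign_inl, sign_inr] at hvv
        norm_num at hvv
      · simp only [sign_inr, Complex.ofReal_neg, Complex.ofReal_one, neg_one_mul] at h3
        have h4 : s₂ y (-Complex.I) = s₂ y' (-Complex.I) := h3
        rw [hs₂I, hs₂I] at h4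
        rw [Subtype.ext h4]
    · intro j x y s hs
      refine ⟨fun h => h s hs, fun h s' hs' => ?_⟩
      have hm₁ : ∀ r ∈ BaseCurve.arc t j, (r : ℂ) ∈ closedHalf t 1 := fun r hr =>
        ofReal_mem_closedHalf hr _
      have hm₂ : ∀ r ∈ BaseCurve.arc t j, (r : ℂ) ∈ closedHalf t (-1) := fun r hr =>
        ofReal_mem_closedHalf hr _
      exact (ordConnected_arc j).isPreconnected.eqOn_of_lift (f := fun r : ℝ => s₁ x r)
        (g := fun r : ℝ => s₂ y r)
        ((hs₁c x).comp Complex.continuous_ofReal.continuousOn hm₁)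
        ((hs₂c y).comp Complex.continuous_ofReal.continuousOn hm₂) X.proj
        (fun r hr => (hs₁p x _ (hm₁ r hr)).trans (hs₂p y _ (hm₂ r hr)).symm)
        (fun r hr _ => hinj _ _ (hm₁ r hr).2 (hs₁p x _ (hm₁ r hr))) hs h hs'
  have hedge : ∀ j x y, G.edge j x y ↔ (X.speiserGraph β t).edge j x y := by
    intro j x y
    constructor
    · intro h
      obtain ⟨s, hs⟩ := nonempty_arc ht j
      exact ⟨s, hs, (hsheet.edge_iff_exists_path ht hs x y (hs₁I x).symm (hs₂I y).symm).2 h⟩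
    · rintro ⟨s, hs, hc⟩
      exact (hsheet.edge_iff_exists_path ht hs x y (hs₁I x).symm (hs₂I y).symm).1 hc
  exact ⟨_, hsheet.reindex (H := X.speiserGraph β t)
    ⟨Equiv.refl _, Equiv.refl _, hedge⟩, hs₁I, hs₂I⟩

end SpreadSurface

/-! ### Ignoring the label that tends to the first one -/

/-- The labeled graph whose edges with the index `j` are the edges of `G` with the index `f j`. -/
def LabeledGraph.pick {k l : ℕ} (G : LabeledGraph.{v} k) (f : Fin l → Fin k) :
    LabeledGraph.{v} l where
  Cross := G.Cross
  Circ := G.Circ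
  edge j x y := G.edge (f j) x y

theorem strictMono_of_appendMark {m : ℕ} {t : Fin m → ℝ} {s : ℝ}
    (h : StrictMono (appendMark t s)) : StrictMono t := fun i j hij => by
  have h1 := h (Fin.castSucc_lt_castSucc_iff.2 hij)
  simpa [appendMark] using h1

theorem lt_of_appendMark {m : ℕ} {t : Fin m → ℝ} {s : ℝ} (h : StrictMono (appendMark t s))
    (i : Fin m) : t i < s := by
  have h1 := h (Fin.castSucc_lt_last i)
  simpa [appendMark] using h1

theorem mem_markedPlane_appendMark {m : ℕ} {t : Fin m → ℝ} {s : ℝ} {z : ℂ} :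
    z ∈ markedPlane (appendMark t s) ↔ z ∈ markedPlane t ∧ z ≠ (s : ℂ) := by
  simp [markedPlane, Fin.forall_fin_succ', appendMark]

/-- Appending a label only cuts the old arcs off at `s`; what lies beyond gets the new last index,
the one that `deleteLast` removes. -/
theorem mem_arc_appendMark_castSucc {m : ℕ} {t : Fin m → ℝ} {s : ℝ} {j : Fin (m + 1)} {r : ℝ} :
    r ∈ BaseCurve.arc (appendMark t s) j.castSucc ↔ r ∈ BaseCurve.arc t j ∧ r < s := by
  simp [BaseCurve.arc, Fin.forall_fin_succ', appendMark, Fin.le_last, (Fin.le_last j).not_gt]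

namespace IsSheeting

/-- Pull-back of a half-plane decomposition under a map of the coordinate plane. -/
theorem comp_coord {X S : Type*} [TopologicalSpace X] {π : X → S} {pt : ℂ → S} {l m : ℕ}
    {t : Fin m → ℝ} {t' : Fin l → ℝ} {G : LabeledGraph.{v} (l + 1)} {σ : G.Vertex → ℂ → X}
    (h : IsSheeting π pt t' G σ) {g : ℂ → ℂ} (hg : Continuous g)
    (hgm : ∀ ε, MapsTo g (closedHalf t ε) (closedHalf t' ε)) (f : Fin (m + 1) → Fin (l + 1))
    (hgf : ∀ j, ∀ s ∈ BaseCurve.arc t j, ∃ s' ∈ BaseCurve.arc t' (f j), g s = s') :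
    IsSheeting π (pt ∘ g) t (G.pick f) fun v z => σ v (g z) where
  continuousOn v := (h.continuousOn v).comp hg.continuousOn (hgm _)
  map_sheet v z hz := h.map_sheet v _ (hgm _ hz)
  exists_sheet x z ε hε hz hx := h.exists_sheet x _ ε hε (hgm _ hz) hx
  sheet_unique v v' z hz hv hvv := h.sheet_unique v v' _ (hgm _ hz) hv hvv
  edge_iff j x y s hs := by
    obtain ⟨s', hs', hgs⟩ := hgf j s hs
    rw [hgs]
    exact h.edge_iff (f j) x y s' hs'
  locInj x z hz hx := by
    -- For `ε = 0` the closed half-plane is the whole marked plane.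
    have h0 : g z ∈ markedPlane t' :=
      (hgm 0 (show z ∈ closedHalf t 0 from ⟨by simp, hz⟩)).2
    exact h.locInj x _ h0 hx

/-- The edges with a given index form a perfect matching. -/
theorem exists_matching {X S : Type*} [TopologicalSpace X] {π : X → S} {pt : ℂ → S} {m : ℕ}
    {t : Fin m → ℝ} {G : LabeledGraph.{v} (m + 1)} {σ : G.Vertex → ℂ → X}
    (h : IsSheeting π pt t G σ) (ht : StrictMono t) (j : Fin (m + 1)) :
    ∃ M : G.Cross ≃ G.Circ, ∀ x y, G.edge j x y ↔ M x = y := by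
  choose f hf using h.exists_circ ht j
  refine ⟨Equiv.ofBijective f ⟨fun x x' hxx => ?_, fun y => ?_⟩, fun x y => ⟨fun hxy => ?_, ?_⟩⟩
  · have h1 := hf x
    rw [hxx] at h1
    exact h.cross_unique ht h1 (hf x')
  · obtain ⟨x, hx⟩ := h.exists_cross ht j y
    exact ⟨x, h.circ_unique ht (hf x) hx⟩
  · exact h.circ_unique ht (hf x) hxy
  · rintro rfl
    exact hf x

/-- Graphs formed by the edges of a single index are isomorphic, and an isomorphism can be chosen to
fix a given vertex. -/
theorem exists_iso_pick {X S : Type*} [TopologicalSpace X] {π : X → S} {pt : ℂ → S} {m : ℕ}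
    {t : Fin m → ℝ} {G : LabeledGraph.{v} (m + 1)} {σ : G.Vertex → ℂ → X}
    (h : IsSheeting π pt t G σ) (ht : StrictMono t) (f f' : Fin 1 → Fin (m + 1)) (p : G.Vertex) :
    ∃ ι : (G.pick f).Iso (G.pick f'), ι.vertex p = p := by
  obtain ⟨M, hM⟩ := h.exists_matching ht (f 0)
  obtain ⟨M', hM'⟩ := h.exists_matching ht (f' 0)
  have hj : ∀ j : Fin 1, j = 0 := fun j => Subsingleton.elim j 0
  rcases p with x | y
  · refine ⟨⟨Equiv.refl _, M.symm.trans M', fun j (x : G.Cross) (y : G.Circ) => ?_⟩, rfl⟩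
    rw [hj j]
    have h1 : M' x = M' (M.symm y) ↔ M x = y := by rw [M'.apply_eq_iff_eq, M.eq_symm_apply]
    exact (hM' x _).trans (h1.trans (hM x y).symm)
  · refine ⟨⟨M.trans M'.symm, Equiv.refl _, fun j (x : G.Cross) (y : G.Circ) => ?_⟩, rfl⟩
    rw [hj j]
    have h1 : M' (M'.symm (M x)) = y ↔ M x = y := by rw [M'.apply_symm_apply]
    exact (hM' _ y).trans (h1.trans (hM x y).symm)

end IsSheeting

/-- Clamp the real part from above. -/
noncomputable def clampAbove (c : ℝ) (z : ℂ) : ℂ := ⟨min z.re c, z.im⟩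

/-- Clamp the real part from below. -/
noncomputable def clampBelow (c : ℝ) (z : ℂ) : ℂ := ⟨max z.re c, z.im⟩

theorem continuous_clampAbove (c : ℝ) : Continuous (clampAbove c) := by
  have h : clampAbove c = fun z => ((min z.re c : ℝ) : ℂ) + (z.im : ℂ) * Complex.I :=
    funext fun z => Complex.ext (by simp [clampAbove]) (by simp [clampAbove])
  rw [h]
  fun_prop

theorem continuous_clampBelow (c : ℝ) : Continuous (clampBelow c) := by
  have h : clampBelow c = fun z => ((max z.re c : ℝ) : ℂ) + (z.im : ℂ) * Complex.I :=
    funext fun z => Complex.ext (by simp [clampBelow]) (by simp [clampBelow])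
  rw [h]
  fun_prop

theorem clampAbove_eq {c : ℝ} {z : ℂ} (h : ‖z‖ ≤ c) : clampAbove c z = z :=
  Complex.ext (min_eq_left ((Complex.re_le_norm z).trans h)) rfl

theorem clampBelow_eq {c : ℝ} {z : ℂ} (h : ‖z‖ ≤ -c) : clampBelow c z = z :=
  Complex.ext (max_eq_left (by linarith [neg_abs_le z.re, Complex.abs_re_le_norm z])) rfl

namespace IsSheeting

variable {X S : Type*} [TopologicalSpace X] {π : X → S} {pt : ℂ → S} {m : ℕ} {t : Fin m → ℝ}
  {s c : ℝ} {G : LabeledGraph.{v} (m + 2)} {σ : G.Vertex → ℂ → X}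

/-- Clamping retracts the plane to the part left of `s` that contains all other marks. It preserves
half-planes and arcs, and the arc beyond `s`, whose edges are deleted, is never met. -/
theorem comp_clampAbove (h : IsSheeting π pt (appendMark t s) G σ) (hc : ∀ i, t i < c)
    (hcs : c < s) :
    IsSheeting π (pt ∘ clampAbove c) t G.deleteLast fun v z => σ v (clampAbove c z) := by
  refine h.comp_coord (continuous_clampAbove c) (fun ε z hz => ⟨hz.1, ?_⟩) Fin.castSucc
    fun j r hr => ⟨min r c, ?_, Complex.ext (by simp [clampAbove]) (by simp [clampAbove])⟩
  · rw [mem_markedPlane_appendMark]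
    constructor
    · intro i hi
      have h1 : min z.re c = t i := congrArg Complex.re hi
      have h2 : z.im = 0 := congrArg Complex.im hi
      rcases min_choice z.re c with h3 | h3
      · exact hz.2 i (Complex.ext (by rw [← h3, h1]; rfl) h2)
      · exact (hc i).ne (by rw [← h1, h3])
    · intro hi
      have h1 : min z.re c = s := congrArg Complex.re hi
      linarith [min_le_right z.re c]
  · rw [mem_arc_appendMark_castSucc]
    exact ⟨fun i => ⟨fun hi => lt_min ((hr i).1 hi) (hc i),
      fun hi => (min_le_left _ _).trans_lt ((hr i).2 hi)⟩, (min_le_right _ _).trans_lt hcs⟩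

/-- Without further marks `s` may also tend to `-∞`. Then the visible part of the line is the arc
beyond `s`, with index `1`, and it is the edges with index `0` that drop out. -/
theorem comp_clampBelow {t : Fin 0 → ℝ} {G : LabeledGraph.{v} 2} {σ : G.Vertex → ℂ → X}
    (h : IsSheeting π pt (appendMark t s) G σ) (hcs : s < c) :
    IsSheeting π (pt ∘ clampBelow c) t (G.pick fun _ => 1) fun v z => σ v (clampBelow c z) := by
  refine h.comp_coord (continuous_clampBelow c) (fun ε z hz => ⟨hz.1, ?_⟩) (fun _ => 1)
    fun j r hr => ⟨max r c, ?_, Complex.ext (by simp [clampBelow]) (by simp [clampBelow])⟩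
  · rw [mem_markedPlane_appendMark]
    refine ⟨fun i => i.elim0, fun hi => ?_⟩
    have h1 : max z.re c = s := congrArg Complex.re hi
    linarith [le_max_right z.re c]
  · intro i
    obtain rfl : i = Fin.last 0 := Fin.fin_one_eq_zero i
    refine ⟨fun _ => ?_, fun hi => absurd hi (by decide)⟩
    simp only [appendMark, Fin.snoc_last]
    exact hcs.trans_le (le_max_right _ _)

end IsSheeting

/-- If one of the labels is close to the first one, the surface has a half-plane decomposition with
this label ignored, which in a large disk is compatible with the coordinate. -/
theorem PointedSpreadSurface.exists_isSheeting_deleteLast {β : BaseCurve} {m : ℕ} {t : Fin m → ℝ}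
    {s : ℝ} (horder : StrictMono (appendMark t s)) {X : PointedSpreadSurface.{u}}
    (hsing : X.singularValues ⊆ range (β.label (appendMark t s))) {Γ : LabeledGraph.{v} (m + 2)}
    (ι : Γ.Iso (X.speiserGraph β (appendMark t s))) {p : Γ.Vertex}
    (hp : X.base ∈ closure (X.hemisphere β (appendMark t s) (ι.vertex p))) {z₀ : ℂ}
    (hz₀ : X.proj X.base = β.point z₀) (hs : ‖z₀‖ + 2 ≤ |s|) (hst : ∀ i, |t i| + 2 ≤ |s|) :
    ∃ (g : ℂ → ℂ) (σ : Γ.deleteLast.Vertex → ℂ → X.carrier),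
      IsSheeting X.proj (β.point ∘ g) t Γ.deleteLast σ ∧ (∀ z, ‖z‖ ≤ |s| - 1 → g z = z) ∧
      0 ≤ sign p * z₀.im ∧ Tendsto (σ p) (𝓝[vertexHalf p] z₀) (𝓝 X.base) := by
  obtain ⟨σ', hσ', hσI, hσI'⟩ := SpreadSurface.exists_isSheeting_speiserGraph horder hsing
  have hhalf : vertexHalf (ι.vertex p) = vertexHalf p := by rcases p with x | y <;> rfl
  have hsign : sign (ι.vertex p) = sign p := by rcases p with x | y <;> rfl
  have hhem : X.hemisphere β (appendMark t s) (ι.vertex p) =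
      σ' (ι.vertex p) '' vertexHalf (ι.vertex p) := by
    generalize ι.vertex p = q
    rcases q with x | y
    · rw [← hσ'.connectedComponentIn_eq (Sum.inl x) (z := Complex.I) (by simp [vertexHalf]),
        vertexHalf_inl, hσI]
      rfl
    · rw [← hσ'.connectedComponentIn_eq (Sum.inr y) (z := -Complex.I) (by simp [vertexHalf]),
        vertexHalf_inr, hσI']
      rfl
  rw [hhem] at hp
  obtain ⟨h1, h2⟩ := hσ'.tendsto_of_mem_closure X.base_not_critical hp hz₀
  rw [hsign] at h1
  rw [hhalf] at h2
  have hσ := hσ'.reindex ι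
  -- The margin `2` leaves `|s| - 1` for the clamping bound and a unit disk about `z₀` on which
  -- clamping does nothing.
  have hnear : ∀ g : ℂ → ℂ, (∀ z, ‖z‖ ≤ |s| - 1 → g z = z) →
      Tendsto (fun z => σ' (ι.vertex p) (g z)) (𝓝[vertexHalf p] z₀) (𝓝 X.base) := by
    intro g hg
    refine h2.congr' ?_
    filter_upwards [mem_nhdsWithin_of_mem_nhds (Metric.ball_mem_nhds z₀ one_pos)] with z hz
    rw [hg z]
    have h3 : ‖z - z₀‖ < 1 := by rwa [← dist_eq_norm]
    linarith [norm_le_norm_add_norm_sub' z z₀]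
  rcases le_or_gt 0 s with hs0 | hs0
  · rw [abs_of_nonneg hs0] at hs hst hnear ⊢
    refine ⟨clampAbove (s - 1), _, hσ.comp_clampAbove
      (fun i => by linarith [le_abs_self (t i), hst i]) (by linarith),
      fun z hz => clampAbove_eq hz, h1, hnear _ fun z hz => clampAbove_eq hz⟩
  · rw [abs_of_neg hs0] at hs hst hnear ⊢
    rcases m with _ | m
    -- For two labels the edges of the wrong index survive, but the edges of either index form a
    -- perfect matching, so the two graphs are isomorphic by a map that fixes `p`.
    · obtain ⟨κ, hκ⟩ := hσ.exists_iso_pick horder Fin.castSucc (fun _ => 1) p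
      have hcl : ∀ z : ℂ, ‖z‖ ≤ -s - 1 → clampBelow (s + 1) z = z := fun z hz =>
        clampBelow_eq (by linarith)
      refine ⟨clampBelow (s + 1), _, (hσ.comp_clampBelow (c := s + 1) (by linarith)).reindex κ,
        hcl, h1, ?_⟩
      have h3 := hnear _ hcl
      simp only [hκ]
      exact h3
    -- With another mark `t 0 < s`, the parameter `s` cannot be far out to the left.
    · exact absurd (lt_of_appendMark horder 0)
        (not_lt.2 (by linarith [neg_abs_le (t 0), hst 0]))

/-! ### The theorem -/

theorem theorem4p1
    -- the base curve, the labels `a₁ = β.label t 0, …, a₍ₖ₋₁₎` with `k = m + 2`, and `aₖ(n)`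
    (β : BaseCurve) (m : ℕ) (t : Fin m → ℝ) (s : ℕ → ℝ)
    (horder : ∀ n, StrictMono (appendMark t (s n)))
    (hcollide : Tendsto (fun n => β.point (s n : ℂ)) atTop (𝓝 (β.label t 0)))
    -- the surfaces and their common labeled Speiser graph
    (X : ℕ → PointedSpreadSurface.{u})
    (hsing : ∀ n, (X n).singularValues ⊆ Set.range (β.label (appendMark t (s n))))
    (Γ : LabeledGraph.{v} (m + 2))
    (ι : ∀ n, Γ.Iso ((X n).speiserGraph β (appendMark t (s n))))
    -- the limit and the base points
    (T : PointedSpreadSurface.{u})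
    (hconv : PointedSpreadSurface.CaratheodoryConverges X T)
    (p : Γ.Vertex)
    (hvertex : ∀ n, (X n).base ∈
      closure ((X n).hemisphere β (appendMark t (s n)) ((ι n).vertex p)))
    (hbase : ∀ n, (X n).proj (X n).base = T.proj T.base)
    (hne : T.proj T.base ≠ β.label t 0) :
    T.IsSpeiser ∧
      T.singularValues ⊆ Set.range (β.label t) ∧
      (∀ j : Fin (m + 1), β.label t j ∈ T.singularValues ↔
        (Γ.deleteLast.component p).HasNonDigon j) ∧
      ∃ κ : (Γ.deleteLast.component p).Iso (T.speiserGraph β t),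
        T.base ∈ closure (T.hemisphere β t (κ.vertex (Γ.deleteLast.root p))) := by
  have ht : StrictMono t := strictMono_of_appendMark (horder 0)
  obtain ⟨z₀, hz₀⟩ := β.exists_eq_point t hne
  have hlarge : ∀ R : ℝ, ∀ᶠ n in atTop, R ≤ |s n| := by
    intro R
    filter_upwards [(β.hasBasis_nhds_label_zero t).tendsto_right_iff.1 hcollide R trivial] with n hn
    rcases hn with hn | ⟨z, hz, hn⟩
    · exact absurd hn (β.point_ne_label_zero t _)
    · rw [β.point_inj.1 hn] at hz
      have hz' : R < ‖(s n : ℂ)‖ := hz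
      rw [Complex.norm_real, Real.norm_eq_abs] at hz'
      exact hz'.le
  -- From `N` on, `s n` is far enough from the base value and from the other marks for the clamping.
  obtain ⟨N, hN⟩ := eventually_atTop.1 ((hlarge (‖z₀‖ + 2)).and
    (eventually_all.2 fun i => hlarge (|t i| + 2)))
  choose g σ hσ hg hsign hb using fun n =>
    PointedSpreadSurface.exists_isSheeting_deleteLast (horder (n + N)) (hsing (n + N)) (ι (n + N))
      (hvertex (n + N)) ((hbase (n + N)).trans hz₀) (hN (n + N) (Nat.le_add_left _ _)).1
      (hN (n + N) (Nat.le_add_left _ _)).2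
  have hX : IsSheetedSequence β t Γ.deleteLast p z₀ (fun n => X (n + N)) g σ := by
    refine ⟨hσ, fun R => ?_, fun n => (hbase (n + N)).trans hz₀, hsign 0, hb⟩
    filter_upwards [(tendsto_add_atTop_nat N).eventually (hlarge (R + 1))] with n hn z hz
    exact hg n z (by linarith)
  -- The tail is a subsequence, so `T` is a kernel of it as well.
  have hT : T.IsKernel fun n => X (n + N) :=
    hconv.2 (fun n => n + N) fun a b hab => Nat.add_lt_add_right hab N
  obtain ⟨τ, hτ, hτb⟩ := hT.exists_isSheeting ht hX hz₀
  have hsub := hτ.singularValues_subset ht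
  refine ⟨(finite_range _).subset hsub, hsub,
    hT.label_mem_singularValues_iff ht hX hz₀ hτ hτb, hτ.iso ht,
    hτ.mem_closure_hemisphere_iso ht (z := z₀) ?_ ?_⟩
  · have h1 : sign (Γ.deleteLast.root p) = sign p := by rcases p with x | y <;> rfl
    exact h1.symm ▸ hsign 0
  · have h1 : vertexHalf (Γ.deleteLast.root p) = vertexHalf p := by rcases p with x | y <;> rfl
    rwa [h1]
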